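/- Let $M$ be a torus manifold, that is, a closed connected smooth manifold of dimension $2n$ with a smooth effective action of the torus $T=(S^1)^n$ which has at least one fixed point. For a connected closed subgroup $H\subset T$ let $(M/T)_H=\{Tx\in M/T : (T_x)^0=H\}$, where $(T_x)^0$ is the identity component of the isotropy group of $x$. Let $\mathcal{P}$ be the set of closures in $M/T$ of connected components of the sets $(M/T)_H$ ($H$ ranging over all connected closed subgroups of $T$), partially ordered by inclusion, and let $\lambda(F)=H$ if $F\in\mathcal{P}$ is the closure of a component of $(M/T)_H$. Let $\operatorname{aut}(\mathcal{P},\lambda)\subset\operatorname{aut}(\mathcal{P})\times\operatorname{aut}(T)$ be the group of pairs $(f,g)$ of an automorphism $f$ of the poset $\mathcal{P}$ and a (continuous) automorphism $g$ of $T$ with $\lambda(f(F))=g(\lambda(F))$ for all $F\in\mathcal{P}$. Regard $T$ as a subgroup of the group $\operatorname{Diff}(M)$ of smooth diffeomorphisms and let $\mathcal{D}(M,T)=N_{\operatorname{Diff}(M)}(T)/T$, where $N_{\operatorname{Diff}(M)}(T)$ is the normalizer of $T$. The class of $\varphi\in N_{\operatorname{Diff}(M)}(T)$ acts on $\mathcal{P}$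 through the homeomorphism $Tx\mapsto T\varphi(x)$ of $M/T$ and on $T$ by $t\mapsto\varphi t\varphi^{-1}$; this defines a natural homomorphism $\mathcal{D}(M,T)\to\operatorname{aut}(\mathcal{P},\lambda)$. Let $\mathcal{G}$ be its kernel. Then $\mathcal{G}$ has finite index in $\mathcal{D}(M,T)$, and $\mathcal{G}$ acts freely on the space $\mathcal{R}(M,T)$ of $T$-invariant smooth Riemannian metrics on $M$, on which $\mathcal{D}(M,T)$ acts by pullback of metrics. -/

import Mathlib

set_option linter.unusedSectionVars false

open Set Topology MulAction
open scoped Manifold ContDiff Bundle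

section Diffeomorphisms

variable {d : ℕ} {M : Type*} [TopologicalSpace M] [ChartedSpace (EuclideanSpace ℝ (Fin d)) M]

variable (d M) in
/-- The group of smooth diffeomorphisms of the smooth `d`-manifold `M`. -/
abbrev Diff : Type _ := M ≃ₘ^∞⟮𝓡 d, 𝓡 d⟯ M

noncomputable instance Diff.instGroup : Group (Diff d M) where
  mul φ ψ := ψ.trans φ
  one := Diffeomorph.refl (𝓡 d) M ∞
  inv φ := φ.symm
  mul_assoc _ _ _ := rfl
  one_mul _ := rfl
  mul_one _ := rfl
  inv_mul_cancel φ := Diffeomorph.ext fun x => φ.symm_apply_apply x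

theorem Diff.mul_apply (φ ψ : Diff d M) (x : M) : (φ * ψ) x = φ (ψ x) := rfl

theorem Diff.one_apply (x : M) : (1 : Diff d M) x = x := rfl

theorem Diff.inv_apply_self (φ : Diff d M) (x : M) : φ⁻¹ (φ x) = x := φ.symm_apply_apply x

theorem Diff.apply_inv_self (φ : Diff d M) (x : M) : φ (φ⁻¹ x) = x := φ.apply_symm_apply x

variable [IsManifold (𝓡 d) ∞ M]

variable (d M) in
/-- The set of smooth Riemannian metrics on `M`. -/
abbrev RiemMetric : Type _ :=
  Bundle.ContMDiffRiemannianMetric (𝓡 d) ∞ (EuclideanSpace ℝ (Fin d))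
    (fun x : M => TangentSpace (𝓡 d) x)

namespace RiemMetric

/-- The bilinear form `(v, w) ↦ g_{φ x} (D_xφ v, D_xφ w)` on the tangent space at `x`. -/
noncomputable def pullbackForm (g : RiemMetric d M) (φ : Diff d M) (x : M) :
    TangentSpace (𝓡 d) x →L[ℝ] TangentSpace (𝓡 d) x →L[ℝ] ℝ :=
  ((mfderiv (𝓡 d) (𝓡 d) φ x).precomp ℝ) ∘L (g.inner (φ x)) ∘L (mfderiv (𝓡 d) (𝓡 d) φ x)

theorem pullbackForm_apply (g : RiemMetric d M) (φ : Diff d M) (x : M)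
    (v w : TangentSpace (𝓡 d) x) :
    g.pullbackForm φ x v w =
      g.inner (φ x) (mfderiv (𝓡 d) (𝓡 d) φ x v) (mfderiv (𝓡 d) (𝓡 d) φ x w) := rfl

theorem pullbackForm_contMDiff (g : RiemMetric d M) (φ : Diff d M) :
    ContMDiff (𝓡 d)
      ((𝓡 d).prod 𝓘(ℝ, EuclideanSpace ℝ (Fin d) →L[ℝ] EuclideanSpace ℝ (Fin d) →L[ℝ] ℝ)) ∞
      (fun x : M => Bundle.TotalSpace.mk'
        (EuclideanSpace ℝ (Fin d) →L[ℝ] EuclideanSpace ℝ (Fin d) →L[ℝ] ℝ)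
        (E := fun x : M => TangentSpace (𝓡 d) x →L[ℝ] TangentSpace (𝓡 d) x →L[ℝ] ℝ)
        x (g.pullbackForm φ x)) := by
  intro x₀
  rw [contMDiffAt_hom_bundle]
  refine ⟨contMDiffAt_id, ?_⟩
  have hA := (φ.contMDiffAt (x := x₀)).mfderiv_const (m := ∞) (by simp)
  have hG := (((contMDiffAt_hom_bundle _).1 (g.contMDiff (φ x₀))).2).comp x₀
    (φ.contMDiffAt (x := x₀))
  refine ((hA.clm_precomp (F₃ := ℝ)).clm_comp (hG.clm_comp hA)).congr_of_eventuallyEq ?_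
  have h1 : ∀ᶠ x in 𝓝 x₀, x ∈ (trivializationAt (EuclideanSpace ℝ (Fin d))
      (fun x : M => TangentSpace (𝓡 d) x) x₀).baseSet :=
    (trivializationAt (EuclideanSpace ℝ (Fin d))
      (fun x : M => TangentSpace (𝓡 d) x) x₀).open_baseSet.mem_nhds
      (FiberBundle.mem_baseSet_trivializationAt' x₀)
  have h2 : ∀ᶠ x in 𝓝 x₀, φ x ∈ (trivializationAt (EuclideanSpace ℝ (Fin d))
      (fun x : M => TangentSpace (𝓡 d) x) (φ x₀)).baseSet :=
    φ.continuous.continuousAt.eventually ((trivializationAt (EuclideanSpace ℝ (Fin d))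
      (fun x : M => TangentSpace (𝓡 d) x) (φ x₀)).open_baseSet.mem_nhds
      (FiberBundle.mem_baseSet_trivializationAt' (φ x₀)))
  filter_upwards [h1, h2] with x hx hφx
  ext v w
  have key : ∀ u : EuclideanSpace ℝ (Fin d),
      (trivializationAt (EuclideanSpace ℝ (Fin d)) (fun x : M => TangentSpace (𝓡 d) x)
        (φ x₀)).symm (φ x) (inTangentCoordinates (𝓡 d) (𝓡 d) id φ (mfderiv (𝓡 d) (𝓡 d) φ) x₀ x u)
      = mfderiv (𝓡 d) (𝓡 d) φ x ((trivializationAt (EuclideanSpace ℝ (Fin d))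
        (fun x : M => TangentSpace (𝓡 d) x) x₀).symm x u) := by
    intro u
    rw [← Bundle.Trivialization.symmL_apply (R := ℝ) _ hφx,
      ← Bundle.Trivialization.symmL_apply (R := ℝ) _ hx]
    exact (trivializationAt (EuclideanSpace ℝ (Fin d)) (fun x : M => TangentSpace (𝓡 d) x)
      (φ x₀)).symmL_continuousLinearMapAt (R := ℝ) hφx _
  have e1 := inCoordinates_apply_eq₂ (𝕜 := ℝ) (F₁ := EuclideanSpace ℝ (Fin d))
    (F₂ := EuclideanSpace ℝ (Fin d)) (F₃ := ℝ)
    (E₁ := fun x : M => TangentSpace (𝓡 d) x) (E₂ := fun x : M => TangentSpace (𝓡 d) x)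
    (E₃ := fun _ : M => ℝ) (x₀ := x₀) (ϕ := g.pullbackForm φ x) (v := v) (w := w) hx hx
    (Set.mem_univ _)
  have e2 := fun v w => inCoordinates_apply_eq₂ (𝕜 := ℝ) (F₁ := EuclideanSpace ℝ (Fin d))
    (F₂ := EuclideanSpace ℝ (Fin d)) (F₃ := ℝ)
    (E₁ := fun x : M => TangentSpace (𝓡 d) x) (E₂ := fun x : M => TangentSpace (𝓡 d) x)
    (E₃ := fun _ : M => ℝ) (x₀ := φ x₀) (ϕ := g.inner (φ x)) (v := v) (w := w) hφx hφx
    (Set.mem_univ _)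
  refine e1.trans (Eq.trans ?_ (e2 _ _).symm)
  rw [pullbackForm_apply]
  exact congrArg _ (congrArg₂ (fun a b => g.inner (φ x) a b) (key v).symm (key w).symm)

theorem ext' {g h : RiemMetric d M} (H : ∀ x v w, g.inner x v w = h.inner x v w) : g = h := by
  obtain ⟨g, _, _, _, _⟩ := g
  obtain ⟨h, _, _, _, _⟩ := h
  congr
  ext x v w
  exact H x v w

/-- The pullback metric `φ^* g`. -/
noncomputable def pullback (g : RiemMetric d M) (φ : Diff d M) : RiemMetric d M where
  inner := g.pullbackForm φ
  symm x v w := g.symm _ _ _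
  pos x v hv := by
    refine g.pos _ _ fun h => hv ?_
    exact (φ.mfderivToContinuousLinearEquiv (by simp) x).injective
      (h.trans (map_zero (φ.mfderivToContinuousLinearEquiv (by simp) x)).symm)
  isVonNBounded x := by
    refine ((g.isVonNBounded (φ x)).image
      ((φ.mfderivToContinuousLinearEquiv (by simp) x).symm : _ →L[ℝ] _)).subset ?_
    intro v hv
    exact ⟨mfderiv (𝓡 d) (𝓡 d) φ x v, hv,
      (φ.mfderivToContinuousLinearEquiv (by simp) x).symm_apply_apply v⟩
  contMDiff := g.pullbackForm_contMDiff φ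

theorem pullback_apply (g : RiemMetric d M) (φ : Diff d M) (x : M)
    (v w : TangentSpace (𝓡 d) x) :
    (g.pullback φ).inner x v w =
      g.inner (φ x) (mfderiv (𝓡 d) (𝓡 d) φ x v) (mfderiv (𝓡 d) (𝓡 d) φ x w) := rfl

theorem pullback_one (g : RiemMetric d M) : g.pullback 1 = g := by
  refine ext' fun x v w => ?_
  rw [pullback_apply]
  have h : mfderiv (𝓡 d) (𝓡 d) (1 : Diff d M) x = ContinuousLinearMap.id ℝ _ := mfderiv_id
  rw [h]
  rfl

theorem pullback_mul (g : RiemMetric d M) (φ ψ : Diff d M) :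
    g.pullback (φ * ψ) = (g.pullback φ).pullback ψ := by
  refine ext' fun x v w => ?_
  have h : mfderiv (𝓡 d) (𝓡 d) (φ * ψ : Diff d M) x =
      (mfderiv (𝓡 d) (𝓡 d) φ (ψ x)) ∘L (mfderiv (𝓡 d) (𝓡 d) ψ x) :=
    mfderiv_comp x (φ.mdifferentiable (by simp) _) (ψ.mdifferentiable (by simp) _)
  rw [pullback_apply, pullback_apply, pullback_apply, h]
  rfl

/-- Pullback of metrics as a left action of the diffeomorphism group: `φ • g = (φ⁻¹)^* g`. -/
noncomputable instance : MulAction (Diff d M) (RiemMetric d M) where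
  smul φ g := g.pullback φ⁻¹
  one_smul g := by
    change g.pullback (1 : Diff d M)⁻¹ = g
    rw [inv_one, pullback_one]
  mul_smul φ ψ g := by
    change g.pullback (φ * ψ)⁻¹ = (g.pullback ψ⁻¹).pullback φ⁻¹
    rw [mul_inv_rev, pullback_mul]

theorem smul_def (φ : Diff d M) (g : RiemMetric d M) : φ • g = g.pullback φ⁻¹ := rfl

end RiemMetric

end Diffeomorphisms

section ContinuousAutomorphisms

/-- The continuous automorphisms of a topological group form a group under composition. -/
instance ContinuousMulEquiv.instAutGroup {G : Type*} [TopologicalSpace G] [Group G] :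
    Group (G ≃ₜ* G) where
  mul f g := g.trans f
  one := ContinuousMulEquiv.refl G
  inv f := f.symm
  mul_assoc _ _ _ := rfl
  one_mul _ := rfl
  mul_one _ := rfl
  inv_mul_cancel f := ContinuousMulEquiv.ext fun x => f.symm_apply_apply x

end ContinuousAutomorphisms

section TorusActions

/-- The `n`-dimensional torus `(S¹)ⁿ`. -/
abbrev Torus (n : ℕ) : Type := Fin n → Circle

/-- A smooth effective action of the `n`-torus on a `2n`-dimensional manifold with at least one
fixed point: a torus manifold. -/
class TorusManifold (n : ℕ) (M : Type*) [TopologicalSpace M]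
    [ChartedSpace (EuclideanSpace ℝ (Fin (2 * n))) M] [MulAction (Torus n) M] : Prop where
  smooth : ContMDiff ((ModelWithCorners.pi fun _ : Fin n => 𝓡 1).prod (𝓡 (2 * n))) (𝓡 (2 * n)) ∞
    (fun p : Torus n × M => p.1 • p.2)
  effective : ⨅ x : M, stabilizer (Torus n) x = ⊥
  exists_fixedPoint : ∃ x : M, ∀ t : Torus n, t • x = x

end TorusActions

section Strata

variable {n : ℕ} {M : Type*} [TopologicalSpace M] [MulAction (Torus n) M]

variable (n M) in
/-- The orbit space `M/T`, with the quotient topology. -/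
abbrev OrbitSpace : Type _ := orbitRel.Quotient (Torus n) M

variable (n) in
/-- The orbit `Tx` as a point of the orbit space. -/
noncomputable def orbitMk (x : M) : OrbitSpace n M := Quotient.mk (orbitRel (Torus n) M) x

variable (n) in
/-- The identity component `(T_x)⁰` of the isotropy group of `x`. -/
noncomputable def isotropyZero (x : M) : Subgroup (Torus n) :=
  (Subgroup.connectedComponentOfOne (stabilizer (Torus n) x)).map (stabilizer (Torus n) x).subtype

variable (M) in
/-- The set `(M/T)_H` of all orbits `Tx` with `(T_x)⁰ = H`. -/
def orbitTypeSet (H : Subgroup (Torus n)) : Set (OrbitSpace n M) :=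
  {q | ∃ x : M, q = orbitMk n x ∧ isotropyZero n x = H}

/-- `C` is an open stratum of `M/T` belonging to the connected closed subgroup `H`, that is, a
connected component of `(M/T)_H`. -/
def IsOpenStratum (H : Subgroup (Torus n)) (C : Set (OrbitSpace n M)) : Prop :=
  IsClosed (H : Set (Torus n)) ∧ IsConnected (H : Set (Torus n)) ∧
    ∃ q ∈ orbitTypeSet M H, C = connectedComponentIn (orbitTypeSet M H) q

variable (n M) in
/-- The poset `𝒫` of closed strata of `M/T` (closures of open strata), ordered by inclusion. -/
abbrev ClosedStrata : Type _ :=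
  {F : Set (OrbitSpace n M) // ∃ H C, IsOpenStratum H C ∧ F = closure C}

/-- The characteristic map `λ`: it sends the closure of a component of `(M/T)_H` to `H`
(see `charMap_eq` for the independence of choices). -/
noncomputable def charMap (F : ClosedStrata n M) : Subgroup (Torus n) := F.2.choose

theorem isotropyZero_le (x : M) : isotropyZero n x ≤ stabilizer (Torus n) x := by
  rintro _ ⟨t, -, rfl⟩
  exact t.2

theorem isotropyZero_isConnected (x : M) : IsConnected (isotropyZero n x : Set (Torus n)) := by
  have h : IsConnected (connectedComponent (1 : stabilizer (Torus n) x)) :=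
    isConnected_connectedComponent
  exact h.image _ continuous_subtype_val.continuousOn

theorem le_isotropyZero {x : M} {H : Subgroup (Torus n)} (hH : IsConnected (H : Set (Torus n)))
    (hx : H ≤ stabilizer (Torus n) x) : H ≤ isotropyZero n x := by
  have himage : (Subtype.val '' {t : stabilizer (Torus n) x | t.1 ∈ H} : Set (Torus n)) = H := by
    ext t
    exact ⟨fun ⟨_, hs, h⟩ => h ▸ hs, fun ht => ⟨⟨t, hx ht⟩, ht, rfl⟩⟩
  have hpre : IsPreconnected {t : stabilizer (Torus n) x | t.1 ∈ H} :=
    Topology.IsInducing.subtypeVal.isPreconnected_image.1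
      ((congrArg IsPreconnected himage).mpr hH.isPreconnected)
  intro t ht
  refine ⟨⟨t, hx ht⟩, ?_, rfl⟩
  exact hpre.subset_connectedComponent (x := (1 : stabilizer (Torus n) x)) H.one_mem ht

theorem orbitMk_eq_iff {x y : M} : orbitMk n x = orbitMk n y ↔ ∃ t : Torus n, t • y = x :=
  Quotient.eq.trans orbitRel_apply

theorem stabilizer_smul_eq (t : Torus n) (x : M) :
    stabilizer (Torus n) (t • x) = stabilizer (Torus n) x := by
  ext s
  rw [mem_stabilizer_iff, mem_stabilizer_iff, smul_comm, smul_left_cancel_iff]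

theorem isotropyZero_eq_of_stabilizer_eq {x y : M}
    (h : stabilizer (Torus n) x = stabilizer (Torus n) y) :
    isotropyZero n x = isotropyZero n y :=
  le_antisymm (le_isotropyZero (isotropyZero_isConnected x) (h ▸ isotropyZero_le x))
    (le_isotropyZero (isotropyZero_isConnected y) (h ▸ isotropyZero_le y))

theorem orbitMk_mem_orbitTypeSet {x : M} {H : Subgroup (Torus n)} :
    orbitMk n x ∈ orbitTypeSet M H ↔ isotropyZero n x = H := by
  refine ⟨?_, fun h => ⟨x, rfl, h⟩⟩
  rintro ⟨y, hy, rfl⟩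
  obtain ⟨t, rfl⟩ := orbitMk_eq_iff.1 hy
  exact isotropyZero_eq_of_stabilizer_eq (stabilizer_smul_eq t y)

theorem IsOpenStratum.subset {H : Subgroup (Torus n)} {C : Set (OrbitSpace n M)}
    (h : IsOpenStratum H C) : C ⊆ orbitTypeSet M H := by
  obtain ⟨-, -, q, -, rfl⟩ := h
  exact connectedComponentIn_subset _ _

theorem IsOpenStratum.nonempty {H : Subgroup (Torus n)} {C : Set (OrbitSpace n M)}
    (h : IsOpenStratum H C) : C.Nonempty := by
  obtain ⟨-, -, q, hq, rfl⟩ := h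
  exact ⟨q, mem_connectedComponentIn hq⟩

theorem IsOpenStratum.le_of_mem_closure [T2Space M] [ContinuousConstSMul (Torus n) M]
    {H : Subgroup (Torus n)} {C : Set (OrbitSpace n M)} (h : IsOpenStratum H C) {x : M}
    (hx : orbitMk n x ∈ closure C) : H ≤ isotropyZero n x := by
  let S : Set (OrbitSpace n M) := {q | ∃ y : M, q = orbitMk n y ∧ H ≤ stabilizer (Torus n) y}
  have hS : orbitMk n ⁻¹' S = ⋂ t ∈ H, {y : M | t • y = y} := by
    ext y
    simp only [S, mem_preimage, mem_ofPred_eq, mem_iInter]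
    constructor
    · rintro ⟨z, hz, hH⟩ t ht
      obtain ⟨s, rfl⟩ := orbitMk_eq_iff.1 hz
      rw [← stabilizer_smul_eq s z] at hH
      exact hH ht
    · exact fun hy => ⟨y, rfl, fun t ht => hy t ht⟩
  have hclosed : IsClosed S := by
    refine (isQuotientMap_quotient_mk' (s := orbitRel (Torus n) M)).isClosed_preimage.1 ?_
    change IsClosed (orbitMk n ⁻¹' S)
    rw [hS]
    exact isClosed_biInter fun t _ => isClosed_eq (continuous_const_smul t) continuous_id
  have hCS : C ⊆ S := by
    intro q hq
    obtain ⟨y, rfl, hy⟩ := h.subset hq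
    exact ⟨y, rfl, hy ▸ isotropyZero_le y⟩
  have hxS : x ∈ orbitMk n ⁻¹' S := closure_minimal hCS hclosed hx
  rw [hS] at hxS
  exact le_isotropyZero h.2.1 fun t ht => mem_iInter₂.1 hxS t ht

theorem IsOpenStratum.eq_of_closure_eq [T2Space M] [ContinuousConstSMul (Torus n) M]
    {H H' : Subgroup (Torus n)} {C C' : Set (OrbitSpace n M)} (h : IsOpenStratum H C)
    (h' : IsOpenStratum H' C') (hCC : closure C = closure C') : H = H' := by
  have aux : ∀ {H H' : Subgroup (Torus n)} {C C' : Set (OrbitSpace n M)}, IsOpenStratum H C →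
      IsOpenStratum H' C' → closure C = closure C' → H ≤ H' := by
    intro H H' C C' h h' hCC
    obtain ⟨q, hq⟩ := h'.nonempty
    obtain ⟨x, rfl, rfl⟩ := h'.subset hq
    exact h.le_of_mem_closure (hCC ▸ subset_closure hq)
  exact le_antisymm (aux h h' hCC) (aux h' h hCC.symm)

/-- `λ(F) = H` whenever `F` is the closure of a component of `(M/T)_H`. -/
theorem charMap_eq [T2Space M] [ContinuousConstSMul (Torus n) M] {F : ClosedStrata n M}
    {H : Subgroup (Torus n)} {C : Set (OrbitSpace n M)} (h : IsOpenStratum H C)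
    (hF : F.1 = closure C) : charMap F = H := by
  obtain ⟨C', h', hF'⟩ := F.2.choose_spec
  exact h'.eq_of_closure_eq h (hF'.symm.trans hF)

theorem charMap_isClosed (F : ClosedStrata n M) : IsClosed (charMap F : Set (Torus n)) := by
  obtain ⟨C', h', -⟩ := F.2.choose_spec
  exact h'.1

theorem charMap_isConnected (F : ClosedStrata n M) : IsConnected (charMap F : Set (Torus n)) := by
  obtain ⟨C', h', -⟩ := F.2.choose_spec
  exact h'.2.1

variable (n M) in
/-- The group `Aut(𝒫, λ)`: pairs `(f, g)` of an automorphism `f` of the poset `𝒫` and an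
automorphism `g` of the torus with `λ(f(F)) = g(λ(F))` for all `F ∈ 𝒫`. -/
def charPairAut : Subgroup ((ClosedStrata n M ≃o ClosedStrata n M) × (Torus n ≃ₜ* Torus n)) where
  carrier := {p | ∀ F, charMap (p.1 F) = (charMap F).map (p.2 : Torus n →* Torus n)}
  one_mem' F := (Subgroup.map_id _).symm
  mul_mem' {p q} hp hq F := by
    change charMap (p.1 (q.1 F)) = _
    rw [hp, hq, Subgroup.map_map]
    rfl
  inv_mem' {p} hp F := by
    have h := hp (p.1⁻¹ F)
    have h1 : p.1 (p.1⁻¹ F) = F := p.1.apply_symm_apply F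
    rw [h1] at h
    rw [h, Subgroup.map_map]
    have h2 : ((p⁻¹.2 : Torus n →* Torus n)).comp (p.2 : Torus n →* Torus n) =
        MonoidHom.id (Torus n) := MonoidHom.ext fun t => p.2.symm_apply_apply t
    rw [h2, Subgroup.map_id]
    rfl

end Strata

section NormalizerQuotient

variable {n : ℕ} {M : Type*} [TopologicalSpace M]
  [ChartedSpace (EuclideanSpace ℝ (Fin (2 * n))) M] [MulAction (Torus n) M] [TorusManifold n M]

theorem TorusManifold.contMDiff_const_smul (t : Torus n) :
    ContMDiff (𝓡 (2 * n)) (𝓡 (2 * n)) ∞ (fun x : M => t • x) :=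
  (TorusManifold.smooth (n := n) (M := M)).comp
    ((contMDiff_const (c := t)).prodMk contMDiff_id)

theorem TorusManifold.continuous_smul : Continuous (fun p : Torus n × M => p.1 • p.2) :=
  (TorusManifold.smooth (n := n) (M := M)).continuous

theorem TorusManifold.continuousConstSMul : ContinuousConstSMul (Torus n) M :=
  ⟨fun t => (TorusManifold.contMDiff_const_smul t).continuous⟩

variable (n M) in
/-- The homomorphism `T → Diff(M)` given by the action. -/
noncomputable def torusToDiff : Torus n →* Diff (2 * n) M where
  toFun t :=
    { toEquiv := MulAction.toPerm t
      contMDiff_toFun := TorusManifold.contMDiff_const_smul t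
      contMDiff_invFun := TorusManifold.contMDiff_const_smul t⁻¹ }
  map_one' := Diffeomorph.ext fun x => one_smul _ x
  map_mul' s t := Diffeomorph.ext fun x => mul_smul s t x

theorem torusToDiff_apply (t : Torus n) (x : M) : torusToDiff n M t x = t • x := rfl

theorem torus_eq_of_smul_eq {s t : Torus n} (h : ∀ x : M, s • x = t • x) : s = t := by
  have h1 : t⁻¹ * s ∈ ⨅ x : M, stabilizer (Torus n) x := by
    refine Subgroup.mem_iInf.2 fun x => ?_
    rw [mem_stabilizer_iff, mul_smul, h, inv_smul_smul]
  rw [TorusManifold.effective, Subgroup.mem_bot] at h1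
  exact (inv_mul_eq_one.1 h1).symm

theorem torusToDiff_injective : Function.Injective (torusToDiff n M) := fun s t h =>
  torus_eq_of_smul_eq (M := M) fun x => by rw [← torusToDiff_apply, h, torusToDiff_apply]

variable (n M) in
/-- The torus as a subgroup of `Diff(M)`. -/
noncomputable def torusSubgroup : Subgroup (Diff (2 * n) M) := (torusToDiff n M).range

variable (n M) in
/-- The normalizer `N_{Diff(M)}(T)`. -/
abbrev TorusNormalizer : Type _ :=
  Subgroup.normalizer (torusSubgroup n M : Set (Diff (2 * n) M))

variable (n M) in
/-- The group `𝒟(M,T) = N_{Diff(M)}(T) / T`. -/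
abbrev DiffModTorus : Type _ :=
  TorusNormalizer n M ⧸ (torusSubgroup n M).subgroupOf
    (Subgroup.normalizer (torusSubgroup n M : Set (Diff (2 * n) M)))

variable (n M) in
/-- Conjugation by elements of the normalizer, read as automorphisms of the torus. -/
noncomputable def conjTorus : TorusNormalizer n M →* MulAut (Torus n) :=
  (MulAut.congr (MonoidHom.ofInjective (torusToDiff_injective (n := n) (M := M))).symm
    ).toMonoidHom.comp (torusSubgroup n M).normalizerMonoidHom

theorem torusToDiff_conjTorus (φ : TorusNormalizer n M) (t : Torus n) :
    torusToDiff n M (conjTorus n M φ t) = φ.1 * torusToDiff n M t * φ.1⁻¹ := by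
  let e := MonoidHom.ofInjective (torusToDiff_injective (n := n) (M := M))
  have h : e (conjTorus n M φ t) = (torusSubgroup n M).normalizerMonoidHom φ (e t) :=
    e.apply_symm_apply _
  exact congrArg Subtype.val h

theorem normalizer_apply_smul (φ : TorusNormalizer n M) (t : Torus n) (x : M) :
    φ.1 (t • x) = conjTorus n M φ t • φ.1 x := by
  rw [← torusToDiff_apply (conjTorus n M φ t), torusToDiff_conjTorus, Diff.mul_apply,
    Diff.mul_apply, Diff.inv_apply_self, torusToDiff_apply]

/-- The map `Tx ↦ T φ(x)` on `M/T` induced by an element `φ` of the normalizer. -/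
noncomputable def orbitMap (φ : TorusNormalizer n M) : OrbitSpace n M → OrbitSpace n M :=
  Quotient.lift (fun x => orbitMk n (φ.1 x)) fun x y h => by
    obtain ⟨t, rfl⟩ := orbitMk_eq_iff.1 (Quotient.sound h : orbitMk n x = orbitMk n y)
    exact orbitMk_eq_iff.2 ⟨conjTorus n M φ t, (normalizer_apply_smul φ t y).symm⟩

theorem orbitMap_mk (φ : TorusNormalizer n M) (x : M) :
    orbitMap φ (orbitMk n x) = orbitMk n (φ.1 x) := rfl

theorem orbitMap_mul (φ ψ : TorusNormalizer n M) (q : OrbitSpace n M) :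
    orbitMap (φ * ψ) q = orbitMap φ (orbitMap ψ q) := by
  induction q using Quotient.inductionOn with
  | _ x => rfl

theorem orbitMap_one (q : OrbitSpace n M) : orbitMap (1 : TorusNormalizer n M) q = q := by
  induction q using Quotient.inductionOn with
  | _ x => rfl

theorem orbitMap_torus (t : Torus n) (h : torusToDiff n M t ∈
    Subgroup.normalizer (torusSubgroup n M : Set (Diff (2 * n) M))) (q : OrbitSpace n M) :
    orbitMap ⟨torusToDiff n M t, h⟩ q = q := by
  induction q using Quotient.inductionOn with
  | _ x => exact orbitMk_eq_iff.2 ⟨t, rfl⟩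

theorem orbitMap_continuous (φ : TorusNormalizer n M) : Continuous (orbitMap φ) :=
  Continuous.quotient_lift (continuous_quotient_mk'.comp φ.1.continuous) _

/-- The homeomorphism of `M/T` induced by an element of the normalizer. -/
noncomputable def orbitHomeo (φ : TorusNormalizer n M) : OrbitSpace n M ≃ₜ OrbitSpace n M where
  toFun := orbitMap φ
  invFun := orbitMap φ⁻¹
  left_inv q := by rw [← orbitMap_mul, inv_mul_cancel, orbitMap_one]
  right_inv q := by rw [← orbitMap_mul, mul_inv_cancel, orbitMap_one]
  continuous_toFun := orbitMap_continuous φ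
  continuous_invFun := orbitMap_continuous φ⁻¹

theorem orbitHomeo_apply (φ : TorusNormalizer n M) (q : OrbitSpace n M) :
    orbitHomeo φ q = orbitMap φ q := rfl

variable [T2Space M]

theorem conjTorus_continuous (φ : TorusNormalizer n M) : Continuous (conjTorus n M φ) := by
  let f : Torus n → M → M := fun t x => t • x
  have hf : Continuous f := continuous_pi fun x =>
    (TorusManifold.continuous_smul (n := n) (M := M)).comp (by fun_prop : Continuous fun t => (t, x))
  have hinj : Function.Injective f := fun s t h => torus_eq_of_smul_eq (congrFun h)
  rw [(hf.isClosedEmbedding hinj).isInducing.continuous_iff]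
  refine continuous_pi fun x => ?_
  have h : ∀ t : Torus n, conjTorus n M φ t • x = φ.1 (t • φ.1⁻¹ x) := fun t => by
    rw [normalizer_apply_smul, Diff.apply_inv_self]
  change Continuous fun t => conjTorus n M φ t • x
  simp_rw [h]
  exact φ.1.continuous.comp ((TorusManifold.continuous_smul (n := n) (M := M)).comp
    (by fun_prop : Continuous fun t => (t, φ.1⁻¹ x)))

variable (n M) in
/-- The homomorphism `N_{Diff(M)}(T) → Aut(T)` which sends `φ` to the automorphism `t ↦ φ t φ⁻¹`. -/
noncomputable def normalizerToAutTorus : TorusNormalizer n M →* (Torus n ≃ₜ* Torus n) where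
  toFun φ :=
    { toMulEquiv := conjTorus n M φ
      continuous_toFun := conjTorus_continuous φ
      continuous_invFun := by
        have h := conjTorus_continuous φ⁻¹
        rw [map_inv] at h
        exact h }
  map_one' := ContinuousMulEquiv.ext fun t => by
    change conjTorus n M 1 t = t
    rw [map_one, MulAut.one_apply]
  map_mul' φ ψ := ContinuousMulEquiv.ext fun t => by
    change conjTorus n M (φ * ψ) t = conjTorus n M φ (conjTorus n M ψ t)
    rw [map_mul, MulAut.mul_apply]

theorem normalizerToAutTorus_apply (φ : TorusNormalizer n M) (t : Torus n) :
    normalizerToAutTorus n M φ t = conjTorus n M φ t := rfl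

theorem map_isotropyZero_le (φ : TorusNormalizer n M) (x : M) :
    (isotropyZero n x).map (normalizerToAutTorus n M φ : Torus n →* Torus n) ≤
      isotropyZero n (φ.1 x) := by
  refine le_isotropyZero ?_ ?_
  · exact (isotropyZero_isConnected x).image _ (conjTorus_continuous φ).continuousOn
  · rintro _ ⟨t, ht, rfl⟩
    change conjTorus n M φ t • φ.1 x = φ.1 x
    rw [← normalizer_apply_smul, mem_stabilizer_iff.1 (isotropyZero_le x ht)]

theorem isotropyZero_normalizer (φ : TorusNormalizer n M) (x : M) :
    isotropyZero n (φ.1 x) =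
      (isotropyZero n x).map (normalizerToAutTorus n M φ : Torus n →* Torus n) := by
  refine le_antisymm (fun t ht => ?_) (map_isotropyZero_le φ x)
  have h1 := map_isotropyZero_le φ⁻¹ (φ.1 x) (Subgroup.mem_map_of_mem _ ht)
  have h2 : (φ⁻¹).1 (φ.1 x) = x := Diff.inv_apply_self φ.1 x
  rw [h2] at h1
  refine ⟨_, h1, ?_⟩
  change normalizerToAutTorus n M φ (normalizerToAutTorus n M φ⁻¹ t) = t
  rw [map_inv]
  exact (normalizerToAutTorus n M φ).apply_symm_apply t

theorem orbitMap_mem_orbitTypeSet (φ : TorusNormalizer n M) {H : Subgroup (Torus n)}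
    {q : OrbitSpace n M} (hq : q ∈ orbitTypeSet M H) :
    orbitMap φ q ∈
      orbitTypeSet M (H.map (normalizerToAutTorus n M φ : Torus n →* Torus n)) := by
  obtain ⟨x, rfl, rfl⟩ := hq
  exact ⟨φ.1 x, rfl, isotropyZero_normalizer φ x⟩

theorem image_orbitTypeSet (φ : TorusNormalizer n M) (H : Subgroup (Torus n)) :
    orbitHomeo φ '' orbitTypeSet M H =
      orbitTypeSet M (H.map (normalizerToAutTorus n M φ : Torus n →* Torus n)) := by
  refine Subset.antisymm ?_ fun q hq => ?_
  · rintro _ ⟨q, hq, rfl⟩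
    exact orbitMap_mem_orbitTypeSet φ hq
  · refine ⟨orbitMap φ⁻¹ q, ?_, (orbitHomeo φ).apply_symm_apply q⟩
    have h := orbitMap_mem_orbitTypeSet φ⁻¹ hq
    rw [Subgroup.map_map] at h
    have h2 : (normalizerToAutTorus n M φ⁻¹ : Torus n →* Torus n).comp
        (normalizerToAutTorus n M φ : Torus n →* Torus n) = MonoidHom.id (Torus n) := by
      rw [map_inv]
      exact MonoidHom.ext fun t => (normalizerToAutTorus n M φ).symm_apply_apply t
    rwa [h2, Subgroup.map_id] at h

theorem IsOpenStratum.image (φ : TorusNormalizer n M) {H : Subgroup (Torus n)}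
    {C : Set (OrbitSpace n M)} (h : IsOpenStratum H C) :
    IsOpenStratum (H.map (normalizerToAutTorus n M φ : Torus n →* Torus n))
      (orbitHomeo φ '' C) := by
  obtain ⟨h1, h2, q, hq, rfl⟩ := h
  refine ⟨?_, ?_, orbitHomeo φ q, orbitMap_mem_orbitTypeSet φ hq, ?_⟩
  · exact (normalizerToAutTorus n M φ).toHomeomorph.isClosedMap _ h1
  · exact h2.image _ (conjTorus_continuous φ).continuousOn
  · rw [(orbitHomeo φ).image_connectedComponentIn hq, image_orbitTypeSet]

theorem image_mem_closedStrata (φ : TorusNormalizer n M) (F : ClosedStrata n M) :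
    ∃ (H : Subgroup (Torus n)) (C : Set (OrbitSpace n M)),
      IsOpenStratum H C ∧ orbitHomeo φ '' F.1 = closure C := by
  obtain ⟨H, C, h, hF⟩ := F.2
  exact ⟨_, _, h.image φ, by rw [hF, (orbitHomeo φ).image_closure]⟩

variable (n M) in
/-- The homomorphism `N_{Diff(M)}(T) → Aut(𝒫)`: `φ` sends a closed stratum to its image under the
homeomorphism of `M/T` induced by `φ`. -/
noncomputable def normalizerToAutStrata :
    TorusNormalizer n M →* (ClosedStrata n M ≃o ClosedStrata n M) where
  toFun φ :=
    { toFun := fun F => ⟨orbitHomeo φ '' F.1, image_mem_closedStrata φ F⟩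
      invFun := fun F => ⟨orbitHomeo φ⁻¹ '' F.1, image_mem_closedStrata φ⁻¹ F⟩
      left_inv := fun F => Subtype.ext <| by
        change (orbitHomeo φ).symm '' (orbitHomeo φ '' F.1) = F.1
        rw [← image_comp, (orbitHomeo φ).symm_comp_self, image_id]
      right_inv := fun F => Subtype.ext <| by
        change orbitHomeo φ '' ((orbitHomeo φ).symm '' F.1) = F.1
        rw [← image_comp, (orbitHomeo φ).self_comp_symm, image_id]
      map_rel_iff' := fun {F F'} => image_subset_image_iff (orbitHomeo φ).injective }
  map_one' := by
    refine RelIso.ext fun F => Subtype.ext ?_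
    change orbitMap (1 : TorusNormalizer n M) '' F.1 = F.1
    rw [funext orbitMap_one, image_id']
  map_mul' φ ψ := by
    refine RelIso.ext fun F => Subtype.ext ?_
    change orbitMap (φ * ψ) '' F.1 = orbitMap φ '' (orbitMap ψ '' F.1)
    rw [← image_comp]
    exact congrArg (· '' F.1) (funext (orbitMap_mul φ ψ))

theorem charMap_normalizer (φ : TorusNormalizer n M) (F : ClosedStrata n M) :
    charMap (normalizerToAutStrata n M φ F) =
      (charMap F).map (normalizerToAutTorus n M φ : Torus n →* Torus n) := by
  have := TorusManifold.continuousConstSMul (n := n) (M := M)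
  obtain ⟨H, C, h, hF⟩ := F.2
  rw [charMap_eq h hF, charMap_eq (F := normalizerToAutStrata n M φ F) (h.image φ)]
  change orbitHomeo φ '' F.1 = closure (orbitHomeo φ '' C)
  rw [hF, (orbitHomeo φ).image_closure]

variable (n M) in
/-- The homomorphism `N_{Diff(M)}(T) → Aut(𝒫, λ)`. -/
noncomputable def normalizerToCharPairAut : TorusNormalizer n M →* charPairAut n M :=
  ((normalizerToAutStrata n M).prod (normalizerToAutTorus n M)).codRestrict (charPairAut n M)
    fun φ => charMap_normalizer φ

theorem normalizerToCharPairAut_torus (φ : TorusNormalizer n M)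
    (hφ : φ ∈ (torusSubgroup n M).subgroupOf
      (Subgroup.normalizer (torusSubgroup n M : Set (Diff (2 * n) M)))) :
    normalizerToCharPairAut n M φ = 1 := by
  obtain ⟨φ, hN⟩ := φ
  obtain ⟨t, rfl⟩ := hφ
  refine Subtype.ext (Prod.ext ?_ ?_)
  · refine RelIso.ext fun F => Subtype.ext ?_
    change orbitMap _ '' F.1 = F.1
    rw [funext (orbitMap_torus t hN), image_id']
  · refine ContinuousMulEquiv.ext fun s => torusToDiff_injective (M := M) ?_
    change torusToDiff n M (conjTorus n M _ s) = torusToDiff n M s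
    rw [torusToDiff_conjTorus, ← map_mul, ← map_inv, ← map_mul, mul_inv_cancel_comm]

variable (n M) in
/-- The natural homomorphism `𝒟(M,T) → Aut(𝒫, λ)`. -/
noncomputable def charHom : DiffModTorus n M →* charPairAut n M :=
  QuotientGroup.lift _ (normalizerToCharPairAut n M) normalizerToCharPairAut_torus

end NormalizerQuotient

section InvariantMetrics

variable {n : ℕ} {M : Type*} [TopologicalSpace M]
  [ChartedSpace (EuclideanSpace ℝ (Fin (2 * n))) M] [IsManifold (𝓡 (2 * n)) ∞ M]
  [MulAction (Torus n) M] [TorusManifold n M]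

variable (n M) in
/-- The set `ℛ(M,T)` of `T`-invariant Riemannian metrics on `M`. -/
def InvariantMetric : Type _ :=
  {g : RiemMetric (2 * n) M // ∀ t : Torus n, g.pullback (torusToDiff n M t) = g}

namespace InvariantMetric

theorem pullback_invariant (g : InvariantMetric n M) (φ : TorusNormalizer n M) (t : Torus n) :
    (g.1.pullback φ.1⁻¹).pullback (torusToDiff n M t) = g.1.pullback φ.1⁻¹ := by
  have h : φ.1⁻¹ * torusToDiff n M t = torusToDiff n M (conjTorus n M φ⁻¹ t) * φ.1⁻¹ := by
    rw [torusToDiff_conjTorus]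
    simp
  rw [← RiemMetric.pullback_mul, h, RiemMetric.pullback_mul, g.2]

noncomputable instance : MulAction (TorusNormalizer n M) (InvariantMetric n M) where
  smul φ g := ⟨φ.1 • g.1, pullback_invariant g φ⟩
  one_smul g := Subtype.ext (one_smul (Diff (2 * n) M) g.1)
  mul_smul φ ψ g := Subtype.ext (mul_smul φ.1 ψ.1 g.1)

theorem torus_smul (φ : TorusNormalizer n M) (hφ : φ ∈ (torusSubgroup n M).subgroupOf
      (Subgroup.normalizer (torusSubgroup n M : Set (Diff (2 * n) M)))) :
    toPermHom (TorusNormalizer n M) (InvariantMetric n M) φ = 1 := by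
  obtain ⟨φ, hN⟩ := φ
  obtain ⟨t, rfl⟩ := hφ
  refine Equiv.ext fun g => Subtype.ext ?_
  change g.1.pullback (torusToDiff n M t)⁻¹ = g.1
  rw [← map_inv, g.2]

/-- The action of `𝒟(M,T)` on `ℛ(M,T)` by pullback of metrics: the class of `φ` sends `g` to
`(φ⁻¹)^* g`. -/
noncomputable instance : MulAction (DiffModTorus n M) (InvariantMetric n M) :=
  MulAction.compHom _ (QuotientGroup.lift _
    (toPermHom (TorusNormalizer n M) (InvariantMetric n M)) torus_smul)

theorem mk_smul (φ : TorusNormalizer n M) (g : InvariantMetric n M) :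
    ((QuotientGroup.mk φ : DiffModTorus n M) • g).1 = g.1.pullback φ.1⁻¹ := rfl

end InvariantMetric

end InvariantMetrics

/-! Finite index means that the homomorphism `charHom` has finite image, so it suffices that only
finitely many poset automorphisms and finitely many torus automorphisms occur.

The poset itself is finite. Near a point `x` the isotropy group acts linearly in a suitable chart
(`exists_linearization`, by averaging a chart), and isotropy groups of nearby points lie in that of
`x` (`eventually_stabilizer_le`). In weight coordinates for the identity component of the isotropy
group, the stratum of a point depends only on which complex coordinates vanish. Hence finitely many
strata meet a neighbourhood of `x`, and compactness gives `finite_closedStrata`.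

For the torus automorphisms, take a fixed point `x`. The isotropy representation is faithful
(`eq_one_of_isotropyRep_eq_one`), and in real dimension `2n` this forces exactly `n` weights, which
identify the torus with `(S¹)ⁿ` (`nonempty_torusCoordinates`). If `φ` normalizes the torus, its
derivative carries the weights at `x` to those at `φ x`, up to inversion and up to the automorphism
induced by `φ`. The automorphism is thus determined by the point `φ x`, one of finitely many fixed
points, and by a finite choice of signed weights (`finite_range_normalizerToAutTorus`).

For freeness, let `φ` be an isometry in the kernel. The orbit of a fixed point `x` is a closed
stratum, so `φ x = x`. The derivative of `φ` at `x` commutes with the torus, hence is diagonal in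
weight coordinates; since it preserves the metric, its entries have modulus one, so it is the
derivative of some `t` in the torus (`exists_isotropyDeriv_eq`). Then `t⁻¹φ` is an isometry fixing
`x` with identity derivative, and on a connected manifold it is the identity
(`Diff.eq_one_of_isometry`). This rigidity is proved without geodesics: the isometry equation bounds
the second derivative of the map by its first-order deviation from the identity, and a Grönwall
argument concludes. -/

set_option maxSynthPendingDepth 3

/-! ### Local rigidity of isometries of a metric on a vector space. -/

section Rigidity


variable {E : Type*} [NormedAddCommGroup E] [NormedSpace ℝ E]

theorem exists_coercive_of_posDef [FiniteDimensional ℝ E] (B : E →L[ℝ] E →L[ℝ] ℝ)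
    (hB : ∀ v, v ≠ 0 → 0 < B v v) : ∃ c > 0, ∀ v, c * ‖v‖ ^ 2 ≤ B v v := by
  have hcont : Continuous fun v => B v v := by fun_prop
  rcases (Metric.sphere (0 : E) 1).eq_empty_or_nonempty with h | h
  · refine ⟨1, one_pos, fun v => ?_⟩
    by_cases hv : v = 0
    · simp [hv]
    · have : (‖v‖⁻¹ • v) ∈ Metric.sphere (0 : E) 1 := by
        simp [norm_smul, hv]
      simp [h] at this
  · obtain ⟨v₀, hv₀, hmin⟩ := (isCompact_sphere (0 : E) 1).exists_isMinOn h hcont.continuousOn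
    have hv₀' : v₀ ≠ 0 := by
      rintro rfl
      simp at hv₀
    refine ⟨B v₀ v₀, hB v₀ hv₀', fun v => ?_⟩
    by_cases hv : v = 0
    · simp [hv]
    · have hmem : (‖v‖⁻¹ • v) ∈ Metric.sphere (0 : E) 1 := by
        simp [norm_smul, hv]
      have h1 : B v₀ v₀ ≤ B (‖v‖⁻¹ • v) (‖v‖⁻¹ • v) := hmin hmem
      have hpos : 0 < ‖v‖ := norm_pos_iff.2 hv
      simp only [map_smul, smul_eq_mul, _root_.smul_apply] at h1
      calc B v₀ v₀ * ‖v‖ ^ 2 ≤ (‖v‖⁻¹ * (‖v‖⁻¹ * B v v)) * ‖v‖ ^ 2 := by gcongr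
        _ = B v v := by field_simp

/-- The derivative of the identity `f^* G = G`. -/
theorem fderiv_isometry_eq {G : E → E →L[ℝ] E →L[ℝ] ℝ} {f : E → E} {x : E}
    (hG : DifferentiableAt ℝ G x) (hG' : DifferentiableAt ℝ G (f x))
    (hf : DifferentiableAt ℝ f x) (hf' : DifferentiableAt ℝ (fderiv ℝ f) x)
    (hiso : ∀ᶠ y in 𝓝 x, ∀ v w, G (f y) (fderiv ℝ f y v) (fderiv ℝ f y w) = G y v w)
    (u v w : E) :
    fderiv ℝ G (f x) (fderiv ℝ f x u) (fderiv ℝ f x v) (fderiv ℝ f x w) +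
      G (f x) (fderiv ℝ (fderiv ℝ f) x u v) (fderiv ℝ f x w) +
      G (f x) (fderiv ℝ f x v) (fderiv ℝ (fderiv ℝ f) x u w) = fderiv ℝ G x u v w := by
  have hA : ∀ v, HasFDerivAt (fun y => fderiv ℝ f y v)
      ((fderiv ℝ (fderiv ℝ f) x).flip v) x := fun v => by
    have := hf'.hasFDerivAt.clm_apply (hasFDerivAt_const v x)
    simpa using this
  have hGf : HasFDerivAt (fun y => G (f y)) ((fderiv ℝ G (f x)).comp (fderiv ℝ f x)) x :=
    hG'.hasFDerivAt.comp x hf.hasFDerivAt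
  have h1 := (hGf.clm_apply (hA v)).clm_apply (hA w)
  have h2 := (hG.hasFDerivAt.clm_apply (hasFDerivAt_const v x)).clm_apply (hasFDerivAt_const w x)
  have h3 := h1.unique (h2.congr_of_eventuallyEq (hiso.mono fun y hy => hy v w))
  have h4 := DFunLike.congr_fun h3 u
  simp at h4
  linarith

/-- Differentiating `f^* G = G` and permuting the three arguments isolates the second derivative of
`f`, as in the Koszul formula. The remaining terms vanish when `f x = x` and the derivative is the
identity, so they are controlled by the first-order deviation. -/
theorem norm_snd_fderiv_isometry_le [FiniteDimensional ℝ E] {G : E → E →L[ℝ] E →L[ℝ] ℝ}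
    {f : E → E} {p : E}
    (hG : ContDiffAt ℝ ∞ G p) (hf : ContDiffAt ℝ ∞ f p)
    (hsymm : ∀ᶠ x in 𝓝 p, ∀ v w, G x v w = G x w v) (hpos : ∀ v, v ≠ 0 → 0 < G p v v)
    (hfp : f p = p) (hDf : fderiv ℝ f p = ContinuousLinearMap.id ℝ E)
    (hiso : ∀ᶠ x in 𝓝 p, ∀ v w, G (f x) (fderiv ℝ f x v) (fderiv ℝ f x w) = G x v w) :
    ∃ C > 0, ∀ᶠ x in 𝓝 p, ‖fderiv ℝ (fderiv ℝ f) x‖ ≤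
      C * (‖f x - x‖ + ‖fderiv ℝ f x - ContinuousLinearMap.id ℝ E‖) := by
  obtain ⟨c, hc, hcoer⟩ := exists_coercive_of_posDef (G p) hpos
  have hDG : ContDiffAt ℝ ∞ (fderiv ℝ G) p := hG.fderiv_right (by simp)
  have hA : ContDiffAt ℝ ∞ (fderiv ℝ f) p := hf.fderiv_right (by simp)
  obtain ⟨K, s, hs, hK⟩ := (hDG.of_le (m := 1) (by simp)).exists_lipschitzOnWith
  have hft : Filter.Tendsto f (𝓝 p) (𝓝 p) := by
    simpa [hfp] using hf.continuousAt.tendsto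
  have hAt : Filter.Tendsto (fderiv ℝ f) (𝓝 p) (𝓝 (ContinuousLinearMap.id ℝ E)) := by
    simpa [hDf] using hA.continuousAt.tendsto
  set L : ℝ := ‖fderiv ℝ G p‖ + 1 with hL
  have e1 : ∀ᶠ x in 𝓝 p, ‖fderiv ℝ G (f x)‖ ≤ L :=
    hft.eventually ((hDG.continuousAt.norm.eventually (gt_mem_nhds (lt_add_one _))).mono
      fun x hx => hx.le)
  have e2 : ∀ᶠ x in 𝓝 p, ‖fderiv ℝ f x‖ ≤ 2 := by
    have : ‖ContinuousLinearMap.id ℝ E‖ < 2 :=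
      lt_of_le_of_lt ContinuousLinearMap.norm_id_le (by norm_num)
    exact (hAt.norm.eventually (gt_mem_nhds this)).mono fun x hx => hx.le
  have e3 : ∀ᶠ x in 𝓝 p, ‖G (f x) - G p‖ < c / 8 := by
    have h0 : Filter.Tendsto (fun x => ‖G (f x) - G p‖) (𝓝 p) (𝓝 0) := by
      have := ((hG.continuousAt.tendsto.comp hft).sub_const (G p)).norm
      simpa using this
    exact h0.eventually (gt_mem_nhds (by positivity))
  have e3' : ∀ᶠ x in 𝓝 p, ‖G p‖ * ‖fderiv ℝ f x - ContinuousLinearMap.id ℝ E‖ < c / 4 := by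
    have h0 : Filter.Tendsto (fun x => ‖G p‖ * ‖fderiv ℝ f x - ContinuousLinearMap.id ℝ E‖)
        (𝓝 p) (𝓝 0) := by
      have := (hAt.sub_const (ContinuousLinearMap.id ℝ E)).norm.const_mul ‖G p‖
      simpa using this
    exact h0.eventually (gt_mem_nhds (by positivity))
  have e4 : ∀ᶠ x in 𝓝 p, ContDiffAt ℝ 2 f x :=
    (hf.of_le (m := 2) (WithTop.coe_le_coe.2 (le_top : (2 : ℕ∞) ≤ ⊤))).eventually (by simp)
  have e5 : ∀ᶠ x in 𝓝 p, DifferentiableAt ℝ G x :=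
    ((hG.of_le (m := 1) (by simp)).eventually (by simp)).mono
      fun x hx => hx.differentiableAt (by simp)
  -- Three remainder terms, each bounded with `K + 7 * L`: `K` from moving the base point, and `7 =
  -- 1 + 2 + 4` from replacing the three vectors by their images one at a time, with the derivative
  -- of norm at most `2`. The division by `c` comes from coercivity.
  refine ⟨(3 * (K + 7 * L)) / c, by positivity, ?_⟩
  filter_upwards [e1, e2, e3, e3', e4, e5, hft.eventually e5, hs, hft.eventually hs,
    hft.eventually hsymm, hiso.eventually_nhds] with x h1 h2 h3 h3' h4 h5 h5' hxs hfxs hsy hi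
  set A := fderiv ℝ f x with hAdef
  set δ : ℝ := ‖f x - x‖ + ‖A - ContinuousLinearMap.id ℝ E‖ with hδ
  have hid := fderiv_isometry_eq h5 h5' (h4.differentiableAt (by simp))
    ((h4.fderiv_right (m := 1) (by norm_num)).differentiableAt (by simp)) hi
  have hsy2 : ∀ u v, fderiv ℝ (fderiv ℝ f) x u v = fderiv ℝ (fderiv ℝ f) x v u :=
    fun u v => (h4.isSymmSndFDerivAt (by simp)).eq u v
  let R : E → E → E → ℝ := fun u v w =>
    fderiv ℝ G x u v w - fderiv ℝ G (f x) (A u) (A v) (A w)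
  have hR : ∀ u v w, |R u v w| ≤ (K + 7 * L) * δ * (‖u‖ * ‖v‖ * ‖w‖) := by
    intro u v w
    have d1 : ‖fderiv ℝ G x - fderiv ℝ G (f x)‖ ≤ K * ‖f x - x‖ := by
      have := hK.dist_le_mul x hxs (f x) hfxs
      rwa [dist_eq_norm, dist_comm, dist_eq_norm] at this
    have dA : ∀ u, ‖u - A u‖ ≤ ‖A - ContinuousLinearMap.id ℝ E‖ * ‖u‖ := fun u => by
      have := (A - ContinuousLinearMap.id ℝ E).le_opNorm u
      rw [norm_sub_rev]
      simpa using this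
    have bA : ∀ u, ‖A u‖ ≤ 2 * ‖u‖ := fun u => A.le_of_opNorm_le h2 u
    have b3 : ∀ (D : E →L[ℝ] E →L[ℝ] E →L[ℝ] ℝ) (a b c : E), |D a b c| ≤ ‖D‖ * ‖a‖ * ‖b‖ * ‖c‖ :=
      fun D a b c => by
        calc |D a b c| ≤ ‖D a b‖ * ‖c‖ := (D a b).le_opNorm c
          _ ≤ _ := by gcongr; exact D.le_opNorm₂ a b
    have split : R u v w = (fderiv ℝ G x - fderiv ℝ G (f x)) u v w +
        fderiv ℝ G (f x) (u - A u) v w + fderiv ℝ G (f x) (A u) (v - A v) w +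
        fderiv ℝ G (f x) (A u) (A v) (w - A w) := by
      simp [R]
    set a := ‖A - ContinuousLinearMap.id ℝ E‖ with ha
    have t1 : |(fderiv ℝ G x - fderiv ℝ G (f x)) u v w| ≤ K * ‖f x - x‖ * ‖u‖ * ‖v‖ * ‖w‖ :=
      (b3 _ _ _ _).trans (by gcongr)
    have t2 : |fderiv ℝ G (f x) (u - A u) v w| ≤ L * (a * ‖u‖) * ‖v‖ * ‖w‖ :=
      (b3 _ _ _ _).trans (by gcongr; exact dA u)
    have t3 : |fderiv ℝ G (f x) (A u) (v - A v) w| ≤ L * (2 * ‖u‖) * (a * ‖v‖) * ‖w‖ :=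
      (b3 _ _ _ _).trans (by gcongr; exacts [bA u, dA v])
    have t4 : |fderiv ℝ G (f x) (A u) (A v) (w - A w)| ≤
        L * (2 * ‖u‖) * (2 * ‖v‖) * (a * ‖w‖) :=
      (b3 _ _ _ _).trans (by gcongr; exacts [bA u, bA v, dA w])
    rw [split]
    calc _ ≤ K * ‖f x - x‖ * ‖u‖ * ‖v‖ * ‖w‖ + L * (a * ‖u‖) * ‖v‖ * ‖w‖ +
          L * (2 * ‖u‖) * (a * ‖v‖) * ‖w‖ + L * (2 * ‖u‖) * (2 * ‖v‖) * (a * ‖w‖) := by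
          refine (abs_add_le _ _).trans (add_le_add ((abs_add_le _ _).trans
            (add_le_add ((abs_add_le _ _).trans (add_le_add t1 t2)) t3)) t4)
      _ = (K * ‖f x - x‖ + 7 * L * a) * (‖u‖ * ‖v‖ * ‖w‖) := by ring
      _ ≤ _ := by
          gcongr
          have hL0 : 0 ≤ L := by positivity
          have hK0 : (0 : ℝ) ≤ K := K.2
          have ha0 : 0 ≤ a := norm_nonneg _
          have : 0 ≤ ‖f x - x‖ := norm_nonneg _
          rw [hδ]
          nlinarith [mul_nonneg hK0 ha0, mul_nonneg hL0 this]
  -- By `hid`, each `R` is a sum of two second-derivative terms. The symmetry of the metric and of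
  -- the second derivative cancels all but one kind in this combination.
  have hkos : ∀ u v w, 2 * G (f x) (fderiv ℝ (fderiv ℝ f) x u v) (A w) =
      R u v w + R v u w - R w u v := by
    intro u v w
    have i1 := hid u v w
    have i2 := hid v u w
    have i3 := hid w u v
    rw [hsy _ (fderiv ℝ (fderiv ℝ f) x u w)] at i1
    rw [hsy _ (fderiv ℝ (fderiv ℝ f) x v w), hsy2 v u] at i2
    rw [hsy _ (fderiv ℝ (fderiv ℝ f) x w v), hsy2 w u, hsy2 w v] at i3
    simp only [R]
    linarith
  -- Near `p` the form differs little from `G p`: the two errors cost `c / 4` each, leaving half of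
  -- the coercivity constant.
  have hlow : ∀ z, c / 2 * ‖z‖ ^ 2 ≤ G (f x) z (A z) := by
    intro z
    have e : G (f x) z (A z) = G p z z + (G (f x) - G p) z (A z) +
        G p z ((A - ContinuousLinearMap.id ℝ E) z) := by simp; ring
    have b1 : |(G (f x) - G p) z (A z)| ≤ c / 8 * ‖z‖ * (2 * ‖z‖) :=
      ((G (f x) - G p).le_opNorm₂ z (A z)).trans (by
        gcongr
        exact A.le_of_opNorm_le h2 z)
    have b2 : |G p z ((A - ContinuousLinearMap.id ℝ E) z)| ≤ c / 4 * ‖z‖ ^ 2 := by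
      calc _ ≤ ‖G p‖ * ‖z‖ * (‖A - ContinuousLinearMap.id ℝ E‖ * ‖z‖) :=
            ((G p).le_opNorm₂ z _).trans (by
              gcongr
              exact ContinuousLinearMap.le_opNorm _ _)
        _ = (‖G p‖ * ‖A - ContinuousLinearMap.id ℝ E‖) * ‖z‖ ^ 2 := by ring
        _ ≤ _ := by gcongr
    have := hcoer z
    have := neg_le_of_abs_le b1
    have := neg_le_of_abs_le b2
    rw [e]
    nlinarith
  refine ContinuousLinearMap.opNorm_le_bound₂ _ (by positivity) fun u v => ?_
  set z := fderiv ℝ (fderiv ℝ f) x u v with hz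
  have k := hkos u v z
  have l := hlow z
  have r1 := le_of_abs_le (hR u v z)
  have r2 := le_of_abs_le (hR v u z)
  have r3 := neg_le_of_abs_le (hR z u v)
  by_cases hz0 : ‖z‖ = 0
  · rw [hz0]; positivity
  have hzpos : 0 < ‖z‖ := lt_of_le_of_ne (norm_nonneg _) (Ne.symm hz0)
  have : c * ‖z‖ * ‖z‖ ≤ 3 * (K + 7 * L) * δ * ‖u‖ * ‖v‖ * ‖z‖ := by
    rw [← hz] at k
    nlinarith
  have := le_of_mul_le_mul_right this hzpos
  rw [div_mul_eq_mul_div, div_mul_eq_mul_div, div_mul_eq_mul_div, le_div_iff₀ hc]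
  linarith

/-- Along each segment from `p` the pair (map minus identity, derivative minus identity) starts at
zero and its velocity is bounded by a multiple of its norm, so by Grönwall it stays zero. -/
theorem isometry_eventuallyEq_id [FiniteDimensional ℝ E] {G : E → E →L[ℝ] E →L[ℝ] ℝ}
    {f : E → E} {p : E}
    (hG : ContDiffAt ℝ ∞ G p) (hf : ContDiffAt ℝ ∞ f p)
    (hsymm : ∀ᶠ x in 𝓝 p, ∀ v w, G x v w = G x w v) (hpos : ∀ v, v ≠ 0 → 0 < G p v v)
    (hfp : f p = p) (hDf : fderiv ℝ f p = ContinuousLinearMap.id ℝ E)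
    (hiso : ∀ᶠ x in 𝓝 p, ∀ v w, G (f x) (fderiv ℝ f x v) (fderiv ℝ f x w) = G x v w) :
    ∀ᶠ x in 𝓝 p, f x = x := by
  obtain ⟨C, hC, hb⟩ := norm_snd_fderiv_isometry_le hG hf hsymm hpos hfp hDf hiso
  have e4 : ∀ᶠ x in 𝓝 p, ContDiffAt ℝ 2 f x :=
    (hf.of_le (m := 2) (WithTop.coe_le_coe.2 (le_top : (2 : ℕ∞) ≤ ⊤))).eventually (by simp)
  obtain ⟨r, hr, hball⟩ := Metric.eventually_nhds_iff_ball.1 (hb.and e4)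
  refine Metric.eventually_nhds_iff_ball.2 ⟨r, hr, fun x hx => ?_⟩
  set h := x - p with hh
  have hmem : ∀ t ∈ Icc (0 : ℝ) 1, p + t • h ∈ Metric.ball p r := by
    intro t ht
    rw [Metric.mem_ball, dist_eq_norm, add_sub_cancel_left, norm_smul, Real.norm_eq_abs,
      abs_of_nonneg ht.1]
    rw [Metric.mem_ball, dist_eq_norm] at hx
    exact lt_of_le_of_lt (mul_le_of_le_one_left (norm_nonneg _) ht.2) hx
  let γ : ℝ → E × (E →L[ℝ] E) := fun t =>
    (f (p + t • h) - (p + t • h), fderiv ℝ f (p + t • h) - ContinuousLinearMap.id ℝ E)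
  let γ' : ℝ → E × (E →L[ℝ] E) := fun t =>
    (fderiv ℝ f (p + t • h) h - h, fderiv ℝ (fderiv ℝ f) (p + t • h) h)
  have hline : ∀ t : ℝ, HasDerivAt (fun t : ℝ => p + t • h) h t := fun t => by
    simpa using ((hasDerivAt_id t).smul_const h).const_add p
  have hder : ∀ t ∈ Icc (0 : ℝ) 1, HasDerivAt γ (γ' t) t := by
    intro t ht
    have h4 := (hball _ (hmem t ht)).2
    have d1 := (h4.differentiableAt (by simp)).hasFDerivAt.comp_hasDerivAt t (hline t)
    have d2 := ((h4.fderiv_right (m := 1) (by norm_num)).differentiableAt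
      (by simp)).hasFDerivAt.comp_hasDerivAt t (hline t)
    exact (d1.sub (hline t)).prodMk (d2.sub_const _)
  -- The first component moves at speed at most `‖h‖ * ‖γ‖`, the second at most `2 * C * ‖h‖ * ‖γ‖`;
  -- the constant dominates both.
  have hzero := eq_zero_of_abs_deriv_le_mul_abs_self_of_eq_zero_right (f := γ) (f' := γ')
    (K := (1 + 2 * C) * ‖h‖) (a := 0) (b := 1)
    (fun t ht => (hder t ht).continuousAt.continuousWithinAt)
    (fun t ht => (hder t ⟨ht.1, ht.2.le⟩).hasDerivWithinAt)
    (by simp [γ, hfp, hDf]) (fun t ht => by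
      have hb' := (hball _ (hmem t ⟨ht.1, ht.2.le⟩)).1
      have n1 : ‖(γ t).1‖ ≤ ‖γ t‖ := norm_fst_le _
      have n2 : ‖(γ t).2‖ ≤ ‖γ t‖ := norm_snd_le _
      refine (Prod.norm_def _).le.trans (max_le ?_ ?_)
      · have := (γ t).2.le_opNorm h
        calc ‖(γ' t).1‖ = ‖(γ t).2 h‖ := by simp [γ, γ']
          _ ≤ ‖(γ t).2‖ * ‖h‖ := (γ t).2.le_opNorm h
          _ ≤ ‖γ t‖ * ‖h‖ := by gcongr
          _ ≤ _ := by nlinarith [mul_nonneg (mul_nonneg hC.le (norm_nonneg h)) (norm_nonneg (γ t))]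
      · calc ‖(γ' t).2‖ ≤ ‖fderiv ℝ (fderiv ℝ f) (p + t • h)‖ * ‖h‖ :=
              ContinuousLinearMap.le_opNorm _ _
          _ ≤ (C * (‖(γ t).1‖ + ‖(γ t).2‖)) * ‖h‖ := by gcongr
          _ ≤ (C * (‖γ t‖ + ‖γ t‖)) * ‖h‖ := by gcongr
          _ ≤ _ := by nlinarith [mul_nonneg (norm_nonneg h) (norm_nonneg (γ t))])
  have h1 := congrArg Prod.fst (hzero 1 ⟨zero_le_one, le_rfl⟩)
  have h2 : p + (1 : ℝ) • h = x := by simp [hh]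
  simp only [γ, h2] at h1
  exact sub_eq_zero.1 h1

end Rigidity

/-! ### Rigidity of isometries on a connected manifold. -/

section IsometryRigidity

variable {d : ℕ} {M : Type*} [TopologicalSpace M] [ChartedSpace (EuclideanSpace ℝ (Fin d)) M]
  [IsManifold (𝓡 d) ∞ M]

theorem contMDiffAt_extChartAt_symm_of_mem {x : M} {v : EuclideanSpace ℝ (Fin d)}
    (hv : v ∈ (extChartAt (𝓡 d) x).target) :
    ContMDiffAt 𝓘(ℝ, EuclideanSpace ℝ (Fin d)) (𝓡 d) ∞ (extChartAt (𝓡 d) x).symm v :=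
  (contMDiffOn_extChartAt_symm x).contMDiffAt ((isOpen_extChartAt_target x).mem_nhds hv)

/-- A Riemannian metric, read in the chart at `x`. -/
noncomputable def RiemMetric.inChart (g : RiemMetric d M) (x : M)
    (v : EuclideanSpace ℝ (Fin d)) :
    EuclideanSpace ℝ (Fin d) →L[ℝ] EuclideanSpace ℝ (Fin d) →L[ℝ] ℝ :=
  ContinuousLinearMap.inCoordinates (EuclideanSpace ℝ (Fin d))
    (fun x : M => TangentSpace (𝓡 d) x) (EuclideanSpace ℝ (Fin d) →L[ℝ] ℝ)
    (fun x : M => TangentSpace (𝓡 d) x →L[ℝ] ℝ) x ((extChartAt (𝓡 d) x).symm v) x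
    ((extChartAt (𝓡 d) x).symm v) (g.inner ((extChartAt (𝓡 d) x).symm v))

theorem RiemMetric.contDiffAt_inChart (g : RiemMetric d M) (x : M) :
    ContDiffAt ℝ ∞ (g.inChart x) (extChartAt (𝓡 d) x x) := by
  have h := ((contMDiffAt_hom_bundle _).1 (g.contMDiff x)).2
  have hx : (extChartAt (𝓡 d) x).symm (extChartAt (𝓡 d) x x) = x := extChartAt_to_inv x
  rw [← contMDiffAt_iff_contDiffAt]
  have h2 := contMDiffAt_extChartAt_symm_of_mem (mem_extChartAt_target (I := 𝓡 d) x)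
  rw [← hx] at h
  have := h.comp _ h2
  rw [hx] at this
  exact this

theorem RiemMetric.inChart_apply (g : RiemMetric d M) (x : M) {v : EuclideanSpace ℝ (Fin d)}
    (hv : v ∈ (extChartAt (𝓡 d) x).target) (a b : EuclideanSpace ℝ (Fin d)) :
    g.inChart x v a b = g.inner ((extChartAt (𝓡 d) x).symm v)
      (mfderiv 𝓘(ℝ, EuclideanSpace ℝ (Fin d)) (𝓡 d) (extChartAt (𝓡 d) x).symm v a)
      (mfderiv 𝓘(ℝ, EuclideanSpace ℝ (Fin d)) (𝓡 d) (extChartAt (𝓡 d) x).symm v b) := by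
  set y := (extChartAt (𝓡 d) x).symm v with hy
  have hys : y ∈ (chartAt (EuclideanSpace ℝ (Fin d)) x).source := by
    rw [← extChartAt_source (𝓡 d)]
    exact (extChartAt (𝓡 d) x).map_target hv
  have hyb : y ∈ (trivializationAt (EuclideanSpace ℝ (Fin d))
      (fun x : M => TangentSpace (𝓡 d) x) x).baseSet := hys
  have key : ∀ u : EuclideanSpace ℝ (Fin d),
      (trivializationAt (EuclideanSpace ℝ (Fin d)) (fun x : M => TangentSpace (𝓡 d) x)
        x).symm y u = mfderiv 𝓘(ℝ, EuclideanSpace ℝ (Fin d)) (𝓡 d) (extChartAt (𝓡 d) x).symm v u := by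
    intro u
    rw [← Bundle.Trivialization.symmL_apply (R := ℝ) _ hyb]
    have h := TangentBundle.symmL_trivializationAt (I := 𝓡 d) hys
    rw [hy, (extChartAt (𝓡 d) x).right_inv hv] at h
    rw [← mfderivWithin_univ, ← (𝓡 d).range_eq_univ]
    exact DFunLike.congr_fun h u
  refine (inCoordinates_apply_eq₂ (𝕜 := ℝ) (F₁ := EuclideanSpace ℝ (Fin d))
    (F₂ := EuclideanSpace ℝ (Fin d)) (F₃ := ℝ)
    (E₁ := fun x : M => TangentSpace (𝓡 d) x) (E₂ := fun x : M => TangentSpace (𝓡 d) x)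
    (E₃ := fun _ : M => ℝ) (x₀ := x) (ϕ := g.inner y) (v := a) (w := b) hyb hyb
    (Set.mem_univ _)).trans ?_
  simp only [Bundle.Trivial.fiberBundle_trivializationAt', Bundle.Trivial.linearMapAt_trivialization]
  exact congrArg₂ (fun a b => g.inner y a b) (key a) (key b)

/-- A diffeomorphism, read in the chart at `x` (in the source and in the target). -/
noncomputable def Diff.inChart (ψ : Diff d M) (x : M) (v : EuclideanSpace ℝ (Fin d)) :
    EuclideanSpace ℝ (Fin d) :=
  extChartAt (𝓡 d) x (ψ ((extChartAt (𝓡 d) x).symm v))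

theorem Diff.contDiffAt_inChart (ψ : Diff d M) {x : M} (hx : ψ x = x) :
    ContDiffAt ℝ ∞ (ψ.inChart x) (extChartAt (𝓡 d) x x) := by
  rw [← contMDiffAt_iff_contDiffAt]
  have h2 := contMDiffAt_extChartAt_symm_of_mem (mem_extChartAt_target (I := 𝓡 d) x)
  refine ContMDiffAt.comp (I' := 𝓡 d) _ (g := extChartAt (𝓡 d) x) ?_
    (ContMDiffAt.comp (I' := 𝓡 d) _ ψ.contMDiffAt h2)
  rw [extChartAt_to_inv, hx]
  exact contMDiffAt_extChartAt

theorem Diff.inChart_self (ψ : Diff d M) {x : M} (hx : ψ x = x) :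
    ψ.inChart x (extChartAt (𝓡 d) x x) = extChartAt (𝓡 d) x x := by
  rw [Diff.inChart, extChartAt_to_inv, hx]

theorem Diff.fderiv_inChart (ψ : Diff d M) {x : M} (hx : ψ x = x) :
    fderiv ℝ (ψ.inChart x) (extChartAt (𝓡 d) x x) =
      (mfderiv (𝓡 d) (𝓡 d) ψ x : EuclideanSpace ℝ (Fin d) →L[ℝ] EuclideanSpace ℝ (Fin d)) := by
  have h : MDifferentiableAt (𝓡 d) (𝓡 d) ψ x := ψ.mdifferentiable (by simp) x
  let D : EuclideanSpace ℝ (Fin d) →L[ℝ] EuclideanSpace ℝ (Fin d) := mfderiv (𝓡 d) (𝓡 d) ψ x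
  have h1 : HasFDerivWithinAt (writtenInExtChartAt (𝓡 d) (𝓡 d) x ψ) D (range (𝓡 d))
    (extChartAt (𝓡 d) x x) := h.hasMFDerivAt.2
  rw [(𝓡 d).range_eq_univ, hasFDerivWithinAt_univ] at h1
  have h2 : writtenInExtChartAt (𝓡 d) (𝓡 d) x ψ = ψ.inChart x := by
    ext1 v
    simp only [writtenInExtChartAt, hx]
    rfl
  rw [h2] at h1
  exact h1.fderiv

theorem Diff.isometry_inChart (ψ : Diff d M) (g : RiemMetric d M) (hg : g.pullback ψ = g)
    {x : M} (hx : ψ x = x) : ∀ᶠ v in 𝓝 (extChartAt (𝓡 d) x x), ∀ a b,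
      g.inChart x (ψ.inChart x v) (fderiv ℝ (ψ.inChart x) v a) (fderiv ℝ (ψ.inChart x) v b) =
        g.inChart x v a b := by
  set c := extChartAt (𝓡 d) x with hc
  have hxt : c x ∈ c.target := mem_extChartAt_target x
  have e1 : ∀ᶠ v in 𝓝 (c x), v ∈ c.target := extChartAt_target_mem_nhds x
  have hcont : ContinuousAt (fun v => ψ (c.symm v)) (c x) :=
    ψ.continuous.continuousAt.comp (continuousAt_extChartAt_symm x)
  have e2 : ∀ᶠ v in 𝓝 (c x), ψ (c.symm v) ∈ c.source := by
    refine hcont.eventually ?_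
    have h0 : ψ (c.symm (c x)) = x := by rw [hc, extChartAt_to_inv, hx]
    change ∀ᶠ y in 𝓝 (ψ (c.symm (c x))), y ∈ c.source
    rw [h0]
    exact extChartAt_source_mem_nhds x
  have e3 : ∀ᶠ v in 𝓝 (c x), ContDiffAt ℝ 1 (ψ.inChart x) v :=
    ((ψ.contDiffAt_inChart hx).of_le (m := 1) (by simp)).eventually (by simp)
  filter_upwards [e1, e2.eventually_nhds, e3] with v h1 h2 h3 a b
  have h2' := h2.self_of_nhds
  have hft : ψ.inChart x v ∈ c.target := c.map_source h2'
  have hcs : c.symm (ψ.inChart x v) = ψ (c.symm v) := c.left_inv h2'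
  have hS := (contMDiffAt_extChartAt_symm_of_mem h1).mdifferentiableAt (by simp)
  have hS' := (contMDiffAt_extChartAt_symm_of_mem hft).mdifferentiableAt (by simp)
  have hψ : MDifferentiableAt (𝓡 d) (𝓡 d) ψ (c.symm v) := ψ.mdifferentiable (by simp) _
  have hf := (h3.differentiableAt (by simp)).mdifferentiableAt
  have d1 := mfderiv_comp v hS' hf
  have d2 := mfderiv_comp v hψ hS
  have hev : (c.symm ∘ ψ.inChart x) =ᶠ[𝓝 v] (ψ ∘ c.symm) := h2.mono fun w hw => c.left_inv hw
  rw [hev.mfderiv_eq, d2, mfderiv_eq_fderiv] at d1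
  rw [g.inChart_apply x hft, g.inChart_apply x h1]
  conv_rhs => rw [← hg]
  rw [RiemMetric.pullback_apply]
  have key : ∀ u, mfderiv (𝓡 d) (𝓡 d) ψ (c.symm v)
      (mfderiv 𝓘(ℝ, EuclideanSpace ℝ (Fin d)) (𝓡 d) c.symm v u) =
      mfderiv 𝓘(ℝ, EuclideanSpace ℝ (Fin d)) (𝓡 d) c.symm (ψ.inChart x v)
        (fderiv ℝ (ψ.inChart x) v u) := fun u => DFunLike.congr_fun d1 u
  rw [← hc, hcs]
  exact (congrArg₂ (fun a b => g.inner (ψ (c.symm v)) a b) (key a) (key b)).symm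

theorem Diff.eventually_eq_self_of_isometry (ψ : Diff d M) (g : RiemMetric d M)
    (hg : g.pullback ψ = g) {x : M} (hx : ψ x = x)
    (hD : fderiv ℝ (ψ.inChart x) (extChartAt (𝓡 d) x x) = ContinuousLinearMap.id ℝ _) :
    ∀ᶠ y in 𝓝 x, ψ y = y := by
  have hxt : extChartAt (𝓡 d) x x ∈ (extChartAt (𝓡 d) x).target := mem_extChartAt_target x
  have e1 : ∀ᶠ v in 𝓝 (extChartAt (𝓡 d) x x), v ∈ (extChartAt (𝓡 d) x).target :=
    extChartAt_target_mem_nhds x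
  have hev := isometry_eventuallyEq_id (g.contDiffAt_inChart x) (ψ.contDiffAt_inChart hx)
    (e1.mono fun v hv a b => by
      rw [g.inChart_apply x hv, g.inChart_apply x hv, g.symm])
    (fun v hv => by
      rw [g.inChart_apply x hxt]
      refine g.pos _ _ fun h0 => hv ?_
      have hl : ((extChartAt (𝓡 d) x) ∘ (extChartAt (𝓡 d) x).symm)
          =ᶠ[𝓝 (extChartAt (𝓡 d) x x)] id :=
        e1.mono fun w hw => (extChartAt (𝓡 d) x).right_inv hw
      have hc : MDifferentiableAt (𝓡 d) 𝓘(ℝ, EuclideanSpace ℝ (Fin d)) (extChartAt (𝓡 d) x)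
          ((extChartAt (𝓡 d) x).symm (extChartAt (𝓡 d) x x)) := by
        rw [extChartAt_to_inv]
        exact mdifferentiableAt_extChartAt (mem_chart_source _ x)
      have hcomp := mfderiv_comp _ hc
        ((contMDiffAt_extChartAt_symm_of_mem hxt).mdifferentiableAt (by simp))
      rw [hl.mfderiv_eq, mfderiv_id] at hcomp
      have := DFunLike.congr_fun hcomp v
      refine this.trans ?_
      refine (congrArg (mfderiv (𝓡 d) 𝓘(ℝ, EuclideanSpace ℝ (Fin d)) (extChartAt (𝓡 d) x)
          ((extChartAt (𝓡 d) x).symm (extChartAt (𝓡 d) x x))) h0).trans ?_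
      exact map_zero (mfderiv (𝓡 d) 𝓘(ℝ, EuclideanSpace ℝ (Fin d)) (extChartAt (𝓡 d) x)
          ((extChartAt (𝓡 d) x).symm (extChartAt (𝓡 d) x x))))
    (ψ.inChart_self hx) hD (ψ.isometry_inChart g hg hx)
  have e2 : ∀ᶠ y in 𝓝 x, ψ y ∈ (extChartAt (𝓡 d) x).source := by
    refine ψ.continuous.continuousAt.eventually ?_
    rw [hx]
    exact extChartAt_source_mem_nhds x
  filter_upwards [(continuousAt_extChartAt x).eventually hev, e2,
    extChartAt_source_mem_nhds (I := 𝓡 d) x] with y h1 h2 h3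
  rw [Diff.inChart, (extChartAt (𝓡 d) x).left_inv h3] at h1
  exact (extChartAt (𝓡 d) x).injOn h2 h3 h1

/-- An isometry of a connected Riemannian manifold with a fixed point at which its derivative is
the identity is the identity. -/
theorem Diff.eq_one_of_isometry [T2Space M] [ConnectedSpace M] (ψ : Diff d M) (g : RiemMetric d M)
    (hg : g.pullback ψ = g) {x₀ : M} (hx₀ : ψ x₀ = x₀)
    (hD : ∀ v, mfderiv (𝓡 d) (𝓡 d) ψ x₀ v = v) : ψ = 1 := by
  let S : Set M := {x | ∀ᶠ y in 𝓝 x, ψ y = y}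
  have hopen : IsOpen S := isOpen_iff_eventually.2 fun x hx => hx.eventually_nhds
  have hclosed : IsClosed S := by
    refine isClosed_iff_clusterPt.2 fun x hx => ?_
    rw [← mem_closure_iff_clusterPt] at hx
    have hfix : ψ x = x := by
      have hcl : IsClosed {y : M | ψ y = y} := isClosed_eq ψ.continuous continuous_id
      exact closure_minimal (fun y hy => Filter.Eventually.self_of_nhds hy) hcl hx
    refine ψ.eventually_eq_self_of_isometry g hg hfix ?_
    -- The derivative read in the chart at `x` is continuous and equals the identity at the points
    -- of `S`, which accumulate at `x`; were it different at `x`, it would differ at some point of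
    -- `S`.
    by_contra hne
    have hcd := ((ψ.contDiffAt_inChart hfix).fderiv_right (m := ∞) (by simp)).continuousAt
    have hev := hcd.eventually_ne hne
    obtain ⟨y, ⟨h1, h2⟩, hyS⟩ := mem_closure_iff_nhds.1 hx _
      (((continuousAt_extChartAt x).eventually hev).and (extChartAt_source_mem_nhds (I := 𝓡 d) x))
    refine h1 ?_
    have hyt := (extChartAt (𝓡 d) x).map_source h2
    have hcy : ContinuousAt (extChartAt (𝓡 d) x).symm (extChartAt (𝓡 d) x y) :=
      continuousAt_extChartAt_symm'' hyt
    have hid : ψ.inChart x =ᶠ[𝓝 (extChartAt (𝓡 d) x y)] id := by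
      have h3 : ∀ᶠ v in 𝓝 (extChartAt (𝓡 d) x y), ψ ((extChartAt (𝓡 d) x).symm v) =
          (extChartAt (𝓡 d) x).symm v := by
        refine hcy.eventually (p := fun z => ψ z = z) ?_
        rw [(extChartAt (𝓡 d) x).left_inv h2]
        exact hyS
      filter_upwards [h3, (isOpen_extChartAt_target x).mem_nhds hyt] with v hv hvt
      rw [Diff.inChart, hv, (extChartAt (𝓡 d) x).right_inv hvt, id]
    rw [hid.fderiv_eq, fderiv_id]
  have hne : S.Nonempty := ⟨x₀, ψ.eventually_eq_self_of_isometry g hg hx₀ (by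
    rw [ψ.fderiv_inChart hx₀]
    exact ContinuousLinearMap.ext hD)⟩
  have huniv := IsClopen.eq_univ ⟨hclosed, hopen⟩ hne
  exact Diffeomorph.ext fun x =>
    Filter.Eventually.self_of_nhds (p := fun y => ψ y = y) (huniv ▸ mem_univ x : x ∈ S)

end IsometryRigidity

/-! ### Averaging over a compact commutative group. -/

section HaarMean

open MeasureTheory

variable {K : Type*} [CommGroup K] [TopologicalSpace K] [IsTopologicalGroup K] [CompactSpace K]
  {F G : Type*} [NormedAddCommGroup F] [NormedSpace ℝ F] [NormedAddCommGroup G] [NormedSpace ℝ G]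

/-- The mean of a vector-valued function on a compact commutative group. -/
noncomputable def haarMean (f : K → F) : F :=
  letI : MeasurableSpace K := borel K
  haveI : BorelSpace K := ⟨rfl⟩
  ∫ k, f k ∂(Measure.haarMeasure (⊤ : TopologicalSpace.PositiveCompacts K))

theorem haarMean_const [CompleteSpace F] (v : F) : haarMean (fun _ : K => v) = v := by
  let _ : MeasurableSpace K := borel K
  have : BorelSpace K := ⟨rfl⟩
  have h : Measure.haarMeasure (⊤ : TopologicalSpace.PositiveCompacts K) univ = 1 :=
    Measure.haarMeasure_self
  simp [haarMean, measureReal_def, h]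

theorem haarMean_mul_left (f : K → F) (h : K) : haarMean (fun k => f (h * k)) = haarMean f := by
  let _ : MeasurableSpace K := borel K
  have : BorelSpace K := ⟨rfl⟩
  exact integral_mul_left_eq_self f h

/-- For an invertible `L` no integrability is needed. This lets `averagedChart_smul` hold at every
point, even where translates leave the chart and the integrand need not be continuous. -/
theorem haarMean_equiv [CompleteSpace F] [CompleteSpace G] (L : F ≃L[ℝ] G) (f : K → F) :
    haarMean (fun k => L (f k)) = L (haarMean f) := by
  let _ : MeasurableSpace K := borel K
  have : BorelSpace K := ⟨rfl⟩
  exact L.integral_comp_comm f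

theorem integrable_haar [FiniteDimensional ℝ F] {f : K → F} (hf : Continuous f) :
    letI : MeasurableSpace K := borel K
    haveI : BorelSpace K := ⟨rfl⟩
    Integrable f (Measure.haarMeasure (⊤ : TopologicalSpace.PositiveCompacts K)) := by
  let _ : MeasurableSpace K := borel K
  have : BorelSpace K := ⟨rfl⟩
  exact hf.integrable_of_hasCompactSupport (HasCompactSupport.of_compactSpace f)

theorem haarMean_map [FiniteDimensional ℝ F] [CompleteSpace G] (L : F →L[ℝ] G) {f : K → F}
    (hf : Continuous f) : haarMean (fun k => L (f k)) = L (haarMean f) := by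
  let _ : MeasurableSpace K := borel K
  have : BorelSpace K := ⟨rfl⟩
  have := FiniteDimensional.complete ℝ F
  exact L.integral_comp_comm (integrable_haar hf)

theorem haarMean_sub [FiniteDimensional ℝ F] {f g : K → F} (hf : Continuous f)
    (hg : Continuous g) : haarMean (fun k => f k - g k) = haarMean f - haarMean g := by
  let _ : MeasurableSpace K := borel K
  have : BorelSpace K := ⟨rfl⟩
  exact integral_sub (integrable_haar hf) (integrable_haar hg)

theorem haarMean_add [FiniteDimensional ℝ F] {f g : K → F} (hf : Continuous f)
    (hg : Continuous g) : haarMean (fun k => f k + g k) = haarMean f + haarMean g := by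
  let _ : MeasurableSpace K := borel K
  have : BorelSpace K := ⟨rfl⟩
  exact integral_add (integrable_haar hf) (integrable_haar hg)

theorem norm_haarMean_le {f : K → F} {C : ℝ} (hC : ∀ k, ‖f k‖ ≤ C) : ‖haarMean f‖ ≤ C := by
  let _ : MeasurableSpace K := borel K
  have : BorelSpace K := ⟨rfl⟩
  have h : Measure.haarMeasure (⊤ : TopologicalSpace.PositiveCompacts K) univ = 1 :=
    Measure.haarMeasure_self
  have : IsProbabilityMeasure (Measure.haarMeasure (⊤ : TopologicalSpace.PositiveCompacts K)) :=
    ⟨h⟩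
  have := norm_integral_le_of_norm_le_const
    (μ := Measure.haarMeasure (⊤ : TopologicalSpace.PositiveCompacts K))
    (Filter.Eventually.of_forall hC)
  simpa [haarMean] using this

end HaarMean

/-! ### The isotropy representation and its continuity. -/

section IsotropyRepresentation

variable {n : ℕ} {M : Type*} [TopologicalSpace M]
  [ChartedSpace (EuclideanSpace ℝ (Fin (2 * n))) M] [MulAction (Torus n) M] [TorusManifold n M]

/-- The action of the torus near a fixed point of `t₀`, read in a chart. -/
theorem exists_contDiffAt_action {x : M} {t₀ : Torus n} (ht₀ : t₀ • x = x) :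
    ∃ W : (Fin n → EuclideanSpace ℝ (Fin 1)) × EuclideanSpace ℝ (Fin (2 * n)) →
        EuclideanSpace ℝ (Fin (2 * n)),
      ∃ κ : Torus n → (Fin n → EuclideanSpace ℝ (Fin 1)), ContinuousAt κ t₀ ∧
        ContDiffAt ℝ ∞ W (κ t₀, extChartAt (𝓡 (2 * n)) x x) ∧
        ∀ᶠ t in 𝓝 t₀, ∀ v, (torusToDiff n M t).inChart x v = W (κ t, v) := by
  let J := ModelWithCorners.pi fun _ : Fin n => 𝓡 1
  have h := (TorusManifold.smooth (n := n) (M := M)) (t₀, x)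
  rw [contMDiffAt_iff] at h
  obtain ⟨-, h⟩ := h
  have hr : range (J.prod (𝓡 (2 * n))) = univ := by
    rw [ModelWithCorners.range_prod]
    have h1 : range J = univ := by
      ext v
      simp only [mem_univ, iff_true]
      exact ⟨v, rfl⟩
    rw [h1, (𝓡 (2 * n)).range_eq_univ, univ_prod_univ]
  rw [hr, contDiffWithinAt_univ] at h
  refine ⟨fun q => extChartAt (𝓡 (2 * n)) x
    ((extChartAt J t₀).symm q.1 • (extChartAt (𝓡 (2 * n)) x).symm q.2),
    extChartAt J t₀, continuousAt_extChartAt t₀, ?_, ?_⟩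
  · rw [extChartAt_prod] at h
    simp only [ht₀] at h
    exact h
  · filter_upwards [extChartAt_source_mem_nhds (I := J) t₀] with t ht v
    rw [(extChartAt J t₀).left_inv ht]
    rfl

variable [IsManifold (𝓡 (2 * n)) ∞ M]

variable (n) in
/-- The derivative at `x` of the action of `t`, for `t` in the isotropy group of `x`. -/
noncomputable def isotropyDeriv (x : M) (t : Torus n) :
    EuclideanSpace ℝ (Fin (2 * n)) →L[ℝ] EuclideanSpace ℝ (Fin (2 * n)) :=
  mfderiv (𝓡 (2 * n)) (𝓡 (2 * n)) (torusToDiff n M t) x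

theorem isotropyDeriv_eq_fderiv {x : M} {t : Torus n} (ht : t • x = x) :
    isotropyDeriv n x t =
      fderiv ℝ ((torusToDiff n M t).inChart x) (extChartAt (𝓡 (2 * n)) x x) :=
  ((torusToDiff n M t).fderiv_inChart ht).symm

theorem isotropyDeriv_one (x : M) : isotropyDeriv n x 1 = ContinuousLinearMap.id ℝ _ := by
  rw [isotropyDeriv, map_one]
  exact mfderiv_id

theorem isotropyDeriv_mul {x : M} (s : Torus n) {t : Torus n} (ht : t • x = x) :
    isotropyDeriv n x (s * t) = (isotropyDeriv n x s).comp (isotropyDeriv n x t) := by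
  have h : mfderiv (𝓡 (2 * n)) (𝓡 (2 * n)) (torusToDiff n M (s * t)) x =
      (mfderiv (𝓡 (2 * n)) (𝓡 (2 * n)) (torusToDiff n M s) (torusToDiff n M t x)) ∘L
        (mfderiv (𝓡 (2 * n)) (𝓡 (2 * n)) (torusToDiff n M t) x) := by
    rw [map_mul]
    exact mfderiv_comp x ((torusToDiff n M s).mdifferentiable (by simp) _)
      ((torusToDiff n M t).mdifferentiable (by simp) _)
  have h2 : torusToDiff n M t x = x := ht
  -- The tangent space depends on the base point, so `t • x` cannot be rewritten to `x` directly;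
  -- the base point is generalised first.
  have h3 : ∀ y : M, y = x →
      (mfderiv (𝓡 (2 * n)) (𝓡 (2 * n)) (torusToDiff n M s) y :
        EuclideanSpace ℝ (Fin (2 * n)) →L[ℝ] EuclideanSpace ℝ (Fin (2 * n))) =
      isotropyDeriv n x s := by
    rintro y rfl
    rfl
  exact h.trans (congrArg (fun A : EuclideanSpace ℝ (Fin (2 * n)) →L[ℝ]
    EuclideanSpace ℝ (Fin (2 * n)) => A.comp (isotropyDeriv n x t)) (h3 _ h2))

/-- The action is jointly smooth in group and chart coordinates, so its partial derivative in the
chart variable is jointly continuous. Joint continuity is what makes estimates uniform over the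
compact isotropy group. -/
theorem eventually_fderiv_action {x : M} {t₀ : Torus n} (ht₀ : t₀ • x = x) :
    ContinuousAt (fun p : Torus n × EuclideanSpace ℝ (Fin (2 * n)) =>
        fderiv ℝ ((torusToDiff n M p.1).inChart x) p.2) (t₀, extChartAt (𝓡 (2 * n)) x x) ∧
      ∀ᶠ p : Torus n × EuclideanSpace ℝ (Fin (2 * n)) in 𝓝 (t₀, extChartAt (𝓡 (2 * n)) x x),
        DifferentiableAt ℝ ((torusToDiff n M p.1).inChart x) p.2 := by
  obtain ⟨W, κ, hκ, hW, hev⟩ := exists_contDiffAt_action (M := M) ht₀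
  set p₀ := (t₀, extChartAt (𝓡 (2 * n)) x x) with hp₀
  let i : EuclideanSpace ℝ (Fin (2 * n)) →L[ℝ]
      (Fin n → EuclideanSpace ℝ (Fin 1)) × EuclideanSpace ℝ (Fin (2 * n)) :=
    ContinuousLinearMap.inr ℝ _ _
  have hm : ContinuousAt (fun p : Torus n × EuclideanSpace ℝ (Fin (2 * n)) => (κ p.1, p.2)) p₀ :=
    (ContinuousAt.comp (f := Prod.fst) (x := p₀) (g := κ) hκ continuousAt_fst).prodMk
      continuousAt_snd
  have hd : ∀ᶠ q in 𝓝 (κ t₀, extChartAt (𝓡 (2 * n)) x x), DifferentiableAt ℝ W q :=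
    ((hW.of_le (m := 1) (by simp)).eventually (by simp)).mono
      fun q hq => hq.differentiableAt (by simp)
  have hev' : ∀ᶠ p : Torus n × EuclideanSpace ℝ (Fin (2 * n)) in 𝓝 p₀,
      ∀ v, (torusToDiff n M p.1).inChart x v = W (κ p.1, v) :=
    continuousAt_fst.eventually (p := fun t => ∀ v, (torusToDiff n M t).inChart x v = W (κ t, v))
      hev
  have hder : ∀ᶠ p : Torus n × EuclideanSpace ℝ (Fin (2 * n)) in 𝓝 p₀,
      HasFDerivAt ((torusToDiff n M p.1).inChart x) ((fderiv ℝ W (κ p.1, p.2)).comp i) p.2 := by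
    filter_upwards [hev', hm.eventually hd] with p h1 h2
    have : (torusToDiff n M p.1).inChart x = fun v => W (κ p.1, v) := funext h1
    rw [this]
    have h3 : HasFDerivAt W (fderiv ℝ W (κ p.1, p.2)) ((κ p.1, p.2)) := h2.hasFDerivAt
    exact h3.comp (f := fun v => (κ p.1, v)) p.2 (hasFDerivAt_prodMk_right (κ p.1) p.2)
  refine ⟨?_, hder.mono fun p hp => hp.differentiableAt⟩
  have hc : ContinuousAt (fun p : Torus n × EuclideanSpace ℝ (Fin (2 * n)) =>
      (fderiv ℝ W (κ p.1, p.2)).comp i) p₀ := by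
    have h1 := (hW.fderiv_right (m := ∞) (by simp)).continuousAt
    have h2 : ContinuousAt (fun p : Torus n × EuclideanSpace ℝ (Fin (2 * n)) =>
      fderiv ℝ W (κ p.1, p.2)) p₀ := ContinuousAt.comp
        (f := fun p : Torus n × EuclideanSpace ℝ (Fin (2 * n)) => (κ p.1, p.2)) h1 hm
    exact h2.clm_comp continuousAt_const
  exact hc.congr (hder.mono fun p hp => hp.fderiv.symm)

theorem isotropyDeriv_continuousOn (x : M) :
    Continuous fun k : stabilizer (Torus n) x => isotropyDeriv n x (k : Torus n) := by
  have h : ∀ k : stabilizer (Torus n) x, isotropyDeriv n x (k : Torus n) =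
      fderiv ℝ ((torusToDiff n M (k : Torus n)).inChart x) (extChartAt (𝓡 (2 * n)) x x) :=
    fun k => isotropyDeriv_eq_fderiv k.2
  simp_rw [h]
  refine continuous_iff_continuousAt.2 fun k => ?_
  have hc := (eventually_fderiv_action (M := M) (x := x) (t₀ := (k : Torus n)) k.2).1
  exact ContinuousAt.comp (f := fun k : stabilizer (Torus n) x =>
    ((k : Torus n), extChartAt (𝓡 (2 * n)) x x)) hc
    (by fun_prop)

variable (n) in
/-- The isotropy representation at `x`. -/
noncomputable def isotropyRep (x : M) : stabilizer (Torus n) x →*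
    (EuclideanSpace ℝ (Fin (2 * n)) →L[ℝ] EuclideanSpace ℝ (Fin (2 * n))) where
  toFun k := isotropyDeriv n x (k : Torus n)
  map_one' := isotropyDeriv_one x
  map_mul' s t := isotropyDeriv_mul (s : Torus n) t.2

theorem isotropyRep_continuous (x : M) : Continuous (isotropyRep n x) :=
  isotropyDeriv_continuousOn x

end IsotropyRepresentation

/-! ### Linearization of the isotropy action near a point. -/

section Linearization

variable {n : ℕ} {M : Type*} [TopologicalSpace M]
  [ChartedSpace (EuclideanSpace ℝ (Fin (2 * n))) M] [MulAction (Torus n) M] [TorusManifold n M]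

theorem isClosed_stabilizer [T2Space M] (x : M) :
    IsClosed (stabilizer (Torus n) x : Set (Torus n)) := by
  have h : Continuous fun t : Torus n => t • x :=
    (TorusManifold.continuous_smul (n := n) (M := M)).comp
      (by fun_prop : Continuous fun t : Torus n => (t, x))
  exact isClosed_eq h continuous_const

theorem compactSpace_stabilizer [T2Space M] (x : M) : CompactSpace (stabilizer (Torus n) x) :=
  isCompact_iff_compactSpace.1 (isClosed_stabilizer x).isCompact

/-- The isotropy group is compact and fixes `x`, so by the tube lemma one neighbourhood serves all
of its elements. -/
theorem eventually_smul_mem_chart_source [T2Space M] (x : M) : ∀ᶠ v in 𝓝 (extChartAt (𝓡 (2 * n)) x x),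
    ∀ t ∈ (stabilizer (Torus n) x : Set (Torus n)),
      t • (extChartAt (𝓡 (2 * n)) x).symm v ∈ (extChartAt (𝓡 (2 * n)) x).source := by
  refine (isClosed_stabilizer x).isCompact.eventually_forall_of_forall_eventually fun t ht => ?_
  have hc : ContinuousAt (fun z : EuclideanSpace ℝ (Fin (2 * n)) × Torus n =>
      z.2 • (extChartAt (𝓡 (2 * n)) x).symm z.1) (extChartAt (𝓡 (2 * n)) x x, t) := by
    refine (TorusManifold.continuous_smul (n := n) (M := M)).continuousAt.comp
      (f := fun z : EuclideanSpace ℝ (Fin (2 * n)) × Torus n =>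
        (z.2, (extChartAt (𝓡 (2 * n)) x).symm z.1)) (continuousAt_snd.prodMk ?_)
    exact ContinuousAt.comp (f := Prod.fst) (g := (extChartAt (𝓡 (2 * n)) x).symm)
      (continuousAt_extChartAt_symm x) continuousAt_fst
  refine hc.eventually_mem ?_
  change (extChartAt (𝓡 (2 * n)) x).source ∈ 𝓝 (t • (extChartAt (𝓡 (2 * n)) x).symm
    (extChartAt (𝓡 (2 * n)) x x))
  rw [extChartAt_to_inv, mem_stabilizer_iff.1 ht]
  exact extChartAt_source_mem_nhds x

variable [IsManifold (𝓡 (2 * n)) ∞ M]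

/-- Again the tube lemma, now applied to the jointly continuous derivative. -/
theorem eventually_norm_fderiv_action_sub_le [T2Space M] (x : M) {ε : ℝ} (hε : 0 < ε) :
    ∀ᶠ v in 𝓝 (extChartAt (𝓡 (2 * n)) x x), ∀ t ∈ (stabilizer (Torus n) x : Set (Torus n)),
      DifferentiableAt ℝ ((torusToDiff n M t).inChart x) v ∧
        ‖fderiv ℝ ((torusToDiff n M t).inChart x) v - isotropyDeriv n x t‖ ≤ ε := by
  have key := (isClosed_stabilizer x).isCompact.eventually_forall_of_forall_eventually
    (x₀ := extChartAt (𝓡 (2 * n)) x x)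
    (P := fun v t => DifferentiableAt ℝ ((torusToDiff n M t).inChart x) v ∧
      ‖fderiv ℝ ((torusToDiff n M t).inChart x) v -
        fderiv ℝ ((torusToDiff n M t).inChart x) (extChartAt (𝓡 (2 * n)) x x)‖ ≤ ε)
    fun t ht => ?_
  · filter_upwards [key] with v hv t ht
    rw [isotropyDeriv_eq_fderiv ht]
    exact hv t ht
  · obtain ⟨h1, h2⟩ := eventually_fderiv_action (M := M) (mem_stabilizer_iff.1 ht)
    have hswap : Filter.Tendsto (fun z : EuclideanSpace ℝ (Fin (2 * n)) × Torus n => (z.2, z.1))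
        (𝓝 (extChartAt (𝓡 (2 * n)) x x, t)) (𝓝 (t, extChartAt (𝓡 (2 * n)) x x)) :=
      (continuous_swap.tendsto (extChartAt (𝓡 (2 * n)) x x, t))
    have hproj : Filter.Tendsto
        (fun z : EuclideanSpace ℝ (Fin (2 * n)) × Torus n => (z.2, extChartAt (𝓡 (2 * n)) x x))
        (𝓝 (extChartAt (𝓡 (2 * n)) x x, t)) (𝓝 (t, extChartAt (𝓡 (2 * n)) x x)) :=
      (by fun_prop : Continuous fun z : EuclideanSpace ℝ (Fin (2 * n)) × Torus n =>
        (z.2, extChartAt (𝓡 (2 * n)) x x)).tendsto (extChartAt (𝓡 (2 * n)) x x, t)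
    have h3 := ((h1.tendsto.comp hswap).sub (h1.tendsto.comp hproj)).norm
    rw [sub_self, norm_zero] at h3
    exact (hswap.eventually h2).and ((h3.eventually (gt_mem_nhds hε)).mono fun z hz => hz.le)

variable (n) in
/-- The average over the isotropy group of `x` of the translates of a chart at `x`. -/
noncomputable def averagedChart [T2Space M] (x y : M) : EuclideanSpace ℝ (Fin (2 * n)) :=
  haveI := compactSpace_stabilizer (n := n) x
  haarMean fun k : stabilizer (Torus n) x => isotropyRep n x k⁻¹
    (extChartAt (𝓡 (2 * n)) x ((k : Torus n) • y) - extChartAt (𝓡 (2 * n)) x x)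

theorem averagedChart_self [T2Space M] (x : M) : averagedChart n x x = 0 := by
  have := compactSpace_stabilizer (n := n) x
  have h : ∀ k : stabilizer (Torus n) x, isotropyRep n x k⁻¹
      (extChartAt (𝓡 (2 * n)) x ((k : Torus n) • x) - extChartAt (𝓡 (2 * n)) x x) = 0 := fun k => by
    rw [mem_stabilizer_iff.1 k.2, sub_self, map_zero]
  simp_rw [averagedChart, h]
  exact haarMean_const 0

variable (n) in
/-- The isotropy representation, by continuous linear equivalences. -/
noncomputable def isotropyEquiv (x : M) (k : stabilizer (Torus n) x) :
    EuclideanSpace ℝ (Fin (2 * n)) ≃L[ℝ] EuclideanSpace ℝ (Fin (2 * n)) :=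
  ContinuousLinearEquiv.equivOfInverse (isotropyRep n x k) (isotropyRep n x k⁻¹)
    (fun v => by
      have : (isotropyRep n x k⁻¹ * isotropyRep n x k) v = v := by
        rw [← map_mul, inv_mul_cancel, map_one]
        rfl
      exact this)
    (fun v => by
      have : (isotropyRep n x k * isotropyRep n x k⁻¹) v = v := by
        rw [← map_mul, mul_inv_cancel, map_one]
        rfl
      exact this)

/-- Translation invariance of the mean, together with commutativity of the torus, moves `h` out of
the average. -/
theorem averagedChart_smul [T2Space M] (x : M) (h : stabilizer (Torus n) x) (y : M) :
    averagedChart n x ((h : Torus n) • y) = isotropyRep n x h (averagedChart n x y) := by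
  have := compactSpace_stabilizer (n := n) x
  have e := haarMean_equiv (isotropyEquiv n x h) (fun k : stabilizer (Torus n) x =>
    isotropyRep n x k⁻¹
      (extChartAt (𝓡 (2 * n)) x ((k : Torus n) • y) - extChartAt (𝓡 (2 * n)) x x))
  refine Eq.trans ?_ e
  rw [← haarMean_mul_left _ h, averagedChart]
  congr 1
  ext1 k
  change _ = (isotropyRep n x h * isotropyRep n x (h * k)⁻¹) _
  have e2 : ((h * k : stabilizer (Torus n) x) : Torus n) • y = (k : Torus n) • (h : Torus n) • y := by
    rw [mul_comm h k, Subgroup.coe_mul, mul_smul]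
  rw [← map_mul, mul_inv_rev, mul_comm k⁻¹, mul_inv_cancel_left, e2]

/-- Formally, the derivative of the integrand at `x` is `ρ(k)⁻¹ ρ(k) = id` for each `k`. The mean
value inequality, uniform in `k`, allows differentiation under the mean and gives strictness, as the
inverse function theorem requires. -/
theorem averagedChart_hasStrictFDerivAt [T2Space M] (x : M) :
    HasStrictFDerivAt (fun v => averagedChart n x ((extChartAt (𝓡 (2 * n)) x).symm v))
      (ContinuousLinearMap.id ℝ (EuclideanSpace ℝ (Fin (2 * n)))) (extChartAt (𝓡 (2 * n)) x x) := by
  have := compactSpace_stabilizer (n := n) x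
  set c := extChartAt (𝓡 (2 * n)) x with hc
  obtain ⟨C, hC⟩ := isCompact_univ.exists_bound_of_continuousOn
    (isotropyRep_continuous (n := n) x).continuousOn
  replace hC : ∀ k, ‖isotropyRep n x k‖ ≤ C := fun k => hC k (mem_univ k)
  have hC0 : 0 ≤ C := (norm_nonneg _).trans (hC 1)
  refine HasStrictFDerivAt.of_isLittleO (Asymptotics.isLittleO_iff.2 fun ε hε => ?_)
  -- `C` bounds the isotropy operators; `C + 1` absorbs that factor and is positive even if `C` is
  -- zero.
  have hε' : 0 < ε / (C + 1) := by positivity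
  obtain ⟨r, hr, hball⟩ := Metric.eventually_nhds_iff_ball.1
    ((eventually_norm_fderiv_action_sub_le x hε').and
      ((eventually_smul_mem_chart_source x).and (extChartAt_target_mem_nhds (I := 𝓡 (2 * n)) x)))
  have hmem : Metric.ball (c x) r ×ˢ Metric.ball (c x) r ∈ 𝓝 (c x, c x) :=
    prod_mem_nhds (Metric.ball_mem_nhds _ hr) (Metric.ball_mem_nhds _ hr)
  filter_upwards [hmem] with p hp
  have hcont : ∀ v ∈ Metric.ball (c x) r, Continuous fun k : stabilizer (Torus n) x =>
      isotropyRep n x k⁻¹ (c ((k : Torus n) • c.symm v) - c x) := by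
    intro v hv
    have h1 : Continuous fun k : stabilizer (Torus n) x => c ((k : Torus n) • c.symm v) := by
      refine (continuousOn_extChartAt x).comp_continuous ?_
        fun k => (hball v hv).2.1 (k : Torus n) k.2
      exact (TorusManifold.continuous_smul (n := n) (M := M)).comp
        (by fun_prop : Continuous fun k : stabilizer (Torus n) x => ((k : Torus n), c.symm v))
    exact ((isotropyRep_continuous x).comp continuous_inv).clm_apply (h1.sub continuous_const)
  -- The increment is itself written as a mean, so that the whole error becomes a single mean, to be
  -- bounded pointwise in `k`.
  have hrep : p.1 - p.2 = haarMean fun k : stabilizer (Torus n) x =>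
      isotropyRep n x k⁻¹ (isotropyRep n x k (p.1 - p.2)) := by
    have : ∀ k, isotropyRep n x k⁻¹ (isotropyRep n x k (p.1 - p.2)) = p.1 - p.2 :=
      fun k => (isotropyEquiv n x k).symm_apply_apply _
    simp_rw [this]
    exact (haarMean_const _).symm
  have hcont' : Continuous fun k : stabilizer (Torus n) x =>
      isotropyRep n x k⁻¹ (isotropyRep n x k (p.1 - p.2)) :=
    ((isotropyRep_continuous x).comp continuous_inv).clm_apply
      ((isotropyRep_continuous x).clm_apply continuous_const)
  have hdiff : averagedChart n x (c.symm p.1) - averagedChart n x (c.symm p.2) - (p.1 - p.2) =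
      haarMean fun k : stabilizer (Torus n) x => isotropyRep n x k⁻¹
        (c ((k : Torus n) • c.symm p.1) - c ((k : Torus n) • c.symm p.2) -
          isotropyRep n x k (p.1 - p.2)) := by
    conv_lhs => rw [hrep]
    have hcont2 : Continuous fun k : stabilizer (Torus n) x =>
        isotropyRep n x k⁻¹ (c ((k : Torus n) • c.symm p.1) - c x) -
          isotropyRep n x k⁻¹ (c ((k : Torus n) • c.symm p.2) - c x) :=
      (hcont _ hp.1).sub (hcont _ hp.2)
    rw [averagedChart, averagedChart, ← haarMean_sub (hcont _ hp.1) (hcont _ hp.2),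
      ← haarMean_sub hcont2 hcont']
    congr 1
    ext1 k
    rw [← map_sub, ← map_sub, sub_sub_sub_cancel_right]
  rw [ContinuousLinearMap.id_apply, hdiff]
  refine norm_haarMean_le fun k => ?_
  have hmv := (convex_ball (c x) r).norm_image_sub_le_of_norm_fderiv_le'
    (f := (torusToDiff n M (k : Torus n)).inChart x) (φ := isotropyRep n x k)
    (C := ε / (C + 1))
    (fun v hv => ((hball v hv).1 (k : Torus n) k.2).1)
    (fun v hv => ((hball v hv).1 (k : Torus n) k.2).2) hp.2 hp.1
  calc _ ≤ C * (ε / (C + 1) * ‖p.1 - p.2‖) :=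
        (ContinuousLinearMap.le_of_opNorm_le _ (hC _) _).trans (by gcongr; exact hmv)
    _ = (C / (C + 1)) * (ε * ‖p.1 - p.2‖) := by ring
    _ ≤ 1 * (ε * ‖p.1 - p.2‖) := by
        gcongr
        rw [div_le_one (by positivity)]
        linarith
    _ = _ := one_mul _

/-- The action of the isotropy group of `x` is linear near `x`, in a suitable chart. -/
theorem exists_linearization [T2Space M] (x : M) :
    ∃ Φ : OpenPartialHomeomorph M (EuclideanSpace ℝ (Fin (2 * n))), x ∈ Φ.source ∧ Φ x = 0 ∧
      (∀ k : stabilizer (Torus n) x, ∀ y ∈ Φ.source, (k : Torus n) • y ∈ Φ.source) ∧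
      ∀ (k : stabilizer (Torus n) x) (y : M), y ∈ Φ.source →
        Φ ((k : Torus n) • y) = isotropyRep n x k (Φ y) := by
  have hs : HasStrictFDerivAt (fun v => averagedChart n x ((extChartAt (𝓡 (2 * n)) x).symm v))
      ((ContinuousLinearEquiv.refl ℝ (EuclideanSpace ℝ (Fin (2 * n))) :
        EuclideanSpace ℝ (Fin (2 * n)) →L[ℝ] EuclideanSpace ℝ (Fin (2 * n))))
      (extChartAt (𝓡 (2 * n)) x x) := averagedChart_hasStrictFDerivAt x
  let Ψ := (chartAt (EuclideanSpace ℝ (Fin (2 * n))) x).trans (hs.toOpenPartialHomeomorph _)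
  have hΨ : ∀ y ∈ Ψ.source, Ψ y = averagedChart n x y := by
    intro y hy
    have h1 : y ∈ (extChartAt (𝓡 (2 * n)) x).source := by
      rw [extChartAt_source]
      exact hy.1
    change averagedChart n x ((extChartAt (𝓡 (2 * n)) x).symm (extChartAt (𝓡 (2 * n)) x y)) = _
    rw [(extChartAt (𝓡 (2 * n)) x).left_inv h1]
  have hxΨ : x ∈ Ψ.source := ⟨mem_chart_source _ x, hs.mem_toOpenPartialHomeomorph_source⟩
  -- The largest subset of the domain stable under the isotropy group: the intersection of all
  -- translates of the domain. It is open because that group is compact.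
  let U : Set M := {y | ∀ t ∈ (stabilizer (Torus n) x : Set (Torus n)), t • y ∈ Ψ.source}
  have hU : IsOpen U := by
    refine isOpen_iff_eventually.2 fun y hy => ?_
    refine (isClosed_stabilizer x).isCompact.eventually_forall_of_forall_eventually fun t ht => ?_
    have hc : Continuous fun z : M × Torus n => z.2 • z.1 :=
      (TorusManifold.continuous_smul (n := n) (M := M)).comp continuous_swap
    exact hc.continuousAt.eventually_mem (Ψ.open_source.mem_nhds (hy t ht))
  have hUsub : U ⊆ Ψ.source := fun y hy => by
    simpa using hy 1 (Subgroup.one_mem _)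
  have hsrc : (Ψ.restrOpen U hU).source = U := by
    rw [OpenPartialHomeomorph.restrOpen_source]
    exact inter_eq_right.2 hUsub
  have hstab : ∀ k : stabilizer (Torus n) x, ∀ y ∈ U, (k : Torus n) • y ∈ U := by
    intro k y hy t ht
    rw [← mul_smul]
    exact hy _ (Subgroup.mul_mem _ ht k.2)
  refine ⟨Ψ.restrOpen U hU, ?_, ?_, ?_, ?_⟩
  · rw [hsrc]
    intro t ht
    rw [mem_stabilizer_iff.1 ht]
    exact hxΨ
  · exact (hΨ x hxΨ).trans (averagedChart_self x)
  · rw [hsrc]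
    exact hstab
  · rw [hsrc]
    intro k y hy
    change Ψ _ = isotropyRep n x k (Ψ y)
    rw [hΨ _ (hUsub (hstab k y hy)), hΨ _ (hUsub hy), averagedChart_smul]

end Linearization

/-! ### Faithfulness of the isotropy representation. -/

section Faithfulness

variable {n : ℕ} {M : Type*} [TopologicalSpace M]
  [ChartedSpace (EuclideanSpace ℝ (Fin (2 * n))) M] [MulAction (Torus n) M] [TorusManifold n M]
  [IsManifold (𝓡 (2 * n)) ∞ M] [T2Space M]

theorem eventually_smul_eq_of_isotropyRep_eq_one {x : M} {k : stabilizer (Torus n) x}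
    (hk : isotropyRep n x k = 1) : ∀ᶠ y in 𝓝 x, (k : Torus n) • y = y := by
  obtain ⟨Φ, hx, -, hinv, hequiv⟩ := exists_linearization (n := n) x
  filter_upwards [Φ.open_source.mem_nhds hx] with y hy
  refine Φ.injOn (hinv k y hy) hy ?_
  rw [hequiv k y hy, hk]
  rfl

/-- In linearizing coordinates at `x` the element `k` is linear and fixes an open set pointwise. Its
fixed vectors form a subspace with nonempty interior, hence the whole space. -/
theorem isotropyRep_eq_one_of_frequently {x : M} {k : stabilizer (Torus n) x}
    (hk : x ∈ closure {y : M | ∀ᶠ z in 𝓝 y, (k : Torus n) • z = z}) : isotropyRep n x k = 1 := by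
  obtain ⟨Φ, hx, -, hinv, hequiv⟩ := exists_linearization (n := n) x
  obtain ⟨y, hys, hy⟩ := mem_closure_iff_nhds.1 hk _ (Φ.open_source.mem_nhds hx)
  let p : Submodule ℝ (EuclideanSpace ℝ (Fin (2 * n))) :=
    LinearMap.eqLocus (isotropyRep n x k : _ →ₗ[ℝ] _) LinearMap.id
  have hmem : ∀ᶠ v in 𝓝 (Φ y), v ∈ p := by
    have h1 : ContinuousAt Φ.symm (Φ y) := Φ.symm.continuousAt (Φ.map_source hys)
    have h2 : ∀ᶠ v in 𝓝 (Φ y), (k : Torus n) • Φ.symm v = Φ.symm v := by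
      refine h1.eventually (p := fun z => (k : Torus n) • z = z) ?_
      rw [Φ.left_inv hys]
      exact hy
    filter_upwards [h2, Φ.open_target.mem_nhds (Φ.map_source hys)] with v hv hvt
    have h3 := hequiv k _ (Φ.map_target hvt)
    rw [hv, Φ.right_inv hvt] at h3
    exact h3.symm
  have htop : p = ⊤ := p.eq_top_of_nonempty_interior' ⟨Φ y, mem_interior_iff_mem_nhds.2 hmem⟩
  ext1 v
  exact (htop ▸ Submodule.mem_top : v ∈ p)

/-- The isotropy representation of an effective torus action on a connected manifold is
faithful. -/
theorem eq_one_of_isotropyRep_eq_one [ConnectedSpace M] {x : M} {k : stabilizer (Torus n) x}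
    (hk : isotropyRep n x k = 1) : (k : Torus n) = 1 := by
  let S : Set M := {y : M | ∀ᶠ z in 𝓝 y, (k : Torus n) • z = z}
  have hopen : IsOpen S := isOpen_iff_eventually.2 fun y hy => hy.eventually_nhds
  have hclosed : IsClosed S := by
    refine isClosed_of_closure_subset fun y hy => ?_
    have := TorusManifold.continuousConstSMul (n := n) (M := M)
    have hfix : (k : Torus n) • y = y := by
      have hcl : IsClosed {y : M | (k : Torus n) • y = y} :=
        isClosed_eq (continuous_const_smul _) continuous_id
      exact closure_minimal (fun z hz =>
        Filter.Eventually.self_of_nhds (p := fun z => (k : Torus n) • z = z) hz) hcl hy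
    exact eventually_smul_eq_of_isotropyRep_eq_one (k := ⟨(k : Torus n), hfix⟩)
      (isotropyRep_eq_one_of_frequently hy)
  have huniv := IsClopen.eq_univ ⟨hclosed, hopen⟩
    ⟨x, eventually_smul_eq_of_isotropyRep_eq_one hk⟩
  refine torus_eq_of_smul_eq (M := M) fun y => ?_
  rw [one_smul]
  exact Filter.Eventually.self_of_nhds (p := fun z => (k : Torus n) • z = z)
    (huniv ▸ mem_univ y : y ∈ S)

end Faithfulness

/-! ### Unitary characters in real representations of compact commutative groups. -/

section Weights

/-- A nonzero invariant subspace `W` of least dimension is chosen. An eigenspace of any `f i` inside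
`W` is again invariant by commutation, so it is all of `W`; every vector of `W` is a joint
eigenvector. -/
theorem exists_joint_eigenvector {ι E : Type*} [AddCommGroup E] [Module ℂ E]
    [FiniteDimensional ℂ E] [Nontrivial E] (f : ι → Module.End ℂ E)
    (hf : ∀ i j, Commute (f i) (f j)) : ∃ v ≠ 0, ∀ i, ∃ c : ℂ, f i v = c • v := by
  let P : ℕ → Prop := fun d => ∃ W : Submodule ℂ E, W ≠ ⊥ ∧ (∀ i, ∀ w ∈ W, f i w ∈ W) ∧
    Module.finrank ℂ W = d
  have hP : ∃ d, P d := ⟨_, ⊤, top_ne_bot, fun _ _ _ => Submodule.mem_top, rfl⟩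
  classical
  obtain ⟨W, hW0, hWinv, hWd⟩ := Nat.find_spec hP
  obtain ⟨v, hvW, hv0⟩ := Submodule.exists_mem_ne_zero_of_ne_bot hW0
  refine ⟨v, hv0, fun i => ?_⟩
  have : Nontrivial W := Submodule.nontrivial_iff_ne_bot.2 hW0
  obtain ⟨c, hc⟩ := Module.End.exists_eigenvalue ((f i).restrict (hWinv i))
  obtain ⟨w, hw⟩ := hc.exists_hasEigenvector
  let W' : Submodule ℂ E := W ⊓ (f i).eigenspace c
  have hW'W : W' ≤ W := inf_le_left
  have hW' : P (Module.finrank ℂ W') := by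
    refine ⟨W', ?_, fun j u hu => ⟨hWinv j u hu.1, ?_⟩, rfl⟩
    · refine (Submodule.ne_bot_iff _).2 ⟨w, ⟨w.2, ?_⟩, fun h => hw.2 (Subtype.ext h)⟩
      exact Module.End.mem_eigenspace_iff.2 (congrArg Subtype.val hw.apply_eq_smul)
    · have h1 : f i u = c • u := Module.End.mem_eigenspace_iff.1 hu.2
      have h2 : f i (f j u) = c • f j u := by
        have := DFunLike.congr_fun (hf i j) u
        rw [Module.End.mul_apply, Module.End.mul_apply, h1, map_smul] at this
        exact this
      exact Module.End.mem_eigenspace_iff.2 h2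
  have hle : Module.finrank ℂ W ≤ Module.finrank ℂ W' := by
    rw [hWd]
    exact Nat.find_min' hP hW'
  have heq : W' = W := Submodule.eq_of_le_of_finrank_le hW'W hle
  exact ⟨c, Module.End.mem_eigenspace_iff.1 (heq ▸ hvW : v ∈ W').2⟩

variable {K : Type*} [CommGroup K] [TopologicalSpace K] [IsTopologicalGroup K] [CompactSpace K]
  {V : Type*} [NormedAddCommGroup V] [NormedSpace ℝ V] [FiniteDimensional ℝ V]

theorem norm_le_one_of_bounded_pow {z : ℂ} {C : ℝ} (h : ∀ m : ℕ, ‖z ^ m‖ ≤ C) : ‖z‖ ≤ 1 := by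
  by_contra! hz
  obtain ⟨m, hm⟩ := pow_unbounded_of_one_lt C hz
  have := h m
  rw [norm_pow] at this
  linarith

/-- The scalars by which a compact group acts on an equivariant functional form a unitary
character. -/
theorem exists_unitary_character (ρ : K →* (V →L[ℝ] V)) (hρ : Continuous ρ) (N : Submodule ℝ V)
    (hN : ∀ k, ∀ v ∈ N, ρ k v ∈ N)
    (l : N →ₗ[ℝ] ℂ) (hl : l ≠ 0) (χ : K → ℂ)
    (h : ∀ k (v : N), l ⟨ρ k v, hN k v v.2⟩ = χ k * l v) :
    ∃ ψ : K →* Circle, Continuous ψ ∧ ∀ k, (ψ k : ℂ) = χ k := by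
  obtain ⟨v, hv⟩ : ∃ v, l v ≠ 0 := by
    by_contra! h0
    exact hl (LinearMap.ext h0)
  have hone : χ 1 = 1 := by
    have := h 1 v
    simp only [map_one, one_apply_eq_self] at this
    exact (mul_right_cancel₀ hv ((one_mul _).trans this)).symm
  have hmul : ∀ s t, χ (s * t) = χ s * χ t := by
    intro s t
    have h1 := h (s * t) v
    have h2 := h s ⟨ρ t v, hN t v v.2⟩
    rw [h t v] at h2
    have h3 : (⟨ρ (s * t) v, hN (s * t) v v.2⟩ : N) = ⟨ρ s (ρ t v), hN s _ (hN t v v.2)⟩ :=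
      Subtype.ext (DFunLike.congr_fun (map_mul ρ s t) (v : V))
    rw [h3] at h1
    exact mul_right_cancel₀ hv (by rw [← h1, h2, mul_assoc])
  have hcont : Continuous χ := by
    have h1 : χ = fun k => l ⟨ρ k v, hN k v v.2⟩ / l v := funext fun k => by
      rw [h, mul_div_cancel_right₀ _ hv]
    rw [h1]
    refine Continuous.div_const (l.continuous_of_finiteDimensional.comp ?_) _
    exact (hρ.clm_apply continuous_const).subtype_mk _
  let χ' : K →* ℂ := ⟨⟨χ, hone⟩, hmul⟩
  obtain ⟨C, hC⟩ := isCompact_univ.exists_bound_of_continuousOn hcont.continuousOn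
  have hle : ∀ k, ‖χ k‖ ≤ 1 := fun k => norm_le_one_of_bounded_pow (C := C) fun m => by
    have : χ k ^ m = χ (k ^ m) := (map_pow χ' k m).symm
    rw [this]
    exact hC _ (mem_univ _)
  have hnorm : ∀ k, ‖χ k‖ = 1 := fun k => by
    refine le_antisymm (hle k) ?_
    have h1 : ‖χ k‖ * ‖χ k⁻¹‖ = 1 := by rw [← norm_mul, ← hmul, mul_inv_cancel, hone, norm_one]
    nlinarith [hle k⁻¹, norm_nonneg (χ k)]
  refine ⟨⟨⟨fun k => ⟨χ k, mem_sphere_zero_iff_norm.2 (hnorm k)⟩, Circle.ext hone⟩,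
    fun s t => Circle.ext (hmul s t)⟩, ?_, fun k => rfl⟩
  exact hcont.subtype_mk _

/-- A real-valued unitary character takes only the values `1` and `-1`; on a connected group the
intermediate value theorem leaves only `1`. -/
theorem exists_im_ne_zero_of_ne_one [ConnectedSpace K] (ψ : K →* Circle) (hψ : Continuous ψ)
    (h : ψ ≠ 1) : ∃ k, (ψ k : ℂ).im ≠ 0 := by
  by_contra! him
  have hsq : ∀ k, (ψ k : ℂ).re * (ψ k : ℂ).re = 1 := fun k => by
    have := Circle.normSq_coe (ψ k)
    rw [Complex.normSq_apply, him k] at this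
    linarith
  have hre : ∃ k, (ψ k : ℂ).re ≤ 0 := by
    by_contra! hpos
    refine h (MonoidHom.ext fun k => Circle.ext (Complex.ext ?_ ?_))
    · have := hsq k
      have := hpos k
      simp only [MonoidHom.one_apply, Circle.coe_one, Complex.one_re]
      nlinarith
    · simpa using him k
  obtain ⟨k, hk⟩ := mem_range_of_exists_le_of_exists_ge
    (f := fun k => (ψ k : ℂ).re) (c := 0)
    (Complex.continuous_re.comp (continuous_subtype_val.comp hψ)) hre ⟨1, by simp⟩
  have := hsq k
  simp only at hk
  simp [hk] at this

/-- On an invariant subspace with nontrivial action there is an equivariant complex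
coordinate. -/
theorem exists_equivariant_functional [ConnectedSpace K] (ρ : K →* (V →L[ℝ] V))
    (hρ : Continuous ρ) (N : Submodule ℝ V) (hN : ∀ k, ∀ v ∈ N, ρ k v ∈ N)
    (hne : ∃ k, ∃ v ∈ N, ρ k v ≠ v) :
    ∃ (ψ : K →* Circle) (l : V →L[ℝ] ℂ), Continuous ψ ∧ (∀ k v, l (ρ k v) = ψ k * l v) ∧
      ∀ z, ∃ v ∈ N, l v = z := by
  -- Passing to the span of the differences `ρ k v - v` excludes the trivial character: an invariant
  -- functional vanishes on all of them.
  let N₁ : Submodule ℝ V := Submodule.span ℝ {w | ∃ k, ∃ v ∈ N, w = ρ k v - v}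
  have hN₁N : N₁ ≤ N := Submodule.span_le.2 (by
    rintro _ ⟨k, v, hv, rfl⟩
    exact N.sub_mem (hN k v hv) hv)
  have hcomm : ∀ s t v, ρ s (ρ t v) = ρ t (ρ s v) := fun s t v => by
    change (ρ s * ρ t) v = (ρ t * ρ s) v
    rw [← map_mul, mul_comm, map_mul]
  have hinv : ∀ k, ∀ v ∈ N₁, ρ k v ∈ N₁ := by
    intro k v hv
    induction hv using Submodule.span_induction with
    | mem w hw =>
      obtain ⟨s, v, hv, rfl⟩ := hw
      refine Submodule.subset_span ⟨s, ρ k v, hN k v hv, ?_⟩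
      rw [map_sub, hcomm]
    | zero => simp
    | add v w _ _ h1 h2 => rw [map_add]; exact N₁.add_mem h1 h2
    | smul a v _ h1 => rw [map_smul]; exact N₁.smul_mem a h1
  have hN₁ : Nontrivial N₁ := by
    obtain ⟨k, v, hv, hkv⟩ := hne
    refine (Submodule.nontrivial_iff_ne_bot).2 ((Submodule.ne_bot_iff _).2
      ⟨ρ k v - v, Submodule.subset_span ⟨k, v, hv, rfl⟩, sub_ne_zero.2 hkv⟩)
  let R : K → (N₁ →ₗ[ℝ] N₁) := fun k => (ρ k : V →ₗ[ℝ] V).restrict (hinv k)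
  let f : K → Module.End ℂ (N₁ →ₗ[ℝ] ℂ) := fun k =>
    { toFun := fun l => l.comp (R k)
      map_add' := fun _ _ => rfl
      map_smul' := fun _ _ => rfl }
  have : Nontrivial (N₁ →ₗ[ℝ] ℂ) := by
    obtain ⟨v, hv⟩ := exists_ne (0 : N₁)
    obtain ⟨g, hg⟩ := Module.Projective.exists_dual_ne_zero ℝ hv
    refine ⟨⟨Complex.ofRealCLM.toLinearMap.comp g, 0, fun h => hg ?_⟩⟩
    exact Complex.ofReal_eq_zero.1 (DFunLike.congr_fun h v)
  have : FiniteDimensional ℂ (N₁ →ₗ[ℝ] ℂ) := by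
    have : FiniteDimensional ℝ (N₁ →ₗ[ℝ] ℂ) := inferInstance
    exact FiniteDimensional.right ℝ ℂ _
  obtain ⟨l₁, hl₁, heig⟩ := exists_joint_eigenvector f fun s t =>
    LinearMap.ext fun l => LinearMap.ext fun v =>
      congrArg l (Subtype.ext (hcomm t s v))
  choose χ hχ using heig
  obtain ⟨ψ, hψ, hψχ⟩ := exists_unitary_character ρ hρ N₁ hinv l₁ hl₁ χ
    fun k v => DFunLike.congr_fun (hχ k) v
  obtain ⟨l₂, hl₂⟩ := LinearMap.exists_extend l₁
  -- The extension `l₂` need not be equivariant. Averaging its twisted translates makes it so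
  -- without changing its values on `N₁`.
  let L : K → (V →L[ℝ] ℂ) := fun k =>
    ((ψ k : ℂ)⁻¹) • ((LinearMap.toContinuousLinearMap l₂).comp (ρ k))
  have hL : Continuous L := by
    refine Continuous.smul (f := fun k => ((ψ k : ℂ)⁻¹)) ?_ (continuous_const.clm_comp hρ)
    exact (continuous_subtype_val.comp hψ).inv₀ fun k => Circle.coe_ne_zero _
  have happ : ∀ v, haarMean L v = haarMean fun k => (ψ k : ℂ)⁻¹ * l₂ (ρ k v) := fun v =>
    (haarMean_map (ContinuousLinearMap.apply ℝ ℂ v) hL).symm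
  have hequiv : ∀ k v, haarMean L (ρ k v) = ψ k * haarMean L v := by
    intro s v
    rw [happ, happ, ← haarMean_mul_left (fun k => (ψ k : ℂ)⁻¹ * l₂ (ρ k v)) s]
    have hc : Continuous fun k => (ψ (s * k) : ℂ)⁻¹ * l₂ (ρ (s * k) v) := by
      refine Continuous.mul ?_ ?_
      · exact ((continuous_subtype_val.comp (hψ.comp (continuous_const_mul s)))).inv₀
          fun k => Circle.coe_ne_zero _
      · exact l₂.continuous_of_finiteDimensional.comp
          ((hρ.comp (continuous_const_mul s)).clm_apply continuous_const)
    refine Eq.trans ?_ (haarMean_map (ContinuousLinearMap.mul ℝ ℂ (ψ s : ℂ)) hc)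
    congr 1
    ext1 k
    have h1 : ρ (s * k) v = ρ k (ρ s v) := by rw [mul_comm, map_mul]; rfl
    simp only [ContinuousLinearMap.mul_apply', map_mul, Circle.coe_mul, ← h1]
    have := Circle.coe_ne_zero (ψ s)
    field_simp
  have hres : ∀ v : N₁, haarMean L v = l₁ v := by
    intro v
    have h1 : ∀ k, (ψ k : ℂ)⁻¹ * l₂ (ρ k v) = l₁ v := fun k => by
      have h2 : l₂ (ρ k v) = l₁ (R k v) := DFunLike.congr_fun hl₂ (R k v)
      have h3 : l₁ (R k v) = χ k * l₁ v := DFunLike.congr_fun (hχ k) v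
      rw [h2, h3, ← hψχ, inv_mul_cancel_left₀ (Circle.coe_ne_zero _)]
    rw [happ]
    simp_rw [h1]
    exact haarMean_const _
  have hψ1 : ψ ≠ 1 := by
    rintro rfl
    refine hl₁ (LinearMap.ext fun v => ?_)
    rw [← hres, LinearMap.zero_apply]
    have hker : N₁ ≤ LinearMap.ker ((haarMean L : V →L[ℝ] ℂ) : V →ₗ[ℝ] ℂ) := Submodule.span_le.2 (by
      rintro _ ⟨k, v, hv, rfl⟩
      have := hequiv k v
      simp only [MonoidHom.one_apply, Circle.coe_one, one_mul] at this
      simpa [sub_eq_zero] using this)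
    exact hker v.2
  obtain ⟨k, hk⟩ := exists_im_ne_zero_of_ne_one ψ hψ hψ1
  obtain ⟨v, hv⟩ : ∃ v, l₁ v ≠ 0 := by
    by_contra! h0
    exact hl₁ (LinearMap.ext h0)
  refine ⟨ψ, haarMean L, hψ, hequiv, fun z => ?_⟩
  -- Since `ψ k` is not real, `1` and `ψ k` form a real basis of `ℂ`; `a` and `b` are the
  -- coordinates of `z / l₁ v` in it.
  let b : ℝ := (z / l₁ v).im / (ψ k : ℂ).im
  let a : ℝ := (z / l₁ v).re - b * (ψ k : ℂ).re
  have hab : (a : ℂ) + b * ψ k = z / l₁ v := by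
    apply Complex.ext
    · simp [a]
    · simp [b, hk]
  refine ⟨a • (v : V) + b • ρ k v, N.add_mem (N.smul_mem _ (hN₁N v.2))
    (N.smul_mem _ (hN k _ (hN₁N v.2))), ?_⟩
  rw [map_add, map_smul, map_smul, hequiv, hres, Complex.real_smul, Complex.real_smul]
  rw [← mul_assoc, ← add_mul, hab, div_mul_cancel₀ _ hv]

end Weights

/-! ### Weight decomposition of real representations. -/

section WeightDecomposition

variable {K : Type*} [CommGroup K] [TopologicalSpace K] [IsTopologicalGroup K] [CompactSpace K]
  [ConnectedSpace K]
  {V : Type*} [NormedAddCommGroup V] [NormedSpace ℝ V] [FiniteDimensional ℝ V]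

/-- A real representation of a compact connected commutative group is a sum of complex
characters and of a trivial representation. -/
theorem exists_weight_decomposition (ρ : K →* (V →L[ℝ] V)) (hρ : Continuous ρ) :
    ∃ (m r : ℕ) (ψ : Fin m → K →* Circle) (e : V ≃L[ℝ] (Fin m → ℂ) × (Fin r → ℝ)),
      (∀ i, Continuous (ψ i)) ∧ ∀ k v, e (ρ k v) = (fun i => ψ i k * (e v).1 i, (e v).2) := by
  let P : ℕ → Prop := fun m => ∃ (ψ : Fin m → K →* Circle) (l : Fin m → (V →L[ℝ] ℂ)),
    (∀ i, Continuous (ψ i)) ∧ (∀ i k v, l i (ρ k v) = ψ i k * l i v) ∧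
      Function.Surjective fun v i => l i v
  have hP0 : P 0 := ⟨Fin.elim0, Fin.elim0, fun i => i.elim0, fun i => i.elim0,
    fun a => ⟨0, Subsingleton.elim _ _⟩⟩
  have hbound : ∀ m, P m → m ≤ Module.finrank ℝ V := by
    rintro m ⟨ψ, l, -, -, hs⟩
    have h1 := LinearMap.finrank_le_finrank_of_surjective
      (f := LinearMap.pi fun i => (l i : V →ₗ[ℝ] ℂ)) hs
    rw [Module.finrank_pi_fintype] at h1
    simp only [Complex.finrank_real_complex, Finset.sum_const, Finset.card_univ, Fintype.card_fin,
      smul_eq_mul] at h1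
    omega
  classical
  -- A maximal number of jointly surjective equivariant coordinates exists, since `2 * m` is at most
  -- the dimension. Maximality forces the action on their common kernel to be trivial.
  obtain ⟨m, hm, hmax⟩ : ∃ m, P m ∧ ¬ P (m + 1) := by
    by_contra! h
    have hall : ∀ m, P m := fun m => Nat.rec hP0 (fun m hm => h m hm) m
    have := hbound _ (hall (Module.finrank ℝ V + 1))
    omega
  obtain ⟨ψ, l, hψ, hl, hs⟩ := hm
  let f : V →ₗ[ℝ] (Fin m → ℂ) := LinearMap.pi fun i => (l i : V →ₗ[ℝ] ℂ)
  have hf : ∀ v i, f v i = l i v := fun v i => rfl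
  let N : Submodule ℝ V := LinearMap.ker f
  have hNmem : ∀ v, v ∈ N ↔ ∀ i, l i v = 0 := fun v => by
    rw [LinearMap.mem_ker, funext_iff]
    rfl
  have hN : ∀ k, ∀ v ∈ N, ρ k v ∈ N := fun k v hv => (hNmem _).2 fun i => by
    rw [hl, (hNmem v).1 hv, mul_zero]
  have htriv : ∀ k, ∀ v ∈ N, ρ k v = v := by
    by_contra! hne
    obtain ⟨χ, l', hχ, hl', hs'⟩ := exists_equivariant_functional ρ hρ N hN hne
    refine hmax ⟨Fin.cons χ ψ, Fin.cons l' l, fun i => ?_, fun i => ?_, fun a => ?_⟩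
    · refine Fin.cases ?_ (fun i => ?_) i
      · simpa using hχ
      · simpa using hψ i
    · refine Fin.cases ?_ (fun i => ?_) i
      · simpa using hl'
      · simpa using hl i
    -- The new coordinate is already surjective on `N`, where the old ones vanish, so it can be
    -- corrected without disturbing them.
    · obtain ⟨v, hv⟩ := hs fun i => a i.succ
      obtain ⟨w, hw, hlw⟩ := hs' (a 0 - l' v)
      refine ⟨v + w, funext fun i => ?_⟩
      refine Fin.cases ?_ (fun i => ?_) i
      · simp [hlw]
      · have h1 := congrFun hv i
        have h2 := (hNmem w).1 hw i
        simp only at h1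
        simp [h1, h2]
  obtain ⟨N', hN'⟩ := N.exists_isCompl
  let q₀ : V →L[ℝ] N := LinearMap.toContinuousLinearMap (N.projectionOnto N' hN')
  have hq₀ : ∀ v : N, q₀ v = v := fun v => Submodule.projectionOnto_apply_left hN' v
  have hL : Continuous fun k => q₀.comp (ρ k) := continuous_const.clm_comp hρ
  -- Averaging makes the projection onto the trivial part invariant; it remains the identity on `N`.
  let q : V →L[ℝ] N := haarMean fun k => q₀.comp (ρ k)
  have hq : ∀ v, q v = haarMean fun k => q₀ (ρ k v) := fun v =>
    (haarMean_map (ContinuousLinearMap.apply ℝ N v) hL).symm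
  have hqN : ∀ v : N, q v = v := fun v => by
    have h1 : ∀ k, q₀ (ρ k v) = v := fun k => by rw [htriv k v v.2, hq₀]
    rw [hq]
    simp_rw [h1]
    exact haarMean_const v
  have hqinv : ∀ k v, q (ρ k v) = q v := fun s v => by
    rw [hq, hq, ← haarMean_mul_left (fun k => q₀ (ρ k v)) s]
    congr 1
    ext1 k
    rw [mul_comm, map_mul]
    rfl
  let g : V →ₗ[ℝ] (Fin m → ℂ) × N := f.prod q
  have hg : Function.Bijective g := by
    refine ⟨(injective_iff_map_eq_zero g).2 fun v hv => ?_, fun a => ?_⟩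
    · have h1 : v ∈ N := congrArg Prod.fst hv
      have h2 : q v = 0 := congrArg Prod.snd hv
      have h3 := hqN ⟨v, h1⟩
      rw [h2] at h3
      exact congrArg Subtype.val h3.symm
    · obtain ⟨v, hv⟩ := hs a.1
      refine ⟨v + ((a.2 - q v : N) : V), Prod.ext ?_ ?_⟩
      · change f _ = _
        have h1 : f ((a.2 - q v : N) : V) = 0 := (a.2 - q v : N).2
        rw [map_add, h1, add_zero]
        exact hv
      · change q _ = _
        rw [map_add, hqN, add_sub_cancel]
  let b := Module.finBasis ℝ N
  let e₁ : V ≃ₗ[ℝ] (Fin m → ℂ) × (Fin (Module.finrank ℝ N) → ℝ) :=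
    (LinearEquiv.ofBijective g hg).trans ((LinearEquiv.refl ℝ _).prodCongr b.equivFun)
  refine ⟨m, Module.finrank ℝ N, ψ, e₁.toContinuousLinearEquiv, hψ, fun k v => Prod.ext ?_ ?_⟩
  · exact funext fun i => hl i k v
  · exact congrArg b.equivFun (hqinv k v)

end WeightDecomposition

/-! ### Injective endomorphisms of tori and the number of separating characters. -/

section TorusEndomorphisms

theorem finite_setOf_torus_pow_eq_one (n : ℕ) {N : ℕ} (hN : 0 < N) :
    {t : Torus n | t ^ N = 1}.Finite := by
  have h1 : {z : Circle | z ^ N = 1}.Finite := by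
    have h2 : {z : ℂ | z ^ N = 1}.Finite := by
      refine (Polynomial.nthRoots N (1 : ℂ)).toFinset.finite_toSet.subset fun z hz => ?_
      simpa [Polynomial.mem_nthRoots hN] using hz
    refine (h2.preimage (f := ((↑) : Circle → ℂ)) Circle.coe_injective.injOn).subset fun (z : Circle) hz => ?_
    change (z : ℂ) ^ N = 1
    rw [← Circle.coe_pow, (hz : z ^ N = 1), Circle.coe_one]
  refine (Set.Finite.pi' fun _ : Fin n => h1).subset fun t ht i => ?_
  exact congrFun (ht : t ^ N = 1) i

/-- Torsion is dense: each angle is rounded down to a multiple of `1 / (N + 1)` of a full turn. -/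
theorem exists_tendsto_torsion {n : ℕ} (t : Torus n) : ∃ s : ℕ → Torus n,
    (∀ N, s N ^ (N + 1) = 1) ∧ Filter.Tendsto s Filter.atTop (𝓝 t) := by
  have h : ∀ i, ∃ a : ℝ, 0 ≤ a ∧ t i = Circle.exp (2 * Real.pi * a) := fun i => by
    have h2 : (0 : ℝ) < 2 * Real.pi := by positivity
    -- The extra full turn makes the angle nonnegative, as convergence of the natural floor
    -- quotients requires.
    refine ⟨Complex.arg (t i) / (2 * Real.pi) + 1, ?_, ?_⟩
    · rw [div_add_one h2.ne']
      exact div_nonneg (by linarith [Complex.neg_pi_lt_arg (t i)]) h2.le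
    · rw [mul_add, mul_div_cancel₀ _ h2.ne', mul_one, Circle.exp_add, Circle.exp_two_pi, mul_one,
        Circle.exp_arg]
  choose a ha0 ha using h
  refine ⟨fun N i => Circle.exp (2 * Real.pi * (⌊a i * (N + 1 : ℕ)⌋₊ / (N + 1 : ℕ))), fun N => ?_, ?_⟩
  · refine funext fun i => ?_
    have hN : ((N + 1 : ℕ) : ℝ) ≠ 0 := by positivity
    rw [Pi.pow_apply, Pi.one_apply, ← Circle.exp_natCast_mul]
    have : ((N + 1 : ℕ) : ℝ) * (2 * Real.pi * (⌊a i * (N + 1 : ℕ)⌋₊ / (N + 1 : ℕ))) =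
      ⌊a i * (N + 1 : ℕ)⌋₊ * (2 * Real.pi) := by field_simp
    rw [this]
    rw [Circle.exp_natCast_mul, Circle.exp_two_pi, one_pow]
  · refine tendsto_pi_nhds.2 fun i => ?_
    rw [ha i]
    refine (Circle.exp.continuous.tendsto _).comp (Filter.Tendsto.const_mul _ ?_)
    have h1 := (tendsto_nat_floor_mul_div_atTop (R := ℝ) (ha0 i))
    exact h1.comp (tendsto_natCast_atTop_atTop.comp (Filter.tendsto_add_atTop_nat 1))

/-- An injective continuous endomorphism of a torus is surjective. -/
theorem torus_endomorphism_surjective {n : ℕ} (f : Torus n →* Torus n) (hf : Continuous f)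
    (hinj : Function.Injective f) : Function.Surjective f := by
  intro t
  obtain ⟨s, hs, hst⟩ := exists_tendsto_torsion t
  -- The elements killed by `N + 1` form a finite set preserved by `f`, so injectivity there gives
  -- surjectivity. The range then contains a sequence tending to `t`, and it is closed by
  -- compactness.
  have hmem : ∀ N, s N ∈ range f := fun N => by
    have hfin := finite_setOf_torus_pow_eq_one n N.succ_pos
    have hmaps : MapsTo f {t : Torus n | t ^ (N + 1) = 1} {t : Torus n | t ^ (N + 1) = 1} :=
      fun t ht => by
        change f t ^ (N + 1) = 1
        rw [← map_pow, (ht : t ^ (N + 1) = 1), map_one]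
    have : Finite {t : Torus n | t ^ (N + 1) = 1} := hfin
    obtain ⟨u, hu⟩ := Finite.injective_iff_surjective.1 (hmaps.restrict_inj.2 hinj.injOn)
      ⟨s N, hs N⟩
    exact ⟨u, congrArg Subtype.val hu⟩
  exact (isCompact_range hf).isClosed.mem_of_tendsto hst (Filter.Eventually.of_forall hmem)

/-- With fewer than `n` characters, padding by trivial ones would give an injective endomorphism of
the torus, hence a surjective one; but its padded coordinates are constantly `1`. -/
theorem torus_hom_card_le {n m : ℕ} (ψ : Fin m → Torus n →* Circle)
    (hψ : ∀ i, Continuous (ψ i)) (hinj : ∀ t, (∀ i, ψ i t = 1) → t = 1) : n ≤ m := by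
  by_contra! hlt
  let f : Torus n →* Torus n := MonoidHom.pi fun j => if h : (j : ℕ) < m then ψ ⟨j, h⟩ else 1
  have hfa : ∀ t j, f t j = (if h : (j : ℕ) < m then ψ ⟨j, h⟩ else 1 : Torus n →* Circle) t :=
    fun t j => rfl
  have hf : Continuous f := continuous_pi fun j => by
    simp_rw [hfa]
    split_ifs with h
    · exact hψ _
    · exact continuous_const
  have hfi : Function.Injective f := (injective_iff_map_eq_one f).2 fun t ht => hinj t fun i => by
    have := congrFun ht ⟨i, i.2.trans hlt⟩
    rw [hfa] at this
    simpa using this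
  obtain ⟨t, ht⟩ := torus_endomorphism_surjective f hf hfi fun _ => Circle.exp Real.pi
  have := congrFun ht ⟨m, hlt⟩
  rw [hfa] at this
  simp only [lt_irrefl, dite_false, MonoidHom.one_apply] at this
  exact Circle.exp_pi_ne_one this.symm

end TorusEndomorphisms

/-! ### Derivatives of diffeomorphisms as endomorphisms of the model space. -/

section TangentMap

variable {d : ℕ} {M : Type*} [TopologicalSpace M] [ChartedSpace (EuclideanSpace ℝ (Fin d)) M]

/-- The derivative of a diffeomorphism, as a linear endomorphism of the model space. -/
noncomputable def Diff.tangentMap (φ : Diff d M) (x : M) :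
    EuclideanSpace ℝ (Fin d) →L[ℝ] EuclideanSpace ℝ (Fin d) :=
  mfderiv (𝓡 d) (𝓡 d) φ x

theorem Diff.tangentMap_one (x : M) : (1 : Diff d M).tangentMap x = ContinuousLinearMap.id ℝ _ :=
  mfderiv_id

theorem Diff.tangentMap_mul [IsManifold (𝓡 d) ∞ M] (φ ψ : Diff d M) (x : M) :
    (φ * ψ).tangentMap x = (φ.tangentMap (ψ x)).comp (ψ.tangentMap x) :=
  mfderiv_comp x (φ.mdifferentiable (by simp) _) (ψ.mdifferentiable (by simp) _)

theorem Diff.tangentMap_inv_apply [IsManifold (𝓡 d) ∞ M] (φ : Diff d M) (x : M)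
    (v : EuclideanSpace ℝ (Fin d)) : φ⁻¹.tangentMap (φ x) (φ.tangentMap x v) = v := by
  have h := Diff.tangentMap_mul φ⁻¹ φ x
  rw [inv_mul_cancel, Diff.tangentMap_one] at h
  exact (DFunLike.congr_fun h v).symm

theorem Diff.tangentMap_apply_inv [IsManifold (𝓡 d) ∞ M] (φ : Diff d M) (x : M)
    (v : EuclideanSpace ℝ (Fin d)) : φ.tangentMap x (φ⁻¹.tangentMap (φ x) v) = v := by
  have h := Diff.tangentMap_mul φ φ⁻¹ (φ x)
  rw [mul_inv_cancel, Diff.tangentMap_one, Diff.inv_apply_self] at h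
  exact (DFunLike.congr_fun h v).symm

end TangentMap

/-! ### Fixed points, their weights, and the induced torus automorphisms. -/

section FixedPoints

variable {n : ℕ} {M : Type*} [TopologicalSpace M]
  [ChartedSpace (EuclideanSpace ℝ (Fin (2 * n))) M] [MulAction (Torus n) M] [TorusManifold n M]
  [IsManifold (𝓡 (2 * n)) ∞ M]

/-- The derivative of an element of the normalizer intertwines the isotropy actions. -/
theorem tangentMap_isotropyDeriv (φ : TorusNormalizer n M) {x : M} {t : Torus n} (ht : t • x = x)
    (v : EuclideanSpace ℝ (Fin (2 * n))) :
    φ.1.tangentMap x (isotropyDeriv n x t v) =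
      isotropyDeriv n (φ.1 x) (conjTorus n M φ t) (φ.1.tangentMap x v) := by
  have h : φ.1 * torusToDiff n M t = torusToDiff n M (conjTorus n M φ t) * φ.1 := by
    rw [torusToDiff_conjTorus, inv_mul_cancel_right]
  have h1 := Diff.tangentMap_mul φ.1 (torusToDiff n M t) x
  rw [h, Diff.tangentMap_mul, torusToDiff_apply, ht] at h1
  exact (DFunLike.congr_fun h1 v).symm

/-- The isotropy representation at a fixed point of the torus. -/
noncomputable def fixedPointRep {x : M} (hx : ∀ t : Torus n, t • x = x) : Torus n →*
    (EuclideanSpace ℝ (Fin (2 * n)) →L[ℝ] EuclideanSpace ℝ (Fin (2 * n))) where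
  toFun t := isotropyDeriv n x t
  map_one' := isotropyDeriv_one x
  map_mul' s t := isotropyDeriv_mul s (hx t)

theorem fixedPointRep_continuous {x : M} (hx : ∀ t : Torus n, t • x = x) :
    Continuous (fixedPointRep hx) :=
  (isotropyDeriv_continuousOn x).comp
    (by fun_prop : Continuous fun t : Torus n => (⟨t, hx t⟩ : stabilizer (Torus n) x))

/-- Linear coordinates at a fixed point in which the torus acts in the standard way, up to an
automorphism. -/
structure TorusCoordinates (n : ℕ) {M : Type*} [TopologicalSpace M]
    [ChartedSpace (EuclideanSpace ℝ (Fin (2 * n))) M] [MulAction (Torus n) M] [TorusManifold n M]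
    [IsManifold (𝓡 (2 * n)) ∞ M] (x : M) where
  char : Fin n → Torus n →* Circle
  equiv : EuclideanSpace ℝ (Fin (2 * n)) ≃L[ℝ] (Fin n → ℂ)
  equiv_apply : ∀ t v, equiv (isotropyDeriv n x t v) = fun i => char i t * equiv v i
  bijective : Function.Bijective fun (t : Torus n) (i : Fin n) => char i t

/-- Dimension count: `m` complex weights and `r` trivial real directions satisfy `2m + r = 2n`,
while faithfulness requires `m ≥ n`. So `m = n`, `r = 0`, and the weights give an injective, hence
bijective, endomorphism of the torus. -/
theorem nonempty_torusCoordinates [T2Space M] [ConnectedSpace M] {x : M}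
    (hx : ∀ t : Torus n, t • x = x) : Nonempty (TorusCoordinates n x) := by
  obtain ⟨m, r, ψ, e, hψ, he⟩ := exists_weight_decomposition (fixedPointRep hx)
    (fixedPointRep_continuous hx)
  have hdim := e.toLinearEquiv.finrank_eq
  rw [Module.finrank_prod, Module.finrank_pi_fintype, finrank_euclideanSpace_fin,
    Module.finrank_fin_fun] at hdim
  simp only [Complex.finrank_real_complex, Finset.sum_const, Finset.card_univ, Fintype.card_fin,
    smul_eq_mul] at hdim
  have hinj : ∀ t, (∀ i, ψ i t = 1) → t = 1 := fun t ht => by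
    refine eq_one_of_isotropyRep_eq_one (k := (⟨t, hx t⟩ : stabilizer (Torus n) x)) ?_
    ext1 v
    refine e.injective ((he t v).trans ?_)
    simp [ht]
  have hnm := torus_hom_card_le ψ hψ hinj
  obtain rfl : m = n := by omega
  obtain rfl : r = 0 := by omega
  let f : Torus m →* Torus m := MonoidHom.pi ψ
  have hfi : Function.Injective f := (injective_iff_map_eq_one f).2 fun t ht =>
    hinj t fun i => congrFun ht i
  refine ⟨⟨ψ, e.trans (ContinuousLinearEquiv.prodUnique ℝ (Fin m → ℂ) (Fin 0 → ℝ)), fun t v => ?_,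
    hfi, torus_endomorphism_surjective f (continuous_pi hψ) hfi⟩⟩
  exact congrArg Prod.fst (he t v)

/-- Some torus element acts as `-1` in the linear coordinates at `x`, and `-1` fixes only the
origin. -/
theorem eventually_eq_of_fixed [T2Space M] [ConnectedSpace M] {x : M}
    (hx : ∀ t : Torus n, t • x = x) : ∀ᶠ y in 𝓝 x, (∀ t : Torus n, t • y = y) → y = x := by
  obtain ⟨c⟩ := nonempty_torusCoordinates hx
  obtain ⟨Φ, hxΦ, hΦx, -, hequiv⟩ := exists_linearization (n := n) x
  filter_upwards [Φ.open_source.mem_nhds hxΦ] with y hy hfix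
  refine Φ.injOn hy hxΦ ?_
  obtain ⟨t, ht⟩ := c.bijective.2 fun _ => -1
  have h1 : Φ (t • y) = isotropyDeriv n x t (Φ y) := hequiv ⟨t, hx t⟩ y hy
  rw [hfix t] at h1
  have h2 := (congrArg c.equiv h1).trans (c.equiv_apply t (Φ y))
  rw [hΦx]
  refine c.equiv.injective ?_
  rw [map_zero]
  ext1 i
  have h3 := congrFun h2 i
  have h4 : c.char i t = -1 := congrFun ht i
  rw [h4, Circle.coe_neg, Circle.coe_one, neg_one_mul] at h3
  exact self_eq_neg.1 h3

theorem isClosed_setOf_fixed [T2Space M] : IsClosed {x : M | ∀ t : Torus n, t • x = x} := by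
  have := TorusManifold.continuousConstSMul (n := n) (M := M)
  rw [ofPred_forall]
  exact isClosed_iInter fun t => isClosed_eq (continuous_const_smul t) continuous_id

theorem finite_setOf_fixed [T2Space M] [CompactSpace M] [ConnectedSpace M] :
    {x : M | ∀ t : Torus n, t • x = x}.Finite := by
  obtain ⟨s, hs, hcov⟩ := (isClosed_setOf_fixed (n := n) (M := M)).isCompact.elim_nhds_subcover
    (fun x => {y | (∀ t : Torus n, t • y = y) → ∀ hx : (∀ t : Torus n, t • x = x), y = x})
    fun x hx => (eventually_eq_of_fixed hx).mono fun y hy h1 h2 => hy h1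
  refine s.finite_toSet.subset fun y hy => ?_
  obtain ⟨x, hxs, hyx⟩ := mem_iUnion₂.1 (hcov hy)
  rw [hyx hy (hs x hxs)]
  exact hxs

/-- The weights of a sum of complex characters, viewed as a real representation. -/
theorem weight_eq_or_eq_inv {T : Type*} [Monoid T] {m : ℕ} (ψ : Fin m → T →* Circle)
    (l : (Fin m → ℂ) →ₗ[ℝ] ℂ) (hl : l ≠ 0) (χ : T → Circle)
    (h : ∀ t z, l (fun i => ψ i t * z i) = χ t * l z) :
    ∃ j, (∀ t, χ t = ψ j t) ∨ ∀ t, χ t = (ψ j t)⁻¹ := by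
  obtain ⟨j, hj⟩ : ∃ j, l.comp (LinearMap.single ℝ (fun _ => ℂ) j) ≠ 0 := by
    by_contra! h0
    exact hl (LinearMap.pi_ext' fun j => by rw [h0, LinearMap.zero_comp])
  set f : ℂ →ₗ[ℝ] ℂ := l.comp (LinearMap.single ℝ (fun _ => ℂ) j) with hf
  have hfz : ∀ z : ℂ, f z = z.re * f 1 + z.im * f Complex.I := fun z => by
    conv_lhs => rw [← Complex.re_add_im z]
    rw [map_add]
    have h1 := f.map_smul z.re 1
    have h2 := f.map_smul z.im Complex.I
    rw [Complex.real_smul, Complex.real_smul, mul_one] at h1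
    rw [Complex.real_smul, Complex.real_smul] at h2
    rw [h1, h2]
  have hft : ∀ t z, f (ψ j t * z) = χ t * f z := fun t z => by
    rw [hf, LinearMap.comp_apply, LinearMap.comp_apply, ← h]
    congr 1
    ext1 i
    by_cases hij : i = j
    · subst hij
      simp
    · simp [hij]
  have e1 : ∀ t, f (ψ j t) = χ t * f 1 := fun t => by rw [← hft, mul_one]
  have e2 : ∀ t, f (ψ j t * Complex.I) = χ t * f Complex.I := fun t => hft t _
  have hI := Complex.I_mul_I
  -- A real-linear `f` has the form `z ↦ α z + β z̄`, with `2α = f 1 - i f(i)` and `2β = f 1 + i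
  -- f(i)`. Equivariance gives `α ψ = χ α` and `β ψ̄ = χ β`, so whichever coefficient is nonzero
  -- identifies `χ`.
  have key : ∀ t, (f 1 - Complex.I * f Complex.I) * (ψ j t) = χ t * (f 1 - Complex.I * f Complex.I) ∧
      (f 1 + Complex.I * f Complex.I) * (starRingEnd ℂ (ψ j t)) =
        χ t * (f 1 + Complex.I * f Complex.I) := fun t => by
    have h1 := e1 t
    have h2 := e2 t
    rw [hfz] at h1 h2
    have h3 : ((ψ j t * Complex.I : ℂ)).re = -(ψ j t : ℂ).im := by simp
    have h4 : ((ψ j t * Complex.I : ℂ)).im = (ψ j t : ℂ).re := by simp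
    rw [h3, h4] at h2
    push_cast at h2
    have h5 : (ψ j t : ℂ) = (ψ j t : ℂ).re + (ψ j t : ℂ).im * Complex.I :=
      (Complex.re_add_im _).symm
    have h6 : starRingEnd ℂ (ψ j t : ℂ) = (ψ j t : ℂ).re - (ψ j t : ℂ).im * Complex.I := by
      apply Complex.ext <;> simp
    rw [h6]
    constructor
    · rw [h5, mul_sub, ← h1, mul_left_comm, ← h2]
      linear_combination (-(ψ j t : ℂ).im * f Complex.I) * hI
    · rw [mul_add, ← h1, mul_left_comm, ← h2]
      linear_combination (-(ψ j t : ℂ).im * f Complex.I) * hI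
  by_cases ha : f 1 - Complex.I * f Complex.I = 0
  · by_cases hb : f 1 + Complex.I * f Complex.I = 0
    · refine absurd (LinearMap.ext fun z => ?_) hj
      have h1 : f 1 = 0 := by linear_combination (ha + hb) / 2
      have h2 : f Complex.I = 0 := by
        have : Complex.I * f Complex.I = 0 := by linear_combination (hb - ha) / 2
        exact (mul_eq_zero.1 this).resolve_left Complex.I_ne_zero
      rw [hfz, h1, h2, mul_zero, mul_zero, add_zero, LinearMap.zero_apply]
    · refine ⟨j, Or.inr fun t => Circle.ext ?_⟩
      rw [Circle.coe_inv_eq_conj]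
      exact (mul_right_cancel₀ hb ((mul_comm _ _).trans (key t).2)).symm
  · refine ⟨j, Or.inl fun t => Circle.ext ?_⟩
    exact (mul_right_cancel₀ ha ((mul_comm _ _).trans (key t).1)).symm

theorem normalizer_fixed (φ : TorusNormalizer n M) {x : M} (hx : ∀ t : Torus n, t • x = x)
    (t : Torus n) : t • φ.1 x = φ.1 x := by
  obtain ⟨s, rfl⟩ := (conjTorus n M φ).surjective t
  rw [← normalizer_apply_smul, hx]

/-- The normalizer induces only finitely many automorphisms of the torus. -/
theorem finite_range_normalizerToAutTorus [T2Space M] [CompactSpace M] [ConnectedSpace M] :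
    (range (normalizerToAutTorus n M)).Finite := by
  obtain ⟨x₀, hx₀⟩ := TorusManifold.exists_fixedPoint (n := n) (M := M)
  obtain ⟨c₀⟩ := nonempty_torusCoordinates hx₀
  have hc : ∀ p : {x : M | ∀ t : Torus n, t • x = x}, Nonempty (TorusCoordinates n (p : M)) :=
    fun p => nonempty_torusCoordinates p.2
  let c := fun p => (hc p).some
  let W : Fin n × Bool → Torus n → Circle := fun q t =>
    if q.2 then c₀.char q.1 t else (c₀.char q.1 t)⁻¹
  have : Finite {x : M | ∀ t : Torus n, t • x = x} := finite_setOf_fixed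
  -- The data are the image fixed point and, for each weight there, the signed weight at `x₀` that
  -- it pulls back to. They determine the automorphism because the weights at a fixed point separate
  -- torus elements.
  let A : {x : M | ∀ t : Torus n, t • x = x} × (Fin n → Fin n × Bool) →
      Set (Torus n ≃ₜ* Torus n) := fun q => {α | ∀ i t, (c q.1).char i (α t) = W (q.2 i) t}
  have hA : ∀ q, (A q).Finite := fun q => Set.Subsingleton.finite fun α hα β hβ => by
    refine ContinuousMulEquiv.ext fun t => (c q.1).bijective.1 (funext fun i => ?_)
    exact (hα i t).trans (hβ i t).symm
  refine (Set.finite_iUnion hA).subset ?_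
  rintro _ ⟨φ, rfl⟩
  let p : {x : M | ∀ t : Torus n, t • x = x} := ⟨φ.1 x₀, normalizer_fixed φ hx₀⟩
  have hσ : ∀ i, ∃ q : Fin n × Bool, ∀ t, (c p).char i (normalizerToAutTorus n M φ t) = W q t := by
    intro i
    -- A weight coordinate at `φ x₀`, pulled back by the derivative of `φ`. It is equivariant at
    -- `x₀` for the weight composed with the induced automorphism, and nonzero since the derivative
    -- is invertible.
    let L : EuclideanSpace ℝ (Fin (2 * n)) →ₗ[ℝ] ℂ :=
      (LinearMap.proj i).comp (((c p).equiv.toLinearMap).comp (φ.1.tangentMap x₀ : _ →ₗ[ℝ] _))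
    have hL : ∀ v, L v = (c p).equiv (φ.1.tangentMap x₀ v) i := fun v => rfl
    obtain ⟨j, hj⟩ := weight_eq_or_eq_inv c₀.char (L.comp c₀.equiv.symm.toLinearMap)
      (fun h0 => by
        have h1 := DFunLike.congr_fun h0 (c₀.equiv (φ.1⁻¹.tangentMap (φ.1 x₀)
          ((c p).equiv.symm fun _ => 1)))
        have h2 : L (φ.1⁻¹.tangentMap (φ.1 x₀) ((c p).equiv.symm fun _ => 1)) = 1 := by
          rw [hL, Diff.tangentMap_apply_inv, ContinuousLinearEquiv.apply_symm_apply]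
        refine one_ne_zero (h2.symm.trans (Eq.trans ?_ h1))
        exact congrArg L (c₀.equiv.symm_apply_apply _).symm)
      (fun t => (c p).char i (normalizerToAutTorus n M φ t)) (fun t z => by
        have h1 : c₀.equiv.symm (fun i => c₀.char i t * z i) =
            isotropyDeriv n x₀ t (c₀.equiv.symm z) := by
          refine c₀.equiv.injective ?_
          rw [c₀.equiv_apply, ContinuousLinearEquiv.apply_symm_apply,
            ContinuousLinearEquiv.apply_symm_apply]
        change L (c₀.equiv.symm _) = _ * L (c₀.equiv.symm z)
        rw [h1, hL, tangentMap_isotropyDeriv φ (hx₀ t)]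
        exact congrFun ((c p).equiv_apply _ _) i)
    rcases hj with hj | hj
    · exact ⟨(j, true), fun t => by simpa [W] using hj t⟩
    · exact ⟨(j, false), fun t => by simpa [W] using hj t⟩
  choose σ hσ using hσ
  exact mem_iUnion.2 ⟨(p, σ), fun i t => hσ i t⟩

/-- A linear map commuting with the isotropy representation at a fixed point and preserving an
invariant positive definite form is given by an element of the torus. -/
theorem exists_isotropyDeriv_eq {x : M} (c : TorusCoordinates n x)
    (A : EuclideanSpace ℝ (Fin (2 * n)) →L[ℝ] EuclideanSpace ℝ (Fin (2 * n)))
    (hA : ∀ t v, A (isotropyDeriv n x t v) = isotropyDeriv n x t (A v))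
    (b : EuclideanSpace ℝ (Fin (2 * n)) →L[ℝ] EuclideanSpace ℝ (Fin (2 * n)) →L[ℝ] ℝ)
    (hpos : ∀ v, v ≠ 0 → 0 < b v v)
    (hb : ∀ t v, b (isotropyDeriv n x t v) (isotropyDeriv n x t v) = b v v)
    (hbA : ∀ v, b (A v) (A v) = b v v) : ∃ t, ∀ v, A v = isotropyDeriv n x t v := by
  let B : (Fin n → ℂ) →ₗ[ℝ] (Fin n → ℂ) :=
    c.equiv.toLinearMap.comp ((A : _ →ₗ[ℝ] _).comp c.equiv.symm.toLinearMap)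
  have hBdef : ∀ z, B z = c.equiv (A (c.equiv.symm z)) := fun z => rfl
  let q : (Fin n → ℂ) → ℝ := fun z => b (c.equiv.symm z) (c.equiv.symm z)
  have hsymm : ∀ t z, c.equiv.symm (fun i => c.char i t * z i) =
      isotropyDeriv n x t (c.equiv.symm z) := fun t z => by
    refine c.equiv.injective ?_
    rw [c.equiv_apply, ContinuousLinearEquiv.apply_symm_apply,
      ContinuousLinearEquiv.apply_symm_apply]
  have hBs : ∀ (s : Fin n → Circle) z, B (fun i => s i * z i) = fun i => s i * B z i := by
    intro s z
    obtain ⟨t, rfl⟩ := c.bijective.2 s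
    rw [hBdef, hsymm, hA, c.equiv_apply]
    rfl
  have hqs : ∀ (s : Fin n → Circle) z, q (fun i => s i * z i) = q z := by
    intro s z
    obtain ⟨t, rfl⟩ := c.bijective.2 s
    simp only [q]
    rw [hsymm, hb]
  have hqB : ∀ z, q (B z) = q z := fun z => by
    simp only [q]
    rw [hBdef, ContinuousLinearEquiv.symm_apply_apply, hbA]
  have hqr : ∀ (r : ℝ) z, q (r • z) = r ^ 2 * q z := fun r z => by
    simp only [q, map_smul, _root_.smul_apply, smul_eq_mul]
    ring
  have hq0 : ∀ z, z ≠ 0 → 0 < q z := fun z hz =>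
    hpos _ fun h => hz (c.equiv.symm.injective (h.trans (map_zero _).symm))
  have hpolar : ∀ z : ℂ, ∃ u : Circle, z = (‖z‖ : ℝ) • (u : ℂ) := fun z =>
    ⟨Circle.exp z.arg, by
      rw [Circle.coe_exp, Complex.real_smul, Complex.norm_mul_exp_arg_mul_I]⟩
  have hsingle : ∀ (u : Circle) i (z : ℂ), (Pi.single i (u * z) : Fin n → ℂ) =
      fun j => ((fun _ => u : Fin n → Circle) j : ℂ) * (Pi.single i z : Fin n → ℂ) j := by
    intro u i z
    ext1 j
    by_cases hij : j = i
    · subst hij; simp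
    · simp [hij]
  let a : Fin n → ℂ := fun i => B (Pi.single i 1) i
  -- The torus element equal to `1` in place `i` and `-1` elsewhere fixes the `i`-th axis but
  -- negates the `j`-th coordinate.
  have hoff : ∀ i z j, j ≠ i → B (Pi.single i z) j = 0 := by
    intro i z j hj
    have h1 := congrFun (hBs (fun k => if k = i then 1 else -1) (Pi.single i z)) j
    have h2 : (fun k => (((if k = i then 1 else -1 : Circle)) : ℂ) * (Pi.single i z : Fin n → ℂ) k) =
        Pi.single i z := by
      ext1 k
      by_cases hk : k = i
      · subst hk; simp
      · simp [hk]
    rw [h2] at h1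
    simp only [hj, if_false, Circle.coe_neg, Circle.coe_one, neg_one_mul] at h1
    exact self_eq_neg.1 h1
  -- Real homogeneity together with commutation with rotations gives complex linearity on each axis,
  -- by the polar form of `z`.
  have hdiag : ∀ i z, B (Pi.single i z) i = a i * z := by
    intro i z
    obtain ⟨u, hu⟩ := hpolar z
    have h1 : (Pi.single i z : Fin n → ℂ) = (‖z‖ : ℝ) • Pi.single i ((u : ℂ) * 1) := by
      rw [mul_one, ← Pi.single_smul, ← hu]
    rw [h1, map_smul, hsingle, hBs]
    conv_rhs => rw [hu]
    simp only [Pi.smul_apply, Complex.real_smul, a]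
    ring
  have hBsingle : ∀ i z, B (Pi.single i z) = Pi.single i (a i * z) := by
    intro i z
    ext1 j
    by_cases hj : j = i
    · subst hj
      rw [hdiag, Pi.single_eq_same]
    · rw [hoff i z j hj, Pi.single_eq_of_ne hj]
  -- The phase of `a i` does not change `q`, so preservation of `q` on the axis reads `‖a i‖ ^ 2 =
  -- 1`.
  have hnorm : ∀ i, ‖a i‖ = 1 := by
    intro i
    obtain ⟨u, hu⟩ := hpolar (a i)
    have h1 := hqB (Pi.single i 1)
    have h2 : (Pi.single i (a i * 1) : Fin n → ℂ) = (‖a i‖ : ℝ) • Pi.single i ((u : ℂ) * 1) := by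
      rw [mul_one, mul_one, ← Pi.single_smul, ← hu]
    rw [hBsingle, h2, hqr, hsingle, hqs] at h1
    have h3 : 0 < q (Pi.single i 1) := hq0 _ fun h => by
      have := congrFun h i
      simp at this
    have h4 : ‖a i‖ ^ 2 = 1 := mul_right_cancel₀ h3.ne' (h1.trans (one_mul _).symm)
    nlinarith [norm_nonneg (a i)]
  obtain ⟨t, ht⟩ := c.bijective.2 fun i => ⟨a i, mem_sphere_zero_iff_norm.2 (hnorm i)⟩
  have hchar : ∀ i, (c.char i t : ℂ) = a i := fun i => congrArg Subtype.val (congrFun ht i)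
  refine ⟨t, fun v => c.equiv.injective ?_⟩
  have hB : ∀ z, B z = fun i => a i * z i := by
    intro z
    conv_lhs => rw [← Finset.univ_sum_single z]
    rw [map_sum]
    simp_rw [hBsingle]
    exact Finset.univ_sum_single fun i => a i * z i
  have h1 := hB (c.equiv v)
  rw [hBdef, ContinuousLinearEquiv.symm_apply_apply] at h1
  rw [h1, c.equiv_apply]
  simp_rw [hchar]

end FixedPoints

/-! ### Closed subgroups of the torus as common kernels of characters. -/

section ClosedSubgroups

/-- The character `t ↦ ∏ i, t i ^ m i` of the torus. -/
noncomputable def torusChar {n : ℕ} (m : Fin n → ℤ) : Torus n →* Circle where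
  toFun t := ∏ i, t i ^ m i
  map_one' := by simp
  map_mul' s t := by simp [mul_zpow, Finset.prod_mul_distrib]

theorem torusChar_apply {n : ℕ} (m : Fin n → ℤ) (t : Torus n) :
    torusChar m t = ∏ i, t i ^ m i := rfl

theorem torusChar_continuous {n : ℕ} (m : Fin n → ℤ) : Continuous (torusChar m) := by
  change Continuous fun t : Torus n => ∏ i, t i ^ m i
  exact continuous_finsetProd _ fun i _ => (continuous_apply i).zpow (m i)

theorem torusChar_zero {n : ℕ} (t : Torus n) : torusChar 0 t = 1 := by
  simp [torusChar_apply]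

theorem torusChar_add {n : ℕ} (m m' : Fin n → ℤ) (t : Torus n) :
    torusChar (m + m') t = torusChar m t * torusChar m' t := by
  simp [torusChar_apply, zpow_add, Finset.prod_mul_distrib]

theorem torusChar_smul {n : ℕ} (a : ℤ) (m : Fin n → ℤ) (t : Torus n) :
    torusChar (a • m) t = torusChar m t ^ a := by
  simp only [torusChar_apply, Pi.smul_apply, smul_eq_mul, ← Finset.prod_zpow]
  exact Finset.prod_congr rfl fun i _ => by rw [mul_comm, zpow_mul]

theorem torusChar_single {n : ℕ} (i : Fin n) (a : ℤ) (t : Torus n) :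
    torusChar (Pi.single i a) t = t i ^ a := by
  rw [torusChar_apply, Finset.prod_eq_single i]
  · rw [Pi.single_eq_same]
  · intro j _ hj
    rw [Pi.single_eq_of_ne hj, zpow_zero]
  · exact fun h => absurd (Finset.mem_univ i) h

/-- A character of the torus, as a continuous complex-valued function. -/
noncomputable def torusCharMap {n : ℕ} (m : Fin n → ℤ) : C(Torus n, ℂ) :=
  ⟨fun t => torusChar m t, continuous_subtype_val.comp (torusChar_continuous m)⟩

/-- Stone–Weierstrass for the star algebra of the coordinate functions. Since characters are closed
under products and conjugation, their linear span contains that algebra. -/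
theorem dense_span_torusCharMap (n : ℕ) :
    Dense (Submodule.span ℂ (range (torusCharMap (n := n))) : Set C(Torus n, ℂ)) := by
  let s : Set C(Torus n, ℂ) := range fun i => torusCharMap (n := n) (Pi.single i 1)
  have hsep : (StarAlgebra.adjoin ℂ s).toSubalgebra.SeparatesPoints := by
    intro t u htu
    obtain ⟨i, hi⟩ := Function.ne_iff.1 htu
    refine ⟨_, ⟨torusCharMap (Pi.single i 1), StarAlgebra.subset_adjoin ℂ s ⟨i, rfl⟩, rfl⟩, ?_⟩
    intro h
    refine hi (Circle.ext ?_)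
    have h1 : (torusChar (Pi.single i 1) t : ℂ) = torusChar (Pi.single i 1) u := h
    rwa [torusChar_single, torusChar_single, zpow_one, zpow_one] at h1
  have htop := ContinuousMap.starSubalgebra_topologicalClosure_eq_top_of_separatesPoints
    (StarAlgebra.adjoin ℂ s) hsep
  have hdense : Dense (StarAlgebra.adjoin ℂ s : Set C(Torus n, ℂ)) := by
    rw [dense_iff_closure_eq, ← StarSubalgebra.topologicalClosure_coe, htop]
    rfl
  refine hdense.mono fun f hf => ?_
  have hclosure : ∀ g ∈ Submonoid.closure (s ∪ star s), g ∈ range (torusCharMap (n := n)) := by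
    intro g hg
    induction hg using Submonoid.closure_induction with
    | mem g hg =>
      rcases hg with ⟨i, rfl⟩ | ⟨i, hi⟩
      · exact ⟨_, rfl⟩
      · refine ⟨Pi.single i (-1), ?_⟩
        rw [← star_star g, ← hi]
        refine ContinuousMap.ext fun t => ?_
        change (torusChar (Pi.single i (-1)) t : ℂ) = starRingEnd ℂ (torusChar (Pi.single i 1) t : ℂ)
        rw [torusChar_single, torusChar_single, zpow_neg, zpow_one, Circle.coe_inv_eq_conj]
    | one => exact ⟨0, ContinuousMap.ext fun t => by
        change (torusChar 0 t : ℂ) = 1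
        rw [torusChar_zero, Circle.coe_one]⟩
    | mul f g _ _ hf hg =>
      obtain ⟨a, rfl⟩ := hf
      obtain ⟨b, rfl⟩ := hg
      exact ⟨a + b, ContinuousMap.ext fun t => by
        change (torusChar (a + b) t : ℂ) = torusChar a t * torusChar b t
        rw [torusChar_add, Circle.coe_mul]⟩
  have hf' : f ∈ Algebra.adjoin ℂ (s ∪ star s) := hf
  rw [← Subalgebra.mem_toSubmodule, Algebra.adjoin_eq_span] at hf'
  exact Submodule.span_mono hclosure hf'

/-- Characters separate the points of a torus from closed subgroups. -/
theorem exists_torusChar_ne_one {n : ℕ} (K : Subgroup (Torus n))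
    (hK : IsClosed (K : Set (Torus n))) {t : Torus n} (ht : t ∉ K) :
    ∃ m, (∀ k ∈ K, torusChar m k = 1) ∧ torusChar m t ≠ 1 := by
  by_contra! hall
  have : CompactSpace K := isCompact_iff_compactSpace.1 hK.isCompact
  have htK : IsClosed ((fun k => t * k) '' (K : Set (Torus n))) :=
    (Homeomorph.mulLeft t).isClosedMap _ hK
  have hdisj : Disjoint (K : Set (Torus n)) ((fun k => t * k) '' (K : Set (Torus n))) := by
    refine Set.disjoint_left.2 fun a ha hta => ht ?_
    obtain ⟨k, hk, rfl⟩ := hta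
    exact (K.mul_mem_cancel_right hk).1 ha
  obtain ⟨f, hf0, hf1, -⟩ := exists_continuous_zero_one_of_isClosed hK htK hdisj
  let F : C(Torus n, ℂ) := ⟨fun s => (f s : ℂ), Complex.continuous_ofReal.comp f.continuous⟩
  have hcont : ∀ (g : C(Torus n, ℂ)) (s : Torus n), Continuous fun k : K => g (s * k) :=
    fun g s => g.continuous.comp (continuous_const.mul continuous_subtype_val)
  -- A character trivial on `K` is by assumption `1` at `t`, and a character nontrivial on `K` has
  -- mean zero on every coset. So trigonometric polynomials have equal means over `K` and `tK`.
  have hzero : ∀ g ∈ Submodule.span ℂ (range (torusCharMap (n := n))),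
      haarMean (fun k : K => g (t * k)) = haarMean fun k : K => g (1 * k) := by
    intro g hg
    induction hg using Submodule.span_induction with
    | mem g hg =>
      obtain ⟨m, rfl⟩ := hg
      have hmul : ∀ s : Torus n, haarMean (fun k : K => torusCharMap m (s * k)) =
          torusChar m s * haarMean (fun k : K => torusCharMap m k) := fun s => by
        refine Eq.trans ?_ (haarMean_map (ContinuousLinearMap.mul ℝ ℂ (torusChar m s : ℂ))
          ((torusCharMap m).continuous.comp continuous_subtype_val))
        congr 1
        ext1 k
        change (torusChar m (s * k) : ℂ) = torusChar m s * torusChar m k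
        rw [map_mul, Circle.coe_mul]
      by_cases hm : ∀ k ∈ K, torusChar m k = 1
      · rw [hmul, hmul, hall m hm, map_one]
      · push Not at hm
        obtain ⟨k, hk, hkne⟩ := hm
        have h0 : haarMean (fun k : K => torusCharMap m k) = 0 := by
          have h1 := hmul k
          have h2 := haarMean_mul_left (fun k : K => torusCharMap m k) ⟨k, hk⟩
          have h3 : (torusChar m k : ℂ) * haarMean (fun k : K => torusCharMap m k) =
              1 * haarMean (fun k : K => torusCharMap m k) := by
            rw [one_mul, ← h1]
            exact h2
          by_contra hne
          exact hkne (Circle.ext (mul_right_cancel₀ hne h3))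
        rw [hmul, hmul, h0, mul_zero, mul_zero]
    | zero => rfl
    | add g h _ _ hg hh =>
      have h1 : ∀ s : Torus n, haarMean (fun k : K => (g + h) (s * k)) =
          haarMean (fun k : K => g (s * k)) + haarMean fun k : K => h (s * k) := fun s =>
        haarMean_add (hcont g s) (hcont h s)
      rw [h1, h1, hg, hh]
    | smul a g _ hg =>
      have h1 : ∀ s : Torus n, haarMean (fun k : K => (a • g) (s * k)) =
          a * haarMean (fun k : K => g (s * k)) := fun s =>
        haarMean_map (ContinuousLinearMap.mul ℝ ℂ a) (hcont g s)
      rw [h1, h1, hg]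
  -- The means of `F` over `K` and `tK` are `0` and `1`, those of `p` agree, and two errors of `1 /
  -- 4` cannot bridge the gap.
  obtain ⟨p, hp, hpF⟩ := Metric.mem_closure_iff.1 (dense_span_torusCharMap n F) (1 / 4) (by norm_num)
  have hb : ∀ s : Torus n, ‖haarMean (fun k : K => F (s * k)) - haarMean fun k : K => p (s * k)‖ ≤
      1 / 4 := fun s => by
    rw [← haarMean_sub (hcont F s) (hcont p s)]
    refine norm_haarMean_le fun k => ?_
    rw [← dist_eq_norm]
    exact (ContinuousMap.dist_apply_le_dist _).trans hpF.le
  have e1 : haarMean (fun k : K => F (t * k)) = 1 := by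
    have : ∀ k : K, F (t * k) = 1 := fun k => by
      change (f (t * k) : ℂ) = 1
      rw [hf1 ⟨k, k.2, rfl⟩]
      simp
    simp_rw [this]
    exact haarMean_const _
  have e0 : haarMean (fun k : K => F (1 * k)) = 0 := by
    have : ∀ k : K, F (1 * k) = 0 := fun k => by
      change (f (1 * k) : ℂ) = 0
      rw [one_mul, hf0 k.2]
      simp
    simp_rw [this]
    exact haarMean_const _
  have b1 := hb t
  have b0 := hb 1
  rw [e1, hzero p hp] at b1
  rw [e0] at b0
  have := norm_sub_le (1 - haarMean fun k : K => p (1 * k)) (0 - haarMean fun k : K => p (1 * k))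
  rw [sub_sub_sub_cancel_right, sub_zero, norm_one] at this
  linarith

/-- A closed subgroup of the torus is the common kernel of finitely many characters. -/
theorem exists_finset_torusChar {n : ℕ} (K : Subgroup (Torus n))
    (hK : IsClosed (K : Set (Torus n))) : ∃ S : Finset (Fin n → ℤ),
      (∀ m ∈ S, ∀ k ∈ K, torusChar m k = 1) ∧ ∀ t, (∀ m ∈ S, torusChar m t = 1) → t ∈ K := by
  let A : Submodule ℤ (Fin n → ℤ) :=
    { carrier := {m | ∀ k ∈ K, torusChar m k = 1}
      add_mem' := fun ha hb k hk => by rw [torusChar_add, ha k hk, hb k hk, mul_one]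
      zero_mem' := fun k _ => torusChar_zero k
      smul_mem' := fun a m hm k hk => by rw [torusChar_smul, hm k hk, one_zpow] }
  -- The exponents of characters trivial on `K` form a subgroup of `ℤⁿ`, so finitely many generate
  -- it.
  obtain ⟨S, hS⟩ := IsNoetherian.noetherian A
  refine ⟨S, fun m hm => ?_, fun t ht => ?_⟩
  · have : m ∈ A := hS ▸ Submodule.subset_span hm
    exact this
  · by_contra htK
    obtain ⟨m, hm, hne⟩ := exists_torusChar_ne_one K hK htK
    have hspan : ∀ m ∈ Submodule.span ℤ (S : Set (Fin n → ℤ)), torusChar m t = 1 := fun m h => by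
      induction h using Submodule.span_induction with
      | mem m h => exact ht m h
      | zero => exact torusChar_zero t
      | add a b _ _ h1 h2 => rw [torusChar_add, h1, h2, mul_one]
      | smul a m _ h => rw [torusChar_smul, h, one_zpow]
    exact hne (hspan m (hS ▸ (hm : m ∈ A)))

/-- No small subgroups in the circle: `1 - re (w²) = 2 (1 - re w)(1 + re w)`, so while real parts
stay positive, squaring at least doubles the distance `1 - re w`, which would exceed `1`. -/
theorem Circle.eq_one_of_forall_pow_re_pos {z : Circle} (h : ∀ k : ℕ, 0 < ((z ^ k : Circle) : ℂ).re) :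
    z = 1 := by
  have hstep : ∀ w : Circle, 1 - ((w ^ 2 : Circle) : ℂ).re = 2 * (1 - (w : ℂ).re ^ 2) := fun w => by
    have h1 := Circle.normSq_coe w
    rw [Complex.normSq_apply] at h1
    rw [Circle.coe_pow, sq, Complex.mul_re]
    nlinarith
  have hgrow : ∀ k : ℕ, 2 ^ k * (1 - (z : ℂ).re) ≤ 1 - ((z ^ 2 ^ k : Circle) : ℂ).re := by
    intro k
    induction k with
    | zero => simp
    | succ k ih =>
      have h1 := h (2 ^ k)
      have h2 := Complex.re_le_norm ((z ^ 2 ^ k : Circle) : ℂ)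
      rw [Circle.norm_coe] at h2
      have e : z ^ 2 ^ (k + 1) = (z ^ 2 ^ k) ^ 2 := by rw [← pow_mul, ← pow_succ]
      rw [e, hstep, pow_succ]
      nlinarith
  have hre : (z : ℂ).re = 1 := by
    have h2 := Complex.re_le_norm (z : ℂ)
    rw [Circle.norm_coe] at h2
    refine le_antisymm h2 (not_lt.1 fun hlt => ?_)
    obtain ⟨k, hk⟩ := pow_unbounded_of_one_lt (1 / (1 - (z : ℂ).re)) (one_lt_two (α := ℝ))
    rw [div_lt_iff₀ (by linarith)] at hk
    have := hgrow k
    have := h (2 ^ k)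
    linarith
  refine Circle.ext (Complex.ext hre ?_)
  have h1 := Circle.normSq_coe z
  rw [Complex.normSq_apply, hre] at h1
  rw [Circle.coe_one, Complex.one_im]
  nlinarith

end ClosedSubgroups

/-! ### Upper semicontinuity of isotropy and finiteness of the strata. -/

section Strata

variable {n : ℕ} {M : Type*} [TopologicalSpace M]
  [ChartedSpace (EuclideanSpace ℝ (Fin (2 * n))) M] [MulAction (Torus n) M] [TorusManifold n M]
  [T2Space M]

/-- The torus elements where the character has nonpositive real part form a compact set, none of
which fixes `x`; so none fixes a nearby `y`. The character thus maps the isotropy group of `y` to a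
subgroup of the open right half-plane, which is trivial. -/
theorem eventually_torusChar_eq_one {x : M} {m : Fin n → ℤ}
    (hm : ∀ k ∈ stabilizer (Torus n) x, torusChar m k = 1) :
    ∀ᶠ y in 𝓝 x, ∀ t ∈ stabilizer (Torus n) y, torusChar m t = 1 := by
  have hC : IsCompact {t : Torus n | (torusChar m t : ℂ).re ≤ 0} :=
    (isClosed_le (Complex.continuous_re.comp (continuous_subtype_val.comp (torusChar_continuous m)))
      continuous_const).isCompact
  have hev := hC.eventually_forall_of_forall_eventually (x₀ := x)
    (P := fun y t => t • y ≠ y) fun t ht => by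
      have hne : t • x ≠ x := fun h => by
        have h1 := hm t h
        have h2 : (torusChar m t : ℂ).re ≤ 0 := ht
        rw [h1, Circle.coe_one, Complex.one_re] at h2
        linarith
      have hc : Continuous fun z : M × Torus n => z.2 • z.1 :=
        (TorusManifold.continuous_smul (n := n) (M := M)).comp continuous_swap
      exact (isOpen_ne_fun hc continuous_fst).mem_nhds (x := (x, t)) hne
  filter_upwards [hev] with y hy t ht
  refine Circle.eq_one_of_forall_pow_re_pos fun k => ?_
  rw [← map_pow]
  by_contra! hle
  exact hy _ hle ((stabilizer (Torus n) y).pow_mem ht k)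

/-- Isotropy groups are upper semicontinuous. -/
theorem eventually_stabilizer_le (x : M) :
    ∀ᶠ y in 𝓝 x, stabilizer (Torus n) y ≤ stabilizer (Torus n) x := by
  obtain ⟨S, hS1, hS2⟩ := exists_finset_torusChar _ (isClosed_stabilizer (n := n) x)
  have h : ∀ᶠ y in 𝓝 x, ∀ m ∈ S, ∀ t ∈ stabilizer (Torus n) y, torusChar m t = 1 :=
    (Filter.eventually_all_finset S).2 fun m hm => eventually_torusChar_eq_one (hS1 m hm)
  filter_upwards [h] with y hy t ht
  exact hS2 t fun m hm => hy m hm t ht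

theorem isClosed_isotropyZero (x : M) : IsClosed (isotropyZero n x : Set (Torus n)) := by
  have := compactSpace_stabilizer (n := n) x
  have h : IsCompact (connectedComponent (1 : stabilizer (Torus n) x)) :=
    isClosed_connectedComponent.isCompact
  exact (h.image continuous_subtype_val).isClosed

/-- The radial map `z ↦ δ z / (1 + ‖z‖)` carries the punctured plane, connected since its real
dimension exceeds one, onto the punctured disc. -/
theorem isPreconnected_ball_diff_zero {δ : ℝ} (hδ : 0 < δ) :
    IsPreconnected (Metric.ball (0 : ℂ) δ \ {0}) := by
  have h1 : IsPreconnected ({0}ᶜ : Set ℂ) :=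
    (isConnected_compl_singleton_of_one_lt_rank (by simp) 0).isPreconnected
  have h2 : Continuous fun z : ℂ => (δ / (1 + ‖z‖)) • z := by
    refine Continuous.smul (continuous_const.div (continuous_const.add continuous_norm) fun z => ?_)
      continuous_id
    exact (by positivity : (0 : ℝ) < 1 + ‖z‖).ne'
  have h3 := h1.image _ h2.continuousOn
  convert h3 using 1
  ext w
  simp only [mem_sdiff, Metric.mem_ball, dist_zero_right, mem_singleton_iff, mem_image,
    mem_compl_iff]
  constructor
  · rintro ⟨hw, hw0⟩
    have hd : 0 < δ - ‖w‖ := by linarith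
    refine ⟨(δ - ‖w‖)⁻¹ • w, smul_ne_zero (inv_ne_zero hd.ne') hw0, ?_⟩
    rw [norm_smul, norm_inv, Real.norm_of_nonneg hd.le, smul_smul]
    have : δ / (1 + (δ - ‖w‖)⁻¹ * ‖w‖) * (δ - ‖w‖)⁻¹ = 1 := by
      have h0 : 1 + (δ - ‖w‖)⁻¹ * ‖w‖ = δ * (δ - ‖w‖)⁻¹ := by
        field_simp
        ring
      rw [h0, div_mul_eq_mul_div, div_self (mul_ne_zero hδ.ne' (inv_ne_zero hd.ne'))]
    rw [this, one_smul]
  · rintro ⟨z, hz, rfl⟩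
    have hz' : 0 < ‖z‖ := norm_pos_iff.2 hz
    refine ⟨?_, smul_ne_zero (by positivity) hz⟩
    rw [norm_smul, Real.norm_of_nonneg (by positivity), div_mul_eq_mul_div, div_lt_iff₀ (by positivity)]
    nlinarith

/-- In the sup norm this is a product of punctured discs, points and a ball. -/
theorem isPreconnected_box_support {m r : ℕ} {δ : ℝ} (hδ : 0 < δ) (S : Set (Fin m)) :
    IsPreconnected {p : (Fin m → ℂ) × (Fin r → ℝ) |
      p ∈ Metric.ball 0 δ ∧ ∀ i, p.1 i ≠ 0 ↔ i ∈ S} := by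
  classical
  have h1 : IsPreconnected ((Set.univ.pi fun i : Fin m =>
      if i ∈ S then Metric.ball (0 : ℂ) δ \ {0} else {0}) ×ˢ Metric.ball (0 : Fin r → ℝ) δ) := by
    refine IsPreconnected.prod (isPreconnected_univ_pi fun i => ?_) (convex_ball _ _).isPreconnected
    split_ifs
    · exact isPreconnected_ball_diff_zero hδ
    · exact isPreconnected_singleton
  convert h1 using 1
  ext p
  have h0 : (0 : (Fin m → ℂ) × (Fin r → ℝ)) = (0, 0) := rfl
  simp only [mem_ofPred_eq, mem_prod, mem_pi, mem_univ, true_implies]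
  rw [h0, ← ball_prod_same, mem_prod, ball_pi _ hδ, mem_pi]
  constructor
  · rintro ⟨⟨hb, hw⟩, hS⟩
    refine ⟨fun i => ?_, hw⟩
    split_ifs with hi
    · exact ⟨hb i (mem_univ i), (hS i).2 hi⟩
    · exact not_not.1 fun h => hi ((hS i).1 h)
  · rintro ⟨hp, hw⟩
    refine ⟨⟨fun i _ => ?_, hw⟩, fun i => ?_⟩
    · have := hp i
      split_ifs at this with hi
      · exact this.1
      · rw [mem_singleton_iff.1 this]
        exact Metric.mem_ball_self hδ
    · have := hp i
      split_ifs at this with hi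
      · exact ⟨fun _ => hi, fun _ => this.2⟩
      · exact ⟨fun h => absurd this h, fun h => absurd h hi⟩

variable (n) in
/-- The open stratum through the orbit of `x`. -/
noncomputable def stratumThrough (x : M) : Set (OrbitSpace n M) :=
  connectedComponentIn (orbitTypeSet M (isotropyZero n x)) (orbitMk n x)

theorem IsOpenStratum.eq_stratumThrough {H : Subgroup (Torus n)} {C : Set (OrbitSpace n M)}
    (h : IsOpenStratum H C) {x : M} (hx : orbitMk n x ∈ C) : C = stratumThrough n x := by
  have hH : isotropyZero n x = H := orbitMk_mem_orbitTypeSet.1 (h.subset hx)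
  obtain ⟨-, -, q, -, rfl⟩ := h
  rw [stratumThrough, hH]
  exact connectedComponentIn_eq hx

/-- The hypothesis is symmetric in the two points, so the identity components agree throughout `Y`;
the image of `Y` is then a connected subset of a single orbit type set. -/
theorem stratumThrough_eq_of_isPreconnected {Y : Set M} (hY : IsPreconnected Y)
    (hiso : ∀ y ∈ Y, ∀ z ∈ Y, isotropyZero n y ≤ stabilizer (Torus n) z) {y z : M} (hy : y ∈ Y)
    (hz : z ∈ Y) : stratumThrough n y = stratumThrough n z := by
  have hle : ∀ y ∈ Y, ∀ z ∈ Y, isotropyZero n y ≤ isotropyZero n z := fun y hy z hz =>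
    le_isotropyZero (isotropyZero_isConnected y) (hiso y hy z hz)
  have heq : ∀ z ∈ Y, isotropyZero n z = isotropyZero n y := fun z hz =>
    le_antisymm (hle z hz y hy) (hle y hy z hz)
  have hc : Continuous (orbitMk n : M → OrbitSpace n M) := continuous_quotient_mk'
  have himg : IsPreconnected (orbitMk n '' Y) := hY.image _ hc.continuousOn
  have hsub : orbitMk n '' Y ⊆ orbitTypeSet M (isotropyZero n y) := by
    rintro _ ⟨w, hw, rfl⟩
    exact orbitMk_mem_orbitTypeSet.2 (heq w hw)
  rw [stratumThrough, stratumThrough, heq z hz]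
  exact connectedComponentIn_eq (himg.subset_connectedComponentIn (mem_image_of_mem _ hy) hsub
    (mem_image_of_mem _ hz))

variable [IsManifold (𝓡 (2 * n)) ∞ M]

/-- The stratification of the orbit space is locally finite. -/
theorem exists_nhds_finite_strata (x : M) : ∃ U ∈ 𝓝 x, (stratumThrough n '' U).Finite := by
  let H := isotropyZero n x
  have : CompactSpace H := isCompact_iff_compactSpace.1 (isClosed_isotropyZero x).isCompact
  have : ConnectedSpace H := isConnected_iff_connectedSpace.1 (isotropyZero_isConnected x)
  -- Only the identity component is used: the weight decomposition needs a connected group, and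
  -- strata only record identity components.
  let inc : H →* stabilizer (Torus n) x := Subgroup.inclusion (isotropyZero_le x)
  have hinc : Continuous inc := continuous_subtype_val.subtype_mk _
  obtain ⟨m, r, ψ, e, -, he⟩ := exists_weight_decomposition ((isotropyRep n x).comp inc)
    ((isotropyRep_continuous x).comp hinc)
  obtain ⟨Φ, hxΦ, hΦx, hinv, hequiv⟩ := exists_linearization (n := n) x
  have hW : {y | stabilizer (Torus n) y ≤ stabilizer (Torus n) x} ∈ 𝓝 x :=
    eventually_stabilizer_le x
  have hg : ContinuousAt (fun p => Φ.symm (e.symm p)) 0 := by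
    have h1 : ContinuousAt Φ.symm (e.symm 0) := by
      rw [map_zero, ← hΦx]
      exact Φ.symm.continuousAt (Φ.map_source hxΦ)
    exact h1.comp e.symm.continuous.continuousAt
  have hg0 : Φ.symm (e.symm 0) = x := by rw [map_zero, ← hΦx, Φ.left_inv hxΦ]
  have h1 : ∀ᶠ p in 𝓝 (0 : (Fin m → ℂ) × (Fin r → ℝ)),
      stabilizer (Torus n) (Φ.symm (e.symm p)) ≤ stabilizer (Torus n) x :=
    hg.eventually (p := fun y => stabilizer (Torus n) y ≤ stabilizer (Torus n) x) (by
      change ∀ᶠ y in 𝓝 (Φ.symm (e.symm 0)), _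
      rw [hg0]
      exact hW)
  have h2 : ∀ᶠ p in 𝓝 (0 : (Fin m → ℂ) × (Fin r → ℝ)), e.symm p ∈ Φ.target := by
    refine e.symm.continuous.continuousAt.eventually_mem (Φ.open_target.mem_nhds ?_)
    rw [map_zero, ← hΦx]
    exact Φ.map_source hxΦ
  obtain ⟨δ, hδ, hball⟩ := Metric.eventually_nhds_iff_ball.1 (h1.and h2)
  let g : (Fin m → ℂ) × (Fin r → ℝ) → M := fun p => Φ.symm (e.symm p)
  have hgcont : ContinuousOn g (Metric.ball 0 δ) :=
    Φ.symm.continuousOn.comp e.symm.continuous.continuousOn fun p hp => (hball p hp).2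
  have heΦ : ∀ p ∈ Metric.ball 0 δ, e (Φ (g p)) = p := fun p hp => by
    simp only [g]
    rw [Φ.right_inv (hball p hp).2, ContinuousLinearEquiv.apply_symm_apply]
  have hgs : ∀ p ∈ Metric.ball 0 δ, g p ∈ Φ.source := fun p hp => Φ.map_target (hball p hp).2
  refine ⟨g '' Metric.ball 0 δ, ?_, ?_⟩
  · have h3 : ContinuousAt (fun y => e (Φ y)) x :=
      e.continuous.continuousAt.comp (Φ.continuousAt hxΦ)
    have h4 : ∀ᶠ y in 𝓝 x, e (Φ y) ∈ Metric.ball 0 δ := by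
      refine h3.eventually_mem (Metric.isOpen_ball.mem_nhds ?_)
      rw [hΦx, map_zero]
      exact Metric.mem_ball_self hδ
    filter_upwards [h4, Φ.open_source.mem_nhds hxΦ] with y hy hys
    refine ⟨e (Φ y), hy, ?_⟩
    simp only [g]
    rw [ContinuousLinearEquiv.symm_apply_apply, Φ.left_inv hys]
  -- The ball is cut into finitely many pieces according to which complex coordinates are nonzero;
  -- each piece will lie in one stratum.
  · let D : Set (Fin m) → Set ((Fin m → ℂ) × (Fin r → ℝ)) := fun S =>
      {p | p ∈ Metric.ball 0 δ ∧ ∀ i, p.1 i ≠ 0 ↔ i ∈ S}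
    have hD : ∀ S, (stratumThrough n '' (g '' D S)).Subsingleton := by
      intro S
      have hpre : IsPreconnected (g '' D S) :=
        (isPreconnected_box_support hδ S).image _ (hgcont.mono fun p hp => hp.1)
      rintro _ ⟨y, hy, rfl⟩ _ ⟨z, hz, rfl⟩
      refine stratumThrough_eq_of_isPreconnected hpre ?_ hy hz
      rintro _ ⟨p, hp, rfl⟩ _ ⟨q, hq, rfl⟩ t ht
      -- The identity component at `g p` lies in the isotropy group of `x` by semicontinuity, and
      -- being connected it lies in `H`, where the weights are available.
      have htH : t ∈ H := le_isotropyZero (isotropyZero_isConnected _)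
        ((isotropyZero_le (g p)).trans (hball p hp.1).1) ht
      have hact : ∀ u ∈ Metric.ball 0 δ, e (Φ (t • g u)) =
          (fun i => ψ i ⟨t, htH⟩ * u.1 i, u.2) := fun u hu => by
        have h5 := hequiv (inc ⟨t, htH⟩) (g u) (hgs u hu)
        have h6 := he ⟨t, htH⟩ (Φ (g u))
        rw [heΦ u hu] at h6
        exact (congrArg e h5).trans h6
      have h7 := hact p hp.1
      rw [mem_stabilizer_iff.1 (isotropyZero_le _ ht), heΦ p hp.1] at h7
      -- Since `t` fixes `p`, it acts trivially on every nonzero coordinate of `p`. The point `q`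
      -- has the same support, so `t` fixes it too.
      have h8 : ∀ i ∈ S, (ψ i ⟨t, htH⟩ : ℂ) = 1 := fun i hi => by
        have h9 : p.1 i = ψ i ⟨t, htH⟩ * p.1 i := congrFun (congrArg Prod.fst h7) i
        exact mul_right_cancel₀ ((hp.2 i).2 hi) (h9.symm.trans (one_mul _).symm)
      have h10 : (fun i => (ψ i ⟨t, htH⟩ : ℂ) * q.1 i, q.2) = q := by
        refine Prod.ext (funext fun i => ?_) rfl
        by_cases hi : i ∈ S
        · simp [h8 i hi]
        · have : q.1 i = 0 := not_not.1 fun h => hi ((hq.2 i).1 h)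
          simp [this]
      refine Φ.injOn (hinv (inc ⟨t, htH⟩) (g q) (hgs q hq.1)) (hgs q hq.1) (e.injective ?_)
      rw [heΦ q hq.1]
      exact (hact q hq.1).trans h10
    refine (Set.finite_iUnion fun S => (hD S).finite).subset ?_
    rintro _ ⟨_, ⟨p, hp, rfl⟩, rfl⟩
    exact mem_iUnion.2 ⟨{i | p.1 i ≠ 0}, ⟨g p, ⟨p, ⟨hp, fun i => Iff.rfl⟩, rfl⟩, rfl⟩⟩

/-- A closed torus manifold has only finitely many strata. -/
theorem finite_closedStrata [CompactSpace M] : Finite (ClosedStrata n M) := by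
  choose U hU hfin using exists_nhds_finite_strata (n := n) (M := M)
  obtain ⟨s, hs⟩ := isCompact_univ.elim_nhds_subcover U fun x _ => hU x
  have hrange : (range (stratumThrough n : M → Set (OrbitSpace n M))).Finite := by
    refine (s.finite_toSet.biUnion fun x _ => hfin x).subset ?_
    rintro _ ⟨y, rfl⟩
    obtain ⟨x, hxs, hxy⟩ := mem_iUnion₂.1 (hs.2 (mem_univ y))
    exact mem_iUnion₂.2 ⟨x, hxs, mem_image_of_mem _ hxy⟩
  refine ((hrange.image closure).subset ?_).to_subtype
  rintro F ⟨H, C, hC, rfl⟩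
  obtain ⟨q, hq⟩ := hC.nonempty
  obtain ⟨x, rfl⟩ := Quotient.exists_rep q
  exact ⟨C, ⟨x, (hC.eq_stratumThrough hq).symm⟩, rfl⟩

end Strata

/-! ### Fixed points as closed strata. -/

section FixedPointStrata

variable {n : ℕ} {M : Type*} [TopologicalSpace M] [T2Space M]
  [ChartedSpace (EuclideanSpace ℝ (Fin (2 * n))) M] [MulAction (Torus n) M] [TorusManifold n M]

theorem isClosed_orbit (x : M) : IsClosed (orbit (Torus n) x) := by
  have hc : Continuous fun t : Torus n => t • x :=
    (TorusManifold.continuous_smul (n := n) (M := M)).comp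
      (by fun_prop : Continuous fun t : Torus n => (t, x))
  exact (isCompact_range hc).isClosed

theorem t1Space_orbitSpace : T1Space (OrbitSpace n M) := by
  refine ⟨fun q => ?_⟩
  obtain ⟨x, rfl⟩ := Quotient.exists_rep q
  refine (isQuotientMap_quotient_mk' (s := orbitRel (Torus n) M)).isClosed_preimage.1 ?_
  convert isClosed_orbit (n := n) x using 1
  ext y
  exact orbitMk_eq_iff (n := n) (x := y) (y := x)

theorem isotropyZero_eq_top_iff {x : M} : isotropyZero n x = ⊤ ↔ ∀ t : Torus n, t • x = x := by
  constructor
  · intro h t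
    exact isotropyZero_le x (h ▸ Subgroup.mem_top t)
  · intro h
    refine top_le_iff.1 (le_isotropyZero ?_ fun t _ => h t)
    rw [Subgroup.coe_top]
    exact isConnected_univ

variable [CompactSpace M] [ConnectedSpace M] [IsManifold (𝓡 (2 * n)) ∞ M]

theorem orbitTypeSet_top_finite : (orbitTypeSet M (⊤ : Subgroup (Torus n))).Finite := by
  refine ((finite_setOf_fixed (n := n) (M := M)).image (orbitMk n)).subset ?_
  rintro _ ⟨x, rfl, hx⟩
  exact ⟨x, isotropyZero_eq_top_iff.1 hx, rfl⟩

/-- The orbit of a fixed point is a closed stratum. -/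
theorem singleton_mem_closedStrata {x : M} (hx : ∀ t : Torus n, t • x = x) :
    ∃ (H : Subgroup (Torus n)) (C : Set (OrbitSpace n M)),
      IsOpenStratum H C ∧ {orbitMk n x} = closure C := by
  have := t1Space_orbitSpace (n := n) (M := M)
  have hmem : orbitMk n x ∈ orbitTypeSet M (⊤ : Subgroup (Torus n)) :=
    orbitMk_mem_orbitTypeSet.2 (isotropyZero_eq_top_iff.2 hx)
  have hsub : (connectedComponentIn (orbitTypeSet M (⊤ : Subgroup (Torus n)))
      (orbitMk n x)).Subsingleton := by
    -- A nontrivial connected set in a T1 space is infinite, but there are only finitely many fixed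
    -- orbits.
    rw [← not_nontrivial_iff]
    exact fun h => isPreconnected_connectedComponentIn.infinite_of_nontrivial h
      (orbitTypeSet_top_finite.subset (connectedComponentIn_subset _ _))
  refine ⟨⊤, _, ⟨?_, ?_, orbitMk n x, hmem, rfl⟩, ?_⟩
  · rw [Subgroup.coe_top]
    exact isClosed_univ
  · rw [Subgroup.coe_top]
    exact isConnected_univ
  · rw [hsub.eq_singleton_of_mem (mem_connectedComponentIn hmem), closure_singleton]

/-- The one-point orbit of `x` is an element of the poset, so acting trivially on the poset forces
`φ x` into the orbit of `x`, which is `{x}`. -/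
theorem apply_fixed_eq_of_normalizerToAutStrata_eq_one {φ : TorusNormalizer n M}
    (hφ : normalizerToAutStrata n M φ = 1) {x : M} (hx : ∀ t : Torus n, t • x = x) :
    φ.1 x = x := by
  have h : orbitMap φ '' {orbitMk n x} = {orbitMk n x} :=
    congrArg Subtype.val (DFunLike.congr_fun hφ
      (⟨{orbitMk n x}, singleton_mem_closedStrata hx⟩ : ClosedStrata n M))
  rw [image_singleton, orbitMap_mk, singleton_eq_singleton_iff] at h
  obtain ⟨t, ht⟩ := orbitMk_eq_iff.1 h
  rw [← ht, hx]

end FixedPointStrata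

/-! ### Finite image, and isometries in the kernel. -/

section Kernel

variable {n : ℕ} {M : Type*} [TopologicalSpace M] [T2Space M] [CompactSpace M] [ConnectedSpace M]
  [ChartedSpace (EuclideanSpace ℝ (Fin (2 * n))) M] [IsManifold (𝓡 (2 * n)) ∞ M]
  [MulAction (Torus n) M] [TorusManifold n M]

theorem finite_range_charHom : Finite (charHom n M).range := by
  have := finite_closedStrata (n := n) (M := M)
  have h1 : Finite (ClosedStrata n M ≃o ClosedStrata n M) :=
    Finite.of_injective (fun f => (f : ClosedStrata n M → ClosedStrata n M)) DFunLike.coe_injective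
  have h2 : ((univ : Set (ClosedStrata n M ≃o ClosedStrata n M)) ×ˢ
      range (normalizerToAutTorus n M)).Finite :=
    finite_univ.prod finite_range_normalizerToAutTorus
  have h3 : ((charHom n M).range : Set (charPairAut n M)) ⊆ Subtype.val ⁻¹' (univ ×ˢ
      range (normalizerToAutTorus n M)) := by
    rintro _ ⟨q, rfl⟩
    obtain ⟨φ, rfl⟩ := QuotientGroup.mk_surjective q
    exact ⟨mem_univ _, φ, rfl⟩
  exact ((h2.preimage Subtype.val_injective.injOn).subset h3).to_subtype

/-- An isometry which normalizes the torus and acts trivially on the closed strata and on the torus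
is given by an element of the torus. -/
theorem exists_eq_torusToDiff {φ : TorusNormalizer n M}
    (hS : normalizerToAutStrata n M φ = 1) (hT : normalizerToAutTorus n M φ = 1)
    (g : InvariantMetric n M) (hg : g.1.pullback φ.1 = g.1) :
    ∃ t, torusToDiff n M t = φ.1 := by
  obtain ⟨x, hx⟩ := TorusManifold.exists_fixedPoint (n := n) (M := M)
  have hφx : φ.1 x = x := apply_fixed_eq_of_normalizerToAutStrata_eq_one hS hx
  have hconj : ∀ t, conjTorus n M φ t = t := fun t => DFunLike.congr_fun hT t
  obtain ⟨c⟩ := nonempty_torusCoordinates hx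
  have hcomm : ∀ t v, φ.1.tangentMap x (isotropyDeriv n x t v) =
      isotropyDeriv n x t (φ.1.tangentMap x v) := fun t v => by
    have h := tangentMap_isotropyDeriv φ (hx t) v
    rwa [hφx, hconj] at h
  have hinv : ∀ (ψ : Diff (2 * n) M), g.1.pullback ψ = g.1 → ψ x = x → ∀ v,
      g.1.inner x (ψ.tangentMap x v) (ψ.tangentMap x v) = g.1.inner x v v := fun ψ hψ hψx v => by
    have h := g.1.pullback_apply ψ x v v
    rw [hψ, hψx] at h
    exact h.symm
  obtain ⟨t, ht⟩ := exists_isotropyDeriv_eq c (φ.1.tangentMap x) hcomm (g.1.inner x)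
    (g.1.pos x) (fun t v => hinv (torusToDiff n M t) (g.2 t) (hx t) v) (hinv φ.1 hg hφx)
  -- `t` was chosen with the same derivative at `x` as `φ`, so this quotient is an isometry fixing
  -- `x` to first order, and rigidity applies.
  have h1 : (torusToDiff n M t)⁻¹ * φ.1 = 1 := by
    refine Diff.eq_one_of_isometry _ g.1 ?_ (x₀ := x) ?_ fun v => ?_
    · rw [RiemMetric.pullback_mul, ← map_inv, g.2, hg]
    · rw [Diff.mul_apply, hφx, ← map_inv]
      exact hx t⁻¹
    · have h2 := Diff.tangentMap_mul (torusToDiff n M t)⁻¹ φ.1 x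
      have h3 := Diff.tangentMap_inv_apply (torusToDiff n M t) x v
      rw [torusToDiff_apply, hx] at h3
      rw [hφx] at h2
      exact (DFunLike.congr_fun h2 v).trans
        ((congrArg ((torusToDiff n M t)⁻¹.tangentMap x) (ht v)).trans h3)
  exact ⟨t, inv_mul_eq_one.1 h1⟩

end Kernel

/-- Let `M` be a closed connected torus manifold. The kernel of the natural homomorphism
`𝒟(M,T) → Aut(𝒫, λ)` has finite index in `𝒟(M,T)` and acts freely on `ℛ(M,T)`. -/
theorem mainTheorem7 (n : ℕ) (M : Type*) [TopologicalSpace M] [T2Space M] [CompactSpace M]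
    [ConnectedSpace M] [ChartedSpace (EuclideanSpace ℝ (Fin (2 * n))) M]
    [IsManifold (𝓡 (2 * n)) ∞ M] [MulAction (Torus n) M] [TorusManifold n M] :
    (charHom n M).ker.FiniteIndex ∧
      ∀ φ ∈ (charHom n M).ker, ∀ g : InvariantMetric n M, φ • g = g → φ = 1 := by
  have := finite_range_charHom (n := n) (M := M)
  refine ⟨Subgroup.finiteIndex_ker _, fun q hq g hg => ?_⟩
  obtain ⟨φ, rfl⟩ := QuotientGroup.mk_surjective q
  have hker : normalizerToCharPairAut n M φ = 1 := hq
  have hpair : (normalizerToAutStrata n M φ, normalizerToAutTorus n M φ) = 1 :=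
    congrArg Subtype.val hker
  have hg' : g.1.pullback φ.1⁻¹ = g.1 := congrArg Subtype.val hg
  have hφg : g.1.pullback φ.1 = g.1 := by
    conv_lhs => rw [← hg', ← RiemMetric.pullback_mul, inv_mul_cancel, RiemMetric.pullback_one]
  obtain ⟨t, ht⟩ := exists_eq_torusToDiff (congrArg Prod.fst hpair) (congrArg Prod.snd hpair) g hφg
  exact (QuotientGroup.eq_one_iff φ).2 ⟨t, ht⟩
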